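/- Label the four sides of a quadrilateral (a closed square $Q$), read consecutively around its boundary, by a word $w=x_1x_2x_3x_4$ in letters $a^{\pm1},b^{\pm1},\dots$ in which no letter occurs (with any exponent) more than twice and at least one letter occurs twice; call $w$ a gluing scheme. Let $S_w$ be the quotient space of $Q$ obtained by gluing, for each letter that occurs twice, the two sides that carry it: if $g,h:[0,1]\to Q$ are these sides, parametrized affinely in the direction of travel around the boundary, then $g(t)\sim h(t)$ for all $t$ if the two exponents are equal, and $g(t)\sim h(1-t)$ for all $t$ if they are different. Sides whose letter occurs once stay free. Two gluing schemes are equivalent if they are related by a chain of the following operations: relabeling (an injective renaming of the letters, combined with inverting all occurrences of some letters), cyclic permutation of the word (rotation), and reversing the word with all exponents inverted (reflection). Let $V$, $E$, $F$ be the numbers of vertices, edges and faces of the graph in $S_w$ that is the image of the boundary of $Q$: vertices are images of corners, edges are images of sides, and faces are connected components of the complement of the graph. Put $\chi(S_w)=V-E+F$. Call a surface orientable if no subset of it is homeomorphic to a Möbius band. The boundary components of a surface are the connected components of the set of points that have no open neighbourhood homeomorphic to $\mathbb R^2$. Then: 1. Every gluing scheme is equivalent to exactly one of the ten schemes $aa^{-1}bc$,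 $aa^{-1}bb^{-1}$, $aa^{-1}bb$, $aabc$, $aabb$, $aba^{-1}c$, $aba^{-1}b^{-1}$, $aba^{-1}b$, $abac$, $abab$. 2. Equivalent gluing schemes give homeomorphic surfaces. Up to homeomorphism, exactly seven surfaces $S_w$ arise: the sphere, the torus, the closed disc, the closed annulus, the projective plane, the Klein bottle and the closed Möbius band, and these are pairwise not homeomorphic. 3. The invariants of these surfaces, and the number $n$ of equivalence classes of gluing schemes $w$ for which $S_w$ is homeomorphic to the given surface, are as follows. $$\begin{array}{l|ccccccc} & \text{sphere} & \text{torus} & \text{disc} & \text{annulus} & \text{projective plane} & \text{Klein bottle} & \text{Möbius band}\\\hline \chi & 2 & 0 & 1 & 0 & 1 & 0 & 0\\ \text{orientable} & \text{yes} & \text{yes} & \text{yes} & \text{yes} & \text{no} & \text{no} & \text{no}\\ \text{boundary components} & 0 & 0 & 1 & 2 & 0 & 0 & 1\\ n & 1 & 1 & 1 & 1 & 2 & 2 & 2 \end{array}$$ -/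

import Mathlib

namespace QuadGluing

/-- A side of the polygon carries a letter and an exponent: `(a, false)` is `a` and `(a, true)` is
`a⁻¹` (the side is oriented against the chosen direction of travel). A labeling scheme of the
quadrilateral is a word of length four in which no letter occurs three times; it is a (full or
partial) gluing if at least one letter occurs twice. -/
@[ext]
structure GluingScheme where
  word : Fin 4 → ℕ × Bool
  at_most_twice : ∀ i j k : Fin 4, i ≠ j → j ≠ k → i ≠ k →
    ¬ ((word i).1 = (word j).1 ∧ (word j).1 = (word k).1)
  glued : ∃ i j : Fin 4, i ≠ j ∧ (word i).1 = (word j).1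

/-- The three elementary operations: relabeling (renaming the letters and, for each letter,
possibly inverting all of its occurrences), cyclic permutation (rotation of the polygon), and flip
(reflection of the polygon). -/
inductive Move : GluingScheme → GluingScheme → Prop
  | relabel (w w' : GluingScheme) (σ : Equiv.Perm ℕ) (s : ℕ → Bool)
      (h : ∀ i, w'.word i = (σ (w.word i).1, xor (w.word i).2 (s (w.word i).1))) : Move w w'
  | permute (w w' : GluingScheme) (h : ∀ i, w'.word i = w.word (i + 1)) : Move w w'
  | flip (w w' : GluingScheme)
      (h : ∀ i, w'.word i = ((w.word i.rev).1, !(w.word i.rev).2)) : Move w w'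

/-- Two schemes are equivalent if a chain of elementary operations leads from one to the other. -/
def schemeSetoid : Setoid GluingScheme := Relation.EqvGen.setoid Move

/-- Gluing schemes up to rotation, reflection and relabeling. -/
abbrev SchemeClass : Type := Quotient schemeSetoid

/-- The quadrilateral. -/
abbrev Square : Type := unitInterval × unitInterval

/-- The four sides of the square, as consecutive paths once around its boundary. -/
def side : Fin 4 → unitInterval → Square
  | 0, t => (t, 0)
  | 1, t => (1, t)
  | 2, t => (unitInterval.symm t, 1)
  | 3, t => (0, unitInterval.symm t)

/-- The identifications prescribed by a scheme: two different sides with the same letter are glued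
in the direction of travel if the exponents agree, and against it if they differ. -/
inductive Glue (w : GluingScheme) : Square → Square → Prop
  | same (i j : Fin 4) (t : unitInterval) (hij : i ≠ j) (h : (w.word i).1 = (w.word j).1)
      (he : (w.word i).2 = (w.word j).2) : Glue w (side i t) (side j t)
  | opposite (i j : Fin 4) (t : unitInterval) (hij : i ≠ j) (h : (w.word i).1 = (w.word j).1)
      (he : (w.word i).2 ≠ (w.word j).2) : Glue w (side i t) (side j (unitInterval.symm t))

/-- The space obtained from the quadrilateral by the gluing, with the quotient topology. (`Quot`
is the quotient by the equivalence relation generated by `Glue w`.) -/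
abbrev Surface (w : GluingScheme) : Type := Quot (Glue w)

/-- The quotient map from the quadrilateral to the glued surface. -/
def proj (w : GluingScheme) : Square → Surface w := Quot.mk (Glue w)

/-- The graph embedded in the surface: the image of the boundary of the quadrilateral. -/
def graph (w : GluingScheme) : Set (Surface w) := ⋃ i, proj w '' Set.range (side i)

/-- `V - E + F` for the embedded graph: the vertices are the images of the corners, the edges are
the images of the sides, the faces are the connected components of the complement. -/
noncomputable def eulerCharacteristic (w : GluingScheme) : ℤ :=
  ((Set.range fun i => proj w (side i 0)).ncard : ℤ)
    - ((Set.range fun i => proj w '' Set.range (side i)).ncard : ℤ)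
    + (Nat.card (ConnectedComponents ↥(graph w)ᶜ) : ℤ)

/-- The unit sphere in `ℝ³`. -/
abbrev Sphere : Type := Metric.sphere (0 : EuclideanSpace ℝ (Fin 3)) 1

/-- The torus. -/
abbrev Torus : Type := Circle × Circle

/-- The closed unit disc in `ℝ²`. -/
abbrev Disc : Type := Metric.closedBall (0 : EuclideanSpace ℝ (Fin 2)) 1

/-- The closed annulus. -/
abbrev Annulus : Type := Circle × unitInterval

/-- The projective plane: the sphere with antipodal points identified. -/
abbrev ProjectivePlane : Type := Quot fun x y : Sphere => y = -x

/-- The Klein bottle: the cylinder `[0,1] × S¹` with `(0, z)` and `(1, z⁻¹)` identified. -/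
abbrev KleinBottle : Type :=
  Quot fun p q : unitInterval × Circle => ∃ z : Circle, p = (0, z) ∧ q = (1, z⁻¹)

/-- The closed Möbius band: the strip `[0,1] × [0,1]` with `(0, t)` and `(1, 1 - t)` identified. -/
abbrev MoebiusBand : Type :=
  Quot fun p q : unitInterval × unitInterval =>
    ∃ t : unitInterval, p = (0, t) ∧ q = (1, unitInterval.symm t)

/-- A surface is orientable if no subset of it is homeomorphic to a Möbius band. -/
def IsOrientable (X : Type) [TopologicalSpace X] : Prop :=
  ¬ ∃ A : Set X, Nonempty (A ≃ₜ MoebiusBand)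

/-- The boundary of a surface: the points without a neighbourhood homeomorphic to the plane. -/
def boundary (X : Type) [TopologicalSpace X] : Set X :=
  {x | ¬ ∃ U : Set X, IsOpen U ∧ x ∈ U ∧ Nonempty (U ≃ₜ EuclideanSpace ℝ (Fin 2))}

/-- The number of boundary components of a surface. -/
noncomputable def boundaryComponents (X : Type) [TopologicalSpace X] : ℕ∞ :=
  ENat.card (ConnectedComponents (boundary X))

/-- Names for the seven surfaces. -/
inductive SurfaceType
  | sphere | torus | disc | annulus | projectivePlane | kleinBottle | moebiusBand

namespace SurfaceType

/-- The standard model of each of the seven surfaces. -/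
noncomputable def model : SurfaceType → TopCat.{0}
  | sphere => TopCat.of Sphere
  | torus => TopCat.of Torus
  | disc => TopCat.of Disc
  | annulus => TopCat.of Annulus
  | projectivePlane => TopCat.of ProjectivePlane
  | kleinBottle => TopCat.of KleinBottle
  | moebiusBand => TopCat.of MoebiusBand

/-- The row of Euler characteristics in the table. -/
def chi : SurfaceType → ℤ
  | sphere => 2
  | torus => 0
  | disc => 1
  | annulus => 0
  | projectivePlane => 1
  | kleinBottle => 0
  | moebiusBand => 0

/-- The row of the table that says whether the surface is orientable. -/
def orientable : SurfaceType → Bool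
  | sphere => true
  | torus => true
  | disc => true
  | annulus => true
  | projectivePlane => false
  | kleinBottle => false
  | moebiusBand => false

/-- The row of numbers of boundary components in the table. -/
def boundaryCount : SurfaceType → ℕ
  | sphere => 0
  | torus => 0
  | disc => 1
  | annulus => 2
  | projectivePlane => 0
  | kleinBottle => 0
  | moebiusBand => 1

/-- The row of numbers of gluing schemes in the table. -/
def schemeCount : SurfaceType → ℕ
  | sphere => 1
  | torus => 1
  | disc => 1
  | annulus => 1
  | projectivePlane => 2
  | kleinBottle => 2
  | moebiusBand => 2

end SurfaceType

/-- Two schemes are topologically the same if the glued surfaces are homeomorphic. -/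
def homeoSetoid : Setoid GluingScheme where
  r w w' := Nonempty (Surface w ≃ₜ Surface w')
  iseqv :=
    { refl := fun _ => ⟨Homeomorph.refl _⟩
      symm := fun ⟨e⟩ => ⟨e.symm⟩
      trans := fun ⟨e⟩ ⟨f⟩ => ⟨e.trans f⟩ }

/-- The ten gluing schemes of the quadrilateral, in order
`a a⁻¹ b c`, `a a⁻¹ b b⁻¹`, `a a⁻¹ b b`, `a a b c`, `a a b b`,
`a b a⁻¹ c`, `a b a⁻¹ b⁻¹`, `a b a⁻¹ b`, `a b a c`, `a b a b`. -/
def listed : Fin 10 → GluingScheme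
  | 0 => ⟨![(0, false), (0, true), (1, false), (2, false)], by decide, by decide⟩
  | 1 => ⟨![(0, false), (0, true), (1, false), (1, true)], by decide, by decide⟩
  | 2 => ⟨![(0, false), (0, true), (1, false), (1, false)], by decide, by decide⟩
  | 3 => ⟨![(0, false), (0, false), (1, false), (2, false)], by decide, by decide⟩
  | 4 => ⟨![(0, false), (0, false), (1, false), (1, false)], by decide, by decide⟩
  | 5 => ⟨![(0, false), (1, false), (0, true), (2, false)], by decide, by decide⟩
  | 6 => ⟨![(0, false), (1, false), (0, true), (1, true)], by decide, by decide⟩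
  | 7 => ⟨![(0, false), (1, false), (0, true), (1, false)], by decide, by decide⟩
  | 8 => ⟨![(0, false), (1, false), (0, false), (2, false)], by decide, by decide⟩
  | 9 => ⟨![(0, false), (1, false), (0, false), (1, false)], by decide, by decide⟩

end QuadGluing

namespace QuadGluing

open Set Filter Topology unitInterval
open scoped Real

/-! ### Angles and degrees of maps to the circle -/

section Lifting

/-! The combinatorial half is elementary. The numbers of glued pairs of sides at a given distance
and with a given relative exponent (`gluedPairs`) do not change under the moves, and they separate
the ten listed schemes. Conversely, a scheme is determined up to relabeling by which sides share a
letter and with which relative exponents (`move_of_pattern`). After a rotation, side 0 is glued to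
side 1 or to side 2, and a short case split reaches a listed scheme.

Equivalent schemes have homeomorphic surfaces because each move is realised by a symmetry of the
square. For each listed scheme there is an explicit continuous map from the square onto the standard
model whose fibres are exactly the gluing classes. Since the square is compact and the model
Hausdorff, the map induces a homeomorphism (`quotHomeo`).

The models are told apart by three invariants, all resting on the covering `Circle.exp` and on
degrees of loops. (a) Boundary: an edge point of a convex set has no planar neighbourhood, since a
small circle around it in a chart could be contracted without meeting it
(`not_isPlanarAt_of_convex`). (b) Orientability: a Möbius band does not embed in the plane, because
one winding number would be both odd and even (`not_injective_moebiusBand_complex`). The disc and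
the annulus are planar. On the sphere a band misses a point or would be the whole sphere. On the
torus a band lifts to a planar cylinder. In the Klein bottle and the projective plane, bands are
exhibited. (c) `AngleLifts`, whether all circle-valued maps have continuous angles, separates the
sphere from the torus and the projective plane from the Klein bottle, which (a) and (b) leave
undecided.

`V - E + F` is invariant under the moves (`Move.eulerCharacteristic_eq`) and is counted for the
listed schemes: there is always one face, edges correspond to letters, and vertices are classes of
glued corners. Since the models are pairwise different, the surface determines the type of the
listed scheme, and hence this number. -/

theorem exists_circle_lift (f : C(ℝ × ℝ, Circle)) :
    ∃ g : C(ℝ × ℝ, ℝ), ∀ x, Circle.exp (g x) = f x := by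
  obtain ⟨e₀, he⟩ := Circle.exp_surjective (f 0)
  obtain ⟨F, ⟨-, hF⟩, -⟩ := Circle.isCoveringMap_exp.existsUnique_continuousMap_lifts f 0 e₀ he
  exact ⟨F, fun x => congrFun hF x⟩

theorem circle_lift_unique {X : Type*} [TopologicalSpace X] [PreconnectedSpace X] {g₁ g₂ : X → ℝ}
    (h₁ : Continuous g₁) (h₂ : Continuous g₂) (h : ∀ x, Circle.exp (g₁ x) = Circle.exp (g₂ x))
    (x₀ : X) (h₀ : g₁ x₀ = g₂ x₀) (x : X) : g₁ x = g₂ x :=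
  congrFun (Circle.isCoveringMap_exp.eq_of_comp_eq h₁ h₂ (funext h) x₀ h₀) x

/-- Uniqueness of lifts propagates the integer found at one point. It serves later as the degree of
a loop and as the jump of an angle across a glued side. -/
theorem circle_lift_sub {X : Type*} [TopologicalSpace X] [PreconnectedSpace X] [Nonempty X]
    {g₁ g₂ : X → ℝ} (h₁ : Continuous g₁) (h₂ : Continuous g₂)
    (h : ∀ x, Circle.exp (g₁ x) = Circle.exp (g₂ x)) :
    ∃ n : ℤ, ∀ x, g₁ x = g₂ x + n * (2 * π) := by
  obtain ⟨x₀⟩ := ‹Nonempty X›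
  obtain ⟨n, hn⟩ := Circle.exp_eq_exp.1 (h x₀)
  refine ⟨n, circle_lift_unique h₁ (by fun_prop) (fun x => ?_) x₀ hn⟩
  rw [h, Circle.exp_add, Circle.exp_int_mul_two_pi, mul_one]

/-- The degree of the loops in a homotopy of loops is constant. -/
theorem exists_circle_lift_periodic (f : C(ℝ × ℝ, Circle)) (T : ℝ)
    (hT : ∀ s u, f (s + T, u) = f (s, u)) :
    ∃ g : C(ℝ × ℝ, ℝ), (∀ x, Circle.exp (g x) = f x) ∧
      ∃ n : ℤ, ∀ s u, g (s + T, u) = g (s, u) + n * (2 * π) := by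
  obtain ⟨g, hg⟩ := exists_circle_lift f
  obtain ⟨n, hn⟩ := circle_lift_sub (X := ℝ × ℝ) (g₁ := fun x => g (x.1 + T, x.2)) (g₂ := g)
    (by fun_prop) (by fun_prop) (fun x => by simp [hg, hT])
  exact ⟨g, hg, n, fun s u => hn (s, u)⟩

/-- The direction of a nonzero complex number. -/
noncomputable def direction (z : {z : ℂ // z ≠ 0}) : Circle :=
  ⟨z.1 / ‖z.1‖, by
    simp [Submonoid.unitSphere, norm_ne_zero_iff.2 z.2]⟩

theorem coe_direction (z : {z : ℂ // z ≠ 0}) : (direction z : ℂ) = z.1 / ‖z.1‖ := rfl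

theorem continuous_direction : Continuous direction := by
  refine Continuous.subtype_mk (Continuous.div continuous_subtype_val (by fun_prop) ?_) _
  rintro ⟨z, hz⟩
  simpa using hz

/-- The identity loop of the circle is not null-homotopic in the punctured plane. -/
theorem not_nullhomotopic (H : C(ℝ × ℝ, ℂ)) (h₀ : ∀ x, H x ≠ 0)
    (hT : ∀ s u, H (s + 2 * π, u) = H (s, u)) {c : ℂ} (hc : ∀ s, H (s, 0) = c) {r : ℝ} (hr : 0 < r)
    (h1 : ∀ s, H (s, 1) = r * Circle.exp s) : False := by
  let f : C(ℝ × ℝ, Circle) := ⟨fun x => direction ⟨H x, h₀ x⟩, continuous_direction.comp (by fun_prop)⟩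
  have hf : ∀ x, f x = direction ⟨H x, h₀ x⟩ := fun _ => rfl
  obtain ⟨g, hg, n, hn⟩ := exists_circle_lift_periodic f (2 * π) (fun s u => by simp [hf, hT])
  -- The lift of the constant loop is constant, so `n = 0`; the lift of the identity loop is a
  -- translation, which grows by `2π` over a period. Both loops have the same `n`.
  have e0 := circle_lift_unique (X := ℝ) (g₁ := fun s => g (s, 0)) (g₂ := fun s => g (0, 0))
    (by fun_prop) (by fun_prop) (fun s => by simp [hg, hf, hc]) 0 rfl
  have e1 := circle_lift_unique (X := ℝ) (g₁ := fun s => g (s, 1)) (g₂ := fun s => s + g (0, 1))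
    (by fun_prop) (by fun_prop) (fun s => by
      have key : ∀ s, f (s, 1) = Circle.exp s := fun s => by
        ext
        simp [hf, direction, h1, abs_of_pos hr, hr.ne']
      rw [Circle.exp_add, hg, hg, key, key]; simp) 0 (by simp)
  have a0 := hn 0 0
  have a1 := hn 0 1
  simp only [zero_add] at a0 a1
  rw [e0] at a0
  rw [e1] at a1
  have := Real.pi_pos
  have hn0 : (n : ℝ) * (2 * π) = 0 := by linarith
  rw [hn0] at a1
  linarith

end Lifting

/-! ### Points with a planar neighbourhood -/

section Planar

variable {X Y : Type*} [TopologicalSpace X] [TopologicalSpace Y]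

/-- The point has an open neighbourhood homeomorphic to the plane. -/
def IsPlanarAt (x : X) : Prop :=
  ∃ U : Set X, IsOpen U ∧ x ∈ U ∧ Nonempty (U ≃ₜ EuclideanSpace ℝ (Fin 2))

/-- A chart onto any open piece of the plane suffices, because a ball inside that piece is itself
homeomorphic to the plane. In this form the property passes along local homeomorphisms by
composition of charts. -/
theorem isPlanarAt_iff {x : X} : IsPlanarAt x ↔ ∃ e : OpenPartialHomeomorph X ℂ, x ∈ e.source := by
  let φ : ℂ ≃ₜ EuclideanSpace ℝ (Fin 2) :=
    Complex.orthonormalBasisOneI.repr.toHomeomorph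
  constructor
  · rintro ⟨U, hU, hx, ⟨h⟩⟩
    have : Nonempty U := ⟨⟨x, hx⟩⟩
    refine ⟨(TopologicalSpace.Opens.openPartialHomeomorphSubtypeCoe ⟨U, hU⟩ this).symm.trans
      (h.trans φ.symm).toOpenPartialHomeomorph, ?_⟩
    simpa using hx
  · rintro ⟨e, hx⟩
    obtain ⟨r, hr, hb⟩ := Metric.isOpen_iff.1 e.open_target _ (e.map_source hx)
    let k : OpenPartialHomeomorph ℂ X := (OpenPartialHomeomorph.univBall (e x) r).trans e.symm
    have hs : k.source = univ := by
      refine eq_univ_of_forall fun z => ?_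
      simp only [k, OpenPartialHomeomorph.trans_source, OpenPartialHomeomorph.univBall_source,
        univ_inter, mem_preimage, OpenPartialHomeomorph.symm_source]
      apply hb
      rw [← OpenPartialHomeomorph.univBall_target (e x) hr]
      exact OpenPartialHomeomorph.map_source _ (by simp)
    refine ⟨k.target, k.open_target, ?_, ⟨k.toHomeomorphSourceTarget.symm.trans
      ((Homeomorph.setCongr hs).trans ((Homeomorph.Set.univ ℂ).trans φ))⟩⟩
    have : k 0 = x := by simp [k, hx]
    rw [← this]
    exact k.map_source (by simp [hs])

theorem isPlanarAt_apply_iff (e : OpenPartialHomeomorph X Y) {x : X} (hx : x ∈ e.source) :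
    IsPlanarAt (e x) ↔ IsPlanarAt x := by
  rw [isPlanarAt_iff, isPlanarAt_iff]
  constructor
  · rintro ⟨k, hk⟩
    exact ⟨e.trans k, by simp [hx, hk]⟩
  · rintro ⟨k, hk⟩
    exact ⟨e.symm.trans k, by simp [hx, hk]⟩

theorem _root_.IsLocalHomeomorph.isPlanarAt_iff {p : X → Y} (hp : IsLocalHomeomorph p) (x : X) :
    IsPlanarAt (p x) ↔ IsPlanarAt x := by
  obtain ⟨e, hx, rfl⟩ := hp x
  exact isPlanarAt_apply_iff e hx

theorem _root_.Topology.IsOpenEmbedding.isPlanarAt_iff {p : X → Y} (hp : IsOpenEmbedding p)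
    (x : X) : IsPlanarAt (p x) ↔ IsPlanarAt x :=
  hp.isLocalHomeomorph.isPlanarAt_iff x

theorem _root_.Homeomorph.isPlanarAt_iff (h : X ≃ₜ Y) (x : X) :
    IsPlanarAt (h x) ↔ IsPlanarAt x :=
  h.isOpenEmbedding.isPlanarAt_iff x

theorem isPlanarAt_complex (z : ℂ) : IsPlanarAt z :=
  isPlanarAt_iff.2 ⟨OpenPartialHomeomorph.refl ℂ, by simp⟩

theorem isPlanarAt_real_prod (z : ℝ × ℝ) : IsPlanarAt z := by
  have := Complex.equivRealProdCLM.toHomeomorph.isPlanarAt_iff (Complex.equivRealProdCLM.symm z)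
  simpa using this.2 (isPlanarAt_complex _)

theorem isPlanarAt_interior {X : Type*} [TopologicalSpace X] (hX : ∀ x : X, IsPlanarAt x)
    {K : Set X} (x : K) (hx : (x : X) ∈ interior K) : IsPlanarAt x := by
  have h1 : IsOpenEmbedding (inclusion (interior_subset (s := K))) := by
    refine ⟨IsEmbedding.inclusion _, ?_⟩
    rw [range_inclusion]
    exact isOpen_interior.preimage continuous_subtype_val
  have h2 : IsOpenEmbedding (Subtype.val : interior K → X) := isOpen_interior.isOpenEmbedding_subtypeVal
  exact (h1.isPlanarAt_iff ⟨x, hx⟩).2 ((h2.isPlanarAt_iff ⟨x, hx⟩).1 (hX _))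

/-- A convex set is not a plane near a point that no segment from `c` passes through. -/
theorem not_isPlanarAt_of_convex {E : Type*} [NormedAddCommGroup E] [NormedSpace ℝ E] {K : Set E}
    (hK : Convex ℝ K) (x : K) {c : E} (hc : c ∈ K) (hcx : c ≠ x)
    (h : ∀ y ∈ K, (x : E) ∈ segment ℝ c y → y = x) : ¬ IsPlanarAt x := by
  rw [isPlanarAt_iff]
  rintro ⟨e, hx⟩
  obtain ⟨O, hO, hOs⟩ := isOpen_induced_iff.1 e.open_source
  have hxO : (x : E) ∈ O := by
    have : x ∈ Subtype.val ⁻¹' O := hOs ▸ hx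
    exact this
  obtain ⟨ε, hε, hball⟩ := Metric.isOpen_iff.1 hO _ hxO
  have hsrc : ∀ y : K, (y : E) ∈ Metric.ball (x : E) ε → y ∈ e.source := fun y hy => by
    rw [← hOs]
    exact hball hy
  -- a small round loop around `e x` inside the image of the ball
  have hopen : IsOpen (e.target ∩ e.symm ⁻¹' (Subtype.val ⁻¹' Metric.ball (x : E) ε)) :=
    e.isOpen_inter_preimage_symm (Metric.isOpen_ball.preimage continuous_subtype_val)
  obtain ⟨r, hr, hrb⟩ := Metric.isOpen_iff.1 hopen (e x) ⟨e.map_source hx, by simp [hx, hε]⟩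
  let γ : ℝ → ℂ := fun s => e x + (r / 2 : ℝ) * Circle.exp s
  have hγ : ∀ s, γ s ∈ e.target ∩ e.symm ⁻¹' (Subtype.val ⁻¹' Metric.ball (x : E) ε) := fun s => by
    apply hrb
    simp only [γ, Metric.mem_ball, dist_self_add_left, norm_mul, Complex.norm_real, Circle.norm_coe]
    rw [Real.norm_of_nonneg (by positivity)]
    linarith
  let η : ℝ → K := fun s => e.symm (γ s)
  have hηc : Continuous η :=
    e.continuousOn_symm.comp_continuous (by fun_prop) fun s => (hγ s).1
  have hηx : ∀ s, (η s : E) ≠ x := fun s hs => by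
    have h1 : e (η s) = γ s := e.right_inv (hγ s).1
    rw [Subtype.ext hs] at h1
    have h2 : ((r / 2 : ℝ) : ℂ) * Circle.exp s = 0 := by
      have : e x = e x + (r / 2 : ℝ) * Circle.exp s := h1
      linear_combination -this
    simp [hr.ne'] at h2
  -- a point near `x` on the segment towards `c`
  obtain ⟨δ, hδ0, hδ1, hδ⟩ : ∃ δ : ℝ, 0 < δ ∧ δ ≤ 1 ∧ δ * ‖c - x‖ < ε := by
    have hn : 0 < ‖c - x‖ := norm_pos_iff.2 (sub_ne_zero.2 hcx)
    refine ⟨min 1 (ε / ‖c - x‖ / 2), by positivity, min_le_left _ _, ?_⟩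
    calc _ ≤ ε / ‖c - x‖ / 2 * ‖c - x‖ := by gcongr; exact min_le_right _ _
      _ = ε / 2 := by field_simp
      _ < ε := by linarith
  let c' : E := (1 - δ) • (x : E) + δ • c
  have hc' : c' ∈ K := hK x.2 hc (by linarith) hδ0.le (by ring)
  have hc'b : c' ∈ Metric.ball (x : E) ε := by
    have : c' - x = δ • (c - x) := by simp only [c']; module
    rw [mem_ball_iff_norm, this, norm_smul, Real.norm_of_nonneg hδ0.le]
    exact hδ
  -- Since `c'` lies between `x` and `c`, a segment from `c'` to `y` through `x` would force `x`
  -- onto the segment from `c` to `y`. The weights arise by substituting `c'` and solving for `x`.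
  have hseg : ∀ y ∈ K, y ≠ x → (x : E) ∉ segment ℝ c' y := by
    rintro y hy hyx ⟨a, b, ha, hb, hab, hx'⟩
    apply hyx
    have hpos : 0 < a * δ + b := by
      rcases hb.eq_or_lt with rfl | hb'
      · have : a = 1 := by linarith
        subst this
        linarith
      · positivity
    refine h y hy ⟨a * δ / (a * δ + b), b / (a * δ + b), by positivity, by positivity,
      by field_simp, ?_⟩
    have h1 : (a * δ) • c + b • y = (a * δ + b) • (x : E) := by
      have hb1 : b = 1 - a := by linarith
      subst hb1
      simp only [c'] at hx'
      linear_combination (norm := module) hx'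
    calc _ = (a * δ + b)⁻¹ • ((a * δ) • c + b • y) := by
          rw [smul_add, smul_smul, smul_smul]; congr 2 <;> ring
      _ = x := by rw [h1, smul_smul, inv_mul_cancel₀ hpos.ne', one_smul]
  -- the contraction of the loop towards that point
  let lam : ℝ → ℝ := fun u => max 0 (min 1 u)
  have hlam : ∀ u, 0 ≤ lam u ∧ lam u ≤ 1 := fun u =>
    ⟨le_max_left _ _, max_le zero_le_one (min_le_left _ _)⟩
  let G : ℝ × ℝ → E := fun z => (1 - lam z.2) • c' + lam z.2 • (η z.1 : E)
  have hGs : ∀ z, G z ∈ segment ℝ c' (η z.1 : E) := fun z =>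
    ⟨_, _, by linarith [(hlam z.2).2], (hlam z.2).1, by ring, rfl⟩
  have hGK : ∀ z, G z ∈ K := fun z => hK.segment_subset hc' (η z.1).2 (hGs z)
  have hGb : ∀ z, G z ∈ Metric.ball (x : E) ε := fun z =>
    (convex_ball _ _).segment_subset hc'b (hγ z.1).2 (hGs z)
  have hGx : ∀ z, G z ≠ x := fun z hz => hseg _ (η z.1).2 (hηx _) (hz ▸ hGs z)
  have hGc : Continuous fun z => (⟨G z, hGK z⟩ : K) := by
    refine Continuous.subtype_mk ?_ _
    have : Continuous lam := by fun_prop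
    have : Continuous fun s => (η s : E) := continuous_subtype_val.comp hηc
    fun_prop
  let H : C(ℝ × ℝ, ℂ) := ⟨fun z => e ⟨G z, hGK z⟩ - e x,
    (e.continuousOn.comp_continuous hGc fun z => hsrc _ (hGb z)).sub continuous_const⟩
  have hH : ∀ z, H z = e ⟨G z, hGK z⟩ - e x := fun _ => rfl
  -- Injectivity of `e` keeps `H` away from `0`, although `H` deforms a circle around `0`, traversed
  -- once, to a constant.
  refine not_nullhomotopic H (fun z hz => ?_) (fun s u => ?_) (c := e ⟨c', hc'⟩ - e x) (fun s => ?_)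
    (half_pos hr) (fun s => ?_)
  · have := e.injOn (hsrc _ (hGb z)) hx (sub_eq_zero.1 hz)
    exact hGx z (congrArg Subtype.val this)
  · have hp : γ (s + 2 * π) = γ s := by simp only [γ, Circle.periodic_exp s]
    have : G (s + 2 * π, u) = G (s, u) := by simp only [G, η, hp]
    simp only [hH, this]
  · have : G (s, 0) = c' := by simp [G, lam]
    simp only [hH, this]
  · have h1 : (⟨G (s, 1), hGK (s, 1)⟩ : K) = η s := Subtype.ext (by simp [G, lam])
    have h2 : e (η s) = γ s := e.right_inv (hγ s).1
    rw [hH, h1, h2]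
    simp [γ]

end Planar

/-! ### Recognising quotient spaces and local homeomorphisms -/

section Quotients

/-- A continuous surjection from a compact space to a Hausdorff space identifies its target with
the quotient by any relation that generates its fibers. -/
noncomputable def quotHomeo {K X : Type*} [TopologicalSpace K] [CompactSpace K]
    [TopologicalSpace X] [T2Space X] {r : K → K → Prop} (f : K → X) (hf : Continuous f)
    (hs : Function.Surjective f) (h₁ : ∀ x y, r x y → f x = f y)
    (h₂ : ∀ x y, f x = f y → Quot.mk r x = Quot.mk r y) : Quot r ≃ₜ X :=
  Continuous.homeoOfEquivCompactToT2
    (f := Equiv.ofBijective (Quot.lift f h₁)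
      ⟨by rintro ⟨x⟩ ⟨y⟩ h; exact h₂ x y h, fun z => (hs z).imp' (Quot.mk r) fun _ h => h⟩)
    (continuous_quot_lift h₁ hf)

/-- A quotient map whose fibers are the orbits of a family of homeomorphisms, and which is locally
injective, is a local homeomorphism. -/
theorem isLocalHomeomorph_of_orbits {Y X ι : Type*} [TopologicalSpace Y] [TopologicalSpace X]
    {p : Y → X} (hp : IsQuotientMap p) (φ : ι → Y ≃ₜ Y) (h : ∀ x y, p x = p y ↔ ∃ i, y = φ i x)
    (hinj : ∀ x, ∃ U, IsOpen U ∧ x ∈ U ∧ InjOn p U) : IsLocalHomeomorph p := by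
  have hopen : IsOpenMap p := fun U hU => by
    rw [← hp.isOpen_preimage]
    -- The saturation of an open set is the union of its translates, hence open.
    have : p ⁻¹' (p '' U) = ⋃ i, φ i '' U := by
      ext y
      simp only [mem_preimage, mem_image, mem_iUnion]
      constructor
      · rintro ⟨x, hx, hxy⟩
        obtain ⟨i, rfl⟩ := (h x y).1 hxy
        exact ⟨i, x, hx, rfl⟩
      · rintro ⟨i, x, hx, rfl⟩
        exact ⟨x, hx, (h _ _).2 ⟨i, rfl⟩⟩
    rw [this]
    exact isOpen_iUnion fun i => (φ i).isOpenMap U hU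
  refine isLocalHomeomorph_iff_isOpenEmbedding_restrict.2 fun x => ?_
  obtain ⟨U, hU, hx, hi⟩ := hinj x
  exact ⟨U, hU.mem_nhds hx, .of_continuous_injective_isOpenMap
    (hp.continuous.comp continuous_subtype_val) hi.injective (hopen.comp hU.isOpenMap_subtype_val)⟩

end Quotients

/-! ### Mapping tori of reflections: the Möbius band and the Klein bottle -/

/-- An involution of a space `F`, together with an embedding of `F` in the plane under which the
involution becomes a reflection. -/
structure Reflection (F : Type) [TopologicalSpace F] where
  ι : F ≃ₜ F
  u : F → ℝ
  v : F → ℝ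
  continuous_u : Continuous u
  continuous_v : Continuous v
  u_ι : ∀ a, u (ι a) = u a
  v_ι : ∀ a, v (ι a) = -v a
  inj : ∀ a b, u a = u b → v a = v b → a = b

namespace Reflection

variable {F : Type} [TopologicalSpace F] (D : Reflection F)

/-- The mapping torus of the involution. -/
abbrev Torus : Type :=
  Quot fun p q : unitInterval × F => ∃ a : F, p = (0, a) ∧ q = (1, D.ι a)

/-- The powers of the involution. -/
noncomputable def pow (n : ℤ) : F ≃ₜ F :=
  open Classical in if Even n then Homeomorph.refl F else D.ι

theorem pow_even {n : ℤ} (h : Even n) (a : F) : D.pow n a = a := by simp [pow, h]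

theorem pow_odd {n : ℤ} (h : ¬ Even n) (a : F) : D.pow n a = D.ι a := by simp [pow, h]

/-- The deck transformations of the infinite strip over the mapping torus. -/
noncomputable def deck (n : ℤ) : ℝ × F ≃ₜ ℝ × F :=
  (Homeomorph.addRight (n : ℝ)).prodCongr (D.pow n)

theorem deck_apply (n : ℤ) (x : ℝ × F) : D.deck n x = (x.1 + n, D.pow n x.2) := rfl

/-- The infinite strip wrapped around a copy of the mapping torus in Euclidean space. -/
noncomputable def wrap (x : ℝ × F) : Circle × ℝ × ℂ :=
  (Circle.exp (2 * π * x.1), D.u x.2, D.v x.2 * Circle.exp (π * x.1))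

theorem continuous_wrap : Continuous D.wrap := by
  have := D.continuous_u
  have := D.continuous_v
  unfold wrap
  fun_prop

theorem circle_exp_pi_int (n : ℤ) :
    (Circle.exp (π * n) : ℂ) = open Classical in if Even n then 1 else -1 := by
  split_ifs with h
  · obtain ⟨k, rfl⟩ := h
    have : π * ((k + k : ℤ) : ℝ) = k * (2 * π) := by push_cast; ring
    rw [this, Circle.exp_int_mul_two_pi, Circle.coe_one]
  · obtain ⟨k, rfl⟩ := Int.not_even_iff_odd.1 h
    have : π * ((2 * k + 1 : ℤ) : ℝ) = k * (2 * π) + π := by push_cast; ring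
    rw [this, Circle.exp_add, Circle.exp_int_mul_two_pi, one_mul, Circle.coe_exp,
      Complex.exp_pi_mul_I]

/-- The factor `Circle.exp (π * s)` makes only half a turn when `s` grows by 1, and its sign change
cancels that of `v` under `ι`. Conversely the first coordinate fixes `s` up to an integer `n`, the
parity of `n` decides the sign, and `inj` recovers the point of the fibre. -/
theorem wrap_eq_iff (x y : ℝ × F) : D.wrap x = D.wrap y ↔ ∃ n, y = D.deck n x := by
  obtain ⟨s, a⟩ := x
  obtain ⟨s', b⟩ := y
  have key : ∀ n : ℤ, (Circle.exp (π * (s + n)) : ℂ) =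
      Circle.exp (π * s) * (open Classical in if Even n then 1 else -1) := fun n => by
    rw [mul_add, Circle.exp_add, Circle.coe_mul, circle_exp_pi_int]
  constructor
  · intro h
    simp only [wrap, Prod.mk.injEq] at h
    obtain ⟨h1, h2, h3⟩ := h
    obtain ⟨n, hn⟩ := Circle.exp_eq_exp.1 h1.symm
    have hs : s' = s + n := by
      have := Real.pi_pos
      have h : 2 * π * s' = 2 * π * (s + n) := by rw [hn]; ring
      exact mul_left_cancel₀ (by positivity) h
    subst hs
    refine ⟨n, Prod.ext rfl ?_⟩
    simp only [deck_apply]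
    rw [key] at h3
    have hne : (Circle.exp (π * s) : ℂ) ≠ 0 := Circle.coe_ne_zero _
    by_cases hn : Even n
    · rw [D.pow_even hn]
      simp only [hn, if_true, mul_one] at h3
      exact (D.inj _ _ h2 (by exact_mod_cast mul_right_cancel₀ hne h3)).symm
    · rw [D.pow_odd hn]
      simp only [hn, if_false] at h3
      refine D.inj _ _ (by rw [D.u_ι, h2]) ?_
      have : (D.v b : ℂ) = -D.v a := mul_right_cancel₀ hne (by linear_combination h3)
      rw [D.v_ι]
      exact_mod_cast this
  · rintro ⟨n, h⟩
    simp only [deck_apply, Prod.mk.injEq] at h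
    obtain ⟨rfl, rfl⟩ := h
    simp only [wrap, Prod.mk.injEq]
    refine ⟨?_, ?_, ?_⟩
    · rw [mul_add, Circle.exp_add, Circle.exp_two_pi_mul_int, mul_one]
    · by_cases hn : Even n
      · rw [D.pow_even hn]
      · rw [D.pow_odd hn, D.u_ι]
    · rw [key]
      by_cases hn : Even n
      · simp [D.pow_even hn, hn]
      · simp [D.pow_odd hn, hn, D.v_ι]

theorem exists_deck_mem (x : ℝ × F) : ∃ n, (D.deck n x).1 ∈ Icc (0 : ℝ) 1 := by
  refine ⟨-⌊x.1⌋, ?_⟩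
  simp only [deck_apply]
  push_cast
  constructor
  · linarith [Int.floor_le x.1]
  · linarith [Int.lt_floor_add_one x.1]

variable [CompactSpace F]

/-- Every orbit of deck transformations meets the strip over `[0,1]`. Two points of that strip can
differ only by a deck transformation with `n` in `{-1, 0, 1}`, and `n = ±1` joins the two ends,
which is the gluing of the mapping torus. The Hausdorff property follows from the embedding. -/
theorem exists_homeo : ∃ e : D.Torus ≃ₜ range D.wrap,
    ∀ (s : unitInterval) (a : F), (e (Quot.mk _ (s, a)) : Circle × ℝ × ℂ) = D.wrap (s, a) := by
  refine ⟨quotHomeo (fun p : unitInterval × F => ⟨D.wrap ((p.1 : ℝ), p.2), mem_range_self _⟩)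
    (Continuous.subtype_mk (D.continuous_wrap.comp (by fun_prop)) _) ?_ ?_ ?_, fun s a => rfl⟩
  · rintro ⟨_, x, rfl⟩
    obtain ⟨n, hn⟩ := D.exists_deck_mem x
    exact ⟨(⟨_, hn⟩, (D.deck n x).2), Subtype.ext ((D.wrap_eq_iff _ _).2 ⟨n, rfl⟩).symm⟩
  · rintro _ _ ⟨a, rfl, rfl⟩
    refine Subtype.ext ((D.wrap_eq_iff _ _).2 ⟨1, ?_⟩)
    simp [deck_apply, D.pow_odd (n := 1) (by decide)]
  · rintro ⟨s, a⟩ ⟨s', b⟩ h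
    obtain ⟨n, hn⟩ := (D.wrap_eq_iff _ _).1 (congrArg Subtype.val h)
    simp only [deck_apply, Prod.mk.injEq] at hn
    obtain ⟨h1, h2⟩ := hn
    have b1 := s.2.1
    have b2 := s.2.2
    have b3 := s'.2.1
    have b4 := s'.2.2
    have hn1 : n ≤ 1 := by
      have : (n : ℝ) ≤ 1 := by linarith
      exact_mod_cast this
    have hn2 : -1 ≤ n := by
      have : (-1 : ℝ) ≤ n := by linarith
      exact_mod_cast this
    obtain rfl | rfl | rfl : n = -1 ∨ n = 0 ∨ n = 1 := by omega
    · rw [D.pow_odd (by decide)] at h2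
      have hs : s = 1 := Subtype.ext (by push_cast at h1 ⊢; linarith)
      have hs' : s' = 0 := Subtype.ext (by push_cast at h1 ⊢; linarith)
      have : a = D.ι b := by
        apply D.inj <;> simp [h2, D.u_ι, D.v_ι]
      exact (Quot.sound ⟨b, by rw [hs'], by rw [hs, this]⟩).symm
    · rw [D.pow_even (by decide)] at h2
      have : s' = s := Subtype.ext (by simpa using h1)
      rw [this, h2]
    · rw [D.pow_odd (by decide)] at h2
      have hs : s = 0 := Subtype.ext (by push_cast at h1 ⊢; linarith)
      have hs' : s' = 1 := Subtype.ext (by push_cast at h1 ⊢; linarith)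
      exact Quot.sound ⟨a, by rw [hs], by rw [hs', h2]⟩

instance : T2Space D.Torus := D.exists_homeo.choose.symm.t2Space

/-- The infinite strip covering the mapping torus. -/
noncomputable def cover (x : ℝ × F) : D.Torus :=
  D.exists_homeo.choose.symm ⟨D.wrap x, mem_range_self x⟩

theorem continuous_cover : Continuous D.cover :=
  D.exists_homeo.choose.symm.continuous.comp (D.continuous_wrap.subtype_mk _)

theorem cover_eq_iff (x y : ℝ × F) : D.cover x = D.cover y ↔ ∃ n, y = D.deck n x := by
  rw [← D.wrap_eq_iff, cover, cover, EmbeddingLike.apply_eq_iff_eq, Subtype.mk.injEq]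

theorem cover_mk (s : unitInterval) (a : F) : D.cover (s, a) = Quot.mk _ (s, a) := by
  rw [cover, Homeomorph.symm_apply_eq]
  exact Subtype.ext (D.exists_homeo.choose_spec s a).symm

theorem surjective_cover : Function.Surjective D.cover := by
  rintro ⟨s, a⟩
  exact ⟨(s, a), D.cover_mk s a⟩

theorem isLocalHomeomorph_cover : IsLocalHomeomorph D.cover := by
  have hq : IsQuotientMap D.cover := by
    refine IsQuotientMap.of_comp (f := fun p : unitInterval × F => ((p.1 : ℝ), p.2)) (by fun_prop)
      D.continuous_cover ?_
    have : D.cover ∘ (fun p : unitInterval × F => ((p.1 : ℝ), p.2)) = Quot.mk _ :=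
      funext fun p => D.cover_mk p.1 p.2
    rw [this]
    exact isQuotientMap_quot_mk
  refine isLocalHomeomorph_of_orbits hq D.deck D.cover_eq_iff fun x => ?_
  -- An open window of length 1 contains no two points that differ by a nonzero integer shift.
  refine ⟨{y | |y.1 - x.1| < 1 / 2}, isOpen_lt (by fun_prop) continuous_const, by simp, ?_⟩
  intro y hy z hz h
  obtain ⟨n, rfl⟩ := (D.cover_eq_iff _ _).1 h
  simp only [mem_ofPred_eq, deck_apply, abs_lt] at hy hz
  have hn1 : n < 1 := by
    have : (n : ℝ) < 1 := by linarith
    exact_mod_cast this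
  have hn2 : -1 < n := by
    have : (-1 : ℝ) < n := by linarith
    exact_mod_cast this
  obtain rfl : n = 0 := by omega
  simp [deck_apply, D.pow_even]

end Reflection

/-- The reflection of the interval, whose mapping torus is the Möbius band. -/
noncomputable def intervalReflection : Reflection unitInterval where
  ι := unitInterval.symmHomeomorph
  u _ := 0
  v t := 2 * t - 1
  continuous_u := by fun_prop
  continuous_v := by fun_prop
  u_ι _ := rfl
  v_ι t := by simp; ring
  inj a b _ h := Subtype.ext (by linarith)

/-- The reflection of the circle, whose mapping torus is the Klein bottle. -/
noncomputable def circleReflection : Reflection Circle where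
  ι := Homeomorph.inv Circle
  u z := (z : ℂ).re
  v z := (z : ℂ).im
  continuous_u := by fun_prop
  continuous_v := by fun_prop
  u_ι z := by simp
  v_ι z := by simp
  inj a b h h' := Circle.ext (Complex.ext h h')

/-- The infinite strip covering the Möbius band. -/
noncomputable def moebiusCover (x : ℝ × unitInterval) : MoebiusBand := intervalReflection.cover x

/-- The infinite cylinder covering the Klein bottle. -/
noncomputable def kleinCover (x : ℝ × Circle) : KleinBottle := circleReflection.cover x

instance : T2Space MoebiusBand := inferInstanceAs (T2Space intervalReflection.Torus)

instance : T2Space KleinBottle := inferInstanceAs (T2Space circleReflection.Torus)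

theorem Reflection.cover_eq_iff' {F : Type} [TopologicalSpace F] [CompactSpace F]
    (D : Reflection F) (x y : ℝ × F) : D.cover x = D.cover y ↔
      ∃ n : ℤ, y.1 = x.1 + n ∧ (Even n ∧ y.2 = x.2 ∨ ¬ Even n ∧ y.2 = D.ι x.2) := by
  rw [D.cover_eq_iff]
  refine exists_congr fun n => ?_
  rw [D.deck_apply, Prod.ext_iff]
  by_cases h : Even n
  · simp [h, D.pow_even]
  · simp [h, D.pow_odd]

theorem moebiusCover_eq_iff (x y : ℝ × unitInterval) : moebiusCover x = moebiusCover y ↔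
    ∃ n : ℤ, y.1 = x.1 + n ∧ (Even n ∧ y.2 = x.2 ∨ ¬ Even n ∧ y.2 = unitInterval.symm x.2) :=
  intervalReflection.cover_eq_iff' x y

theorem kleinCover_eq_iff (x y : ℝ × Circle) : kleinCover x = kleinCover y ↔
    ∃ n : ℤ, y.1 = x.1 + n ∧ (Even n ∧ y.2 = x.2 ∨ ¬ Even n ∧ y.2 = x.2⁻¹) :=
  circleReflection.cover_eq_iff' x y

theorem isLocalHomeomorph_moebiusCover : IsLocalHomeomorph moebiusCover :=
  intervalReflection.isLocalHomeomorph_cover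

theorem isLocalHomeomorph_kleinCover : IsLocalHomeomorph kleinCover :=
  circleReflection.isLocalHomeomorph_cover

theorem continuous_moebiusCover : Continuous moebiusCover := intervalReflection.continuous_cover

theorem continuous_kleinCover : Continuous kleinCover := circleReflection.continuous_cover

theorem surjective_moebiusCover : Function.Surjective moebiusCover :=
  intervalReflection.surjective_cover

theorem surjective_kleinCover : Function.Surjective kleinCover := circleReflection.surjective_cover

theorem moebiusCover_mk (s t : unitInterval) : moebiusCover (s, t) = Quot.mk _ (s, t) :=
  intervalReflection.cover_mk s t

theorem kleinCover_mk (s : unitInterval) (z : Circle) : kleinCover (s, z) = Quot.mk _ (s, z) :=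
  circleReflection.cover_mk s z

/-! ### The projective plane as a quotient of the sphere -/

section ProjectivePlane

/-- At a nonzero coordinate the diagonal product fixes that coordinate up to sign; with the sign
chosen, its row of products fixes all the others. -/
theorem sphere_eq_or_eq_neg {x y : Sphere} (h : ∀ i j, x.1 i * x.1 j = y.1 i * y.1 j) :
    y = x ∨ y = -x := by
  have hne : (y : EuclideanSpace ℝ (Fin 3)) ≠ 0 := ne_zero_of_mem_unit_sphere y
  obtain ⟨i, hi⟩ : ∃ i, y.1 i ≠ 0 := by
    by_contra! h
    exact hne (PiLp.ext h)
  rcases mul_self_eq_mul_self_iff.1 (h i i).symm with h' | h'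
  · left
    ext j
    have := h i j
    rw [← h'] at this
    exact (mul_left_cancel₀ hi this).symm
  · right
    ext j
    have := h i j
    have hx : x.1 i = - y.1 i := by rw [h', neg_neg]
    rw [hx] at this
    have : y.1 i * (y.1 j) = y.1 i * (- x.1 j) := by linarith
    exact mul_left_cancel₀ hi this

/-- The projection matrices embed the projective plane in Euclidean space. -/
def veronese : ProjectivePlane → Fin 3 → Fin 3 → ℝ :=
  Quot.lift (fun x i j => x.1 i * x.1 j) (by rintro x _ rfl; ext i j; simp)

theorem continuous_veronese : Continuous veronese := continuous_quot_lift _ (by fun_prop)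

theorem projectivePlane_mk_eq_iff (x y : Sphere) :
    (Quot.mk _ x : ProjectivePlane) = Quot.mk _ y ↔ y = x ∨ y = -x := by
  constructor
  · intro h
    exact sphere_eq_or_eq_neg fun i j => congrFun (congrFun (congrArg veronese h) i) j
  · rintro (rfl | rfl)
    · rfl
    · exact Quot.sound rfl

instance : T2Space ProjectivePlane := by
  refine T2Space.of_injective_continuous (f := veronese) ?_ continuous_veronese
  rintro ⟨x⟩ ⟨y⟩ h
  exact (projectivePlane_mk_eq_iff x y).2
    (sphere_eq_or_eq_neg fun i j => congrFun (congrFun h i) j)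

theorem isLocalHomeomorph_projectivePlane_mk :
    IsLocalHomeomorph (Quot.mk _ : Sphere → ProjectivePlane) := by
  refine isLocalHomeomorph_of_orbits isQuotientMap_quot_mk
    (fun b : Bool => cond b (Homeomorph.refl _) (Homeomorph.neg _)) (fun x y => ?_) fun x => ?_
  · rw [projectivePlane_mk_eq_iff]
    simp [or_comm]
  -- The open hemisphere around `x` contains no antipodal pair.
  · refine ⟨{y | 0 < inner ℝ (x : EuclideanSpace ℝ (Fin 3)) y}, isOpen_lt continuous_const
      (by fun_prop), by simp, ?_⟩
    intro y hy z hz h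
    rcases (projectivePlane_mk_eq_iff y z).1 h with rfl | rfl
    · rfl
    · simp only [mem_ofPred_eq, coe_neg_sphere, inner_neg_right] at hy hz
      linarith

end ProjectivePlane

/-! ### Boundaries of the seven models -/

section Boundary

theorem mem_boundary_iff {X : Type} [TopologicalSpace X] (x : X) :
    x ∈ boundary X ↔ ¬ IsPlanarAt x := Iff.rfl

theorem boundary_eq_empty {X : Type} [TopologicalSpace X] (h : ∀ x : X, IsPlanarAt x) :
    boundary X = ∅ :=
  eq_empty_of_forall_notMem fun x hx => hx (h x)

theorem boundaryComponents_congr {X Y : Type} [TopologicalSpace X] [TopologicalSpace Y]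
    (h : X ≃ₜ Y) : boundaryComponents X = boundaryComponents Y := by
  let e : boundary X ≃ₜ boundary Y := h.subtype fun x => (h.isPlanarAt_iff x).not.symm
  refine ENat.card_congr (e.isQuotientMap.isCoinducing.connectedComponentsHomeomorph
    fun y => ?_).toEquiv
  have : e ⁻¹' {y} = {e.symm y} := by
    ext x
    rw [mem_preimage, mem_singleton_iff, mem_singleton_iff]
    exact ⟨fun h => by rw [← h, e.symm_apply_apply], fun h => by rw [h, e.apply_symm_apply]⟩
  rw [this]
  exact isConnected_singleton

theorem boundaryComponents_eq_zero {X : Type} [TopologicalSpace X] (h : boundary X = ∅) :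
    boundaryComponents X = 0 := by
  have : IsEmpty (boundary X) := isEmpty_coe_sort.2 h
  have : IsEmpty (ConnectedComponents (boundary X)) := ConnectedComponents.isEmpty_iff_isEmpty.2 this
  exact ENat.card_eq_zero_iff_empty _ |>.2 this

theorem boundaryComponents_eq_one {X : Type} [TopologicalSpace X] (h : IsConnected (boundary X)) :
    boundaryComponents X = 1 := by
  have := isConnected_iff_connectedSpace.1 h
  have : Nonempty (ConnectedComponents (boundary X)) := inferInstance
  obtain ⟨u⟩ := nonempty_unique (ConnectedComponents (boundary X))
  simp [boundaryComponents, ENat.card_eq_coe_fintype_card]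

theorem _root_.IsLocalHomeomorph.prodMap' {X Y X' Y' : Type*} [TopologicalSpace X]
    [TopologicalSpace Y] [TopologicalSpace X'] [TopologicalSpace Y'] {f : X → Y} {g : X' → Y'}
    (hf : IsLocalHomeomorph f) (hg : IsLocalHomeomorph g) : IsLocalHomeomorph (Prod.map f g) := by
  rintro ⟨x, y⟩
  obtain ⟨e, hx, rfl⟩ := hf x
  obtain ⟨e', hy, rfl⟩ := hg y
  exact ⟨e.prod e', ⟨hx, hy⟩, rfl⟩

theorem isPlanarAt_sphere (x : Sphere) : IsPlanarAt x := by
  rw [isPlanarAt_iff]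
  exact ⟨(chartAt (EuclideanSpace ℝ (Fin 2)) x).trans
    Complex.orthonormalBasisOneI.repr.symm.toHomeomorph.toOpenPartialHomeomorph, by simp⟩

theorem boundary_sphere : boundary Sphere = ∅ := boundary_eq_empty isPlanarAt_sphere

theorem boundary_projectivePlane : boundary ProjectivePlane = ∅ :=
  boundary_eq_empty <| by
    rintro ⟨x⟩
    exact (isLocalHomeomorph_projectivePlane_mk.isPlanarAt_iff x).2 (isPlanarAt_sphere x)

theorem boundary_torus : boundary Torus = ∅ :=
  boundary_eq_empty <| by
    rintro ⟨z, w⟩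
    obtain ⟨s, rfl⟩ := Circle.exp_surjective z
    obtain ⟨t, rfl⟩ := Circle.exp_surjective w
    exact ((isLocalHomeomorph_circleExp.prodMap' isLocalHomeomorph_circleExp).isPlanarAt_iff
      (s, t)).2 (isPlanarAt_real_prod _)

theorem boundary_kleinBottle : boundary KleinBottle = ∅ :=
  boundary_eq_empty fun x => by
    obtain ⟨⟨s, z⟩, rfl⟩ := surjective_kleinCover x
    obtain ⟨t, rfl⟩ := Circle.exp_surjective z
    exact (isLocalHomeomorph_kleinCover.isPlanarAt_iff _).2
      ((((Homeomorph.refl ℝ).isLocalHomeomorph.prodMap' isLocalHomeomorph_circleExp).isPlanarAt_iff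
      (s, t)).2 (isPlanarAt_real_prod _))

/-- The strip is a convex subset of the plane, so its interior points are planar. An edge point is
excluded by `not_isPlanarAt_of_convex`, with `c` on the opposite edge: no segment from there
continues beyond the edge. -/
theorem isPlanarAt_strip (x : ℝ × unitInterval) : IsPlanarAt x ↔ x.2 ≠ 0 ∧ x.2 ≠ 1 := by
  let K : Set (ℝ × ℝ) := univ ×ˢ Icc 0 1
  have hK : Convex ℝ K := convex_univ.prod (convex_Icc 0 1)
  let e : ℝ × unitInterval ≃ₜ K :=
    { toFun := fun x => ⟨(x.1, x.2), trivial, x.2.2⟩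
      invFun := fun x => (x.1.1, ⟨x.1.2, x.2.2⟩)
      left_inv := fun _ => rfl
      right_inv := fun _ => rfl }
  rw [← e.isPlanarAt_iff]
  obtain ⟨s, t⟩ := x
  constructor
  · intro h
    constructor
    · rintro rfl
      refine not_isPlanarAt_of_convex hK _ (c := (s, 1)) (by simp [K]) (by simp [e]) ?_ h
      rintro ⟨y₁, y₂⟩ ⟨-, hy0, hy1⟩ ⟨a, b, ha, hb, hab, h⟩
      change _ = (s, (0 : ℝ)) at h
      change _ = (s, (0 : ℝ))
      simp only [Prod.smul_mk, Prod.mk_add_mk, smul_eq_mul, Prod.mk.injEq, mul_one] at h hy0 hy1 ⊢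
      have : a = 0 := by nlinarith [mul_nonneg hb hy0]
      subst this
      obtain rfl : b = 1 := by linarith
      simpa using h
    · rintro rfl
      refine not_isPlanarAt_of_convex hK _ (c := (s, 0)) (by simp [K]) (by simp [e]) ?_ h
      rintro ⟨y₁, y₂⟩ ⟨-, hy0, hy1⟩ ⟨a, b, ha, hb, hab, h⟩
      change _ = (s, (1 : ℝ)) at h
      change _ = (s, (1 : ℝ))
      simp only [Prod.smul_mk, Prod.mk_add_mk, smul_eq_mul, Prod.mk.injEq, mul_zero] at h hy0 hy1 ⊢
      have : a = 0 := by nlinarith [mul_nonneg hb (sub_nonneg.2 hy1)]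
      subst this
      obtain rfl : b = 1 := by linarith
      simpa using h
  · rintro ⟨h0, h1⟩
    refine isPlanarAt_interior isPlanarAt_real_prod _ ?_
    rw [interior_prod_eq, interior_univ, interior_Icc]
    exact ⟨trivial, unitInterval.pos_iff_ne_zero.2 h0, unitInterval.lt_one_iff_ne_one.2 h1⟩

/-- A shift by 1 carries the upper edge of the strip to the lower one, so a single line covers the
whole boundary; this is why it is connected. -/
theorem boundary_moebiusBand : boundary MoebiusBand = range fun s : ℝ => moebiusCover (s, 0) := by
  ext x
  obtain ⟨⟨s, t⟩, rfl⟩ := surjective_moebiusCover x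
  rw [mem_boundary_iff, isLocalHomeomorph_moebiusCover.isPlanarAt_iff, isPlanarAt_strip]
  constructor
  · intro h
    have h : t = 0 ∨ t = 1 := by tauto
    rcases h with rfl | rfl
    · exact ⟨s, rfl⟩
    · exact ⟨s + 1, ((moebiusCover_eq_iff _ _).2 ⟨1, by simp⟩).symm⟩
  · rintro ⟨s', h⟩ ⟨h0, h1⟩
    obtain ⟨n, -, ⟨-, h⟩ | ⟨-, h⟩⟩ := (moebiusCover_eq_iff _ _).1 h
    · exact h0 h
    · exact h1 (by simpa using h)

theorem isConnected_boundary_moebiusBand : IsConnected (boundary MoebiusBand) := by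
  rw [boundary_moebiusBand]
  exact isConnected_range (continuous_moebiusCover.comp (by fun_prop))

theorem boundary_annulus : boundary Annulus = {x | x.2 = 0 ∨ x.2 = 1} := by
  ext ⟨z, t⟩
  obtain ⟨s, rfl⟩ := Circle.exp_surjective z
  rw [mem_boundary_iff]
  have := (isLocalHomeomorph_circleExp.prodMap'
    (Homeomorph.refl unitInterval).isLocalHomeomorph).isPlanarAt_iff (s, t)
  simp only [Prod.map_apply, Homeomorph.refl_apply, id] at this
  rw [this, isPlanarAt_strip]
  simp only [mem_ofPred_eq]
  tauto

theorem boundaryComponents_annulus : boundaryComponents Annulus = 2 := by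
  -- The two end circles: closed, complementary to each other and hence clopen, and connected.
  let U : Bool → Set (boundary Annulus) := fun b => {x | x.1.2 = cond b 1 0}
  have hc : ∀ b, IsClosed (U b) := fun b => isClosed_eq (by fun_prop) continuous_const
  have hcompl : ∀ b, (U b)ᶜ = U (!b) := fun b => by
    ext ⟨⟨z, t⟩, hx⟩
    rw [boundary_annulus] at hx
    rcases hx with rfl | rfl <;> cases b <;> simp [U]
  have e : ConnectedComponents (boundary Annulus) ≃ Bool := by
    refine ConnectedComponents.equivOfIsClopenOfIsConnected (U := U) (fun b => ⟨hc b, ?_⟩) ?_ ?_ ?_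
    · rw [← isClosed_compl_iff, hcompl]
      exact hc _
    · intro b c hbc
      have : c = !b := by cases b <;> cases c <;> simp_all
      rw [this, Function.onFun, ← hcompl]
      exact disjoint_compl_right
    · refine eq_univ_of_forall fun x => mem_iUnion.2 ?_
      by_cases h : x ∈ U true
      · exact ⟨true, h⟩
      · exact ⟨false, by rw [← mem_compl_iff, hcompl] at h; exact h⟩
    · intro b
      have : U b = range fun z : Circle => (⟨(z, cond b 1 0), by
          rw [boundary_annulus]; cases b <;> simp⟩ : boundary Annulus) := by
        ext ⟨⟨z, t⟩, hx⟩
        simp [U, eq_comm]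
      rw [this]
      have : ConnectedSpace Circle := connectedSpace_iff_univ.2 <| by
        rw [← Circle.exp_surjective.range_eq]
        exact isConnected_range Circle.exp.continuous
      exact isConnected_range (by fun_prop)
  rw [boundaryComponents, ENat.card_congr e]
  simp

theorem isPlanarAt_euclidean (x : EuclideanSpace ℝ (Fin 2)) : IsPlanarAt x :=
  ⟨univ, isOpen_univ, trivial, ⟨Homeomorph.Set.univ _⟩⟩

theorem boundary_disc : boundary Disc = {x : Disc | ‖(x : EuclideanSpace ℝ (Fin 2))‖ = 1} := by
  ext x
  have hx := mem_closedBall_zero_iff.1 x.2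
  rw [mem_boundary_iff, mem_ofPred_eq]
  constructor
  · intro h
    by_contra hne
    refine h (isPlanarAt_interior isPlanarAt_euclidean x ?_)
    rw [interior_closedBall _ one_ne_zero]
    simpa using lt_of_le_of_ne hx hne
  · intro h
    refine not_isPlanarAt_of_convex (convex_closedBall _ _) x (c := 0) (by simp) ?_ ?_
    · intro h0
      rw [← h0] at h
      simp at h
    · rintro y hy ⟨a, b, ha, hb, hab, hx'⟩
      rw [smul_zero, zero_add] at hx'
      have hy := mem_closedBall_zero_iff.1 hy
      rw [← hx', norm_smul, Real.norm_of_nonneg hb] at h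
      have : b = 1 := by nlinarith [norm_nonneg y]
      rw [← hx', this, one_smul]

theorem isConnected_boundary_disc : IsConnected (boundary Disc) := by
  have h := isConnected_sphere (E := EuclideanSpace ℝ (Fin 2))
    (by rw [← Module.finrank_eq_rank, finrank_euclideanSpace_fin]; norm_num) 0 zero_le_one
  have := isConnected_iff_connectedSpace.1 h
  have : boundary Disc = range fun y : Metric.sphere (0 : EuclideanSpace ℝ (Fin 2)) 1 =>
      (⟨y, Metric.sphere_subset_closedBall y.2⟩ : Disc) := by
    rw [boundary_disc]
    ext ⟨x, hx⟩
    simp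
  rw [this]
  exact isConnected_range (by fun_prop)

theorem boundaryComponents_model (s : SurfaceType) :
    boundaryComponents s.model = (s.boundaryCount : ℕ∞) := by
  cases s
  · exact boundaryComponents_eq_zero boundary_sphere
  · exact boundaryComponents_eq_zero boundary_torus
  · exact boundaryComponents_eq_one isConnected_boundary_disc
  · exact boundaryComponents_annulus
  · exact boundaryComponents_eq_zero boundary_projectivePlane
  · exact boundaryComponents_eq_zero boundary_kleinBottle
  · exact boundaryComponents_eq_one isConnected_boundary_moebiusBand

end Boundary

/-! ### Cylindrical coordinates on the sphere and the projective plane -/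

section SpherePoints

/-- The point of the sphere with the given horizontal and vertical coordinates. -/
noncomputable def spherePoint (p : {p : ℂ × ℝ // ‖p.1‖ ^ 2 + p.2 ^ 2 = 1}) : Sphere :=
  ⟨!₂[p.1.1.re, p.1.1.im, p.1.2], by
    have h := p.2
    rw [← Complex.normSq_eq_norm_sq, Complex.normSq_apply] at h
    rw [mem_sphere_zero_iff_norm, EuclideanSpace.norm_eq, Real.sqrt_eq_one]
    simp only [Fin.sum_univ_three, Real.norm_eq_abs, sq_abs]
    simp
    linarith⟩

theorem continuous_spherePoint : Continuous spherePoint := by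
  unfold spherePoint
  refine Continuous.subtype_mk ((PiLp.continuous_toLp 2 _).comp ?_) _
  refine continuous_pi fun i => ?_
  fin_cases i
  · exact Complex.continuous_re.comp (by fun_prop)
  · exact Complex.continuous_im.comp (by fun_prop)
  · exact continuous_snd.comp (by fun_prop)

theorem spherePoint_injective : Function.Injective spherePoint := by
  rintro ⟨⟨w, h⟩, hp⟩ ⟨⟨w', h'⟩, hp'⟩ he
  have := congrArg (fun x : Sphere => x.1) he
  have e0 := congrArg (fun x : EuclideanSpace ℝ (Fin 3) => x 0) this
  have e1 := congrArg (fun x : EuclideanSpace ℝ (Fin 3) => x 1) this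
  have e2 := congrArg (fun x : EuclideanSpace ℝ (Fin 3) => x 2) this
  simp [spherePoint] at e0 e1 e2
  simp [Complex.ext_iff, e0, e1, e2]

theorem spherePoint_surjective : Function.Surjective spherePoint := by
  rintro ⟨x, hx⟩
  refine ⟨⟨(⟨x 0, x 1⟩, x 2), ?_⟩, ?_⟩
  · rw [mem_sphere_zero_iff_norm, EuclideanSpace.norm_eq, Real.sqrt_eq_one] at hx
    simp only [Fin.sum_univ_three, Real.norm_eq_abs, sq_abs] at hx
    rw [← Complex.normSq_eq_norm_sq, Complex.normSq_apply]
    linarith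
  · ext i
    fin_cases i <;> simp [spherePoint]

theorem neg_spherePoint (w : ℂ) (h : ℝ) (H : ‖w‖ ^ 2 + h ^ 2 = 1) :
    -spherePoint ⟨(w, h), H⟩ = spherePoint ⟨(-w, -h), by simpa using H⟩ := by
  ext i
  fin_cases i <;> simp [spherePoint]

theorem spherePoint_eq_iff (w w' : ℂ) (h h' : ℝ) (H : ‖w‖ ^ 2 + h ^ 2 = 1)
    (H' : ‖w'‖ ^ 2 + h' ^ 2 = 1) :
    spherePoint ⟨(w, h), H⟩ = spherePoint ⟨(w', h'), H'⟩ ↔ w = w' ∧ h = h' := by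
  rw [spherePoint_injective.eq_iff, Subtype.mk.injEq, Prod.mk.injEq]

/-- The point of the projective plane with the given homogeneous coordinates. -/
noncomputable def projectivePoint (p : {p : ℂ × ℝ // ‖p.1‖ ^ 2 + p.2 ^ 2 = 1}) : ProjectivePlane :=
  Quot.mk _ (spherePoint p)

theorem continuous_projectivePoint : Continuous projectivePoint :=
  continuous_quot_mk.comp continuous_spherePoint

theorem projectivePoint_eq_iff (w w' : ℂ) (h h' : ℝ) (H : ‖w‖ ^ 2 + h ^ 2 = 1)
    (H' : ‖w'‖ ^ 2 + h' ^ 2 = 1) :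
    projectivePoint ⟨(w, h), H⟩ = projectivePoint ⟨(w', h'), H'⟩ ↔
      w' = w ∧ h' = h ∨ w' = -w ∧ h' = -h := by
  rw [projectivePoint, projectivePoint, projectivePlane_mk_eq_iff, neg_spherePoint,
    spherePoint_eq_iff, spherePoint_eq_iff]

end SpherePoints

/-! ### Orientability: where a Möbius band embeds -/

section Embeddings

/-- A Möbius band does not embed in the plane: the direction from a boundary point to the opposite
one turns an odd number of times along the boundary, but this loop of directions deforms to
one that runs twice through the directions between opposite points of the core. -/
theorem not_injective_moebiusBand_complex (f : C(MoebiusBand, ℂ)) : ¬ Function.Injective f := by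
  intro hf
  let F : ℝ × unitInterval → ℂ := fun x => f (moebiusCover x)
  have hFc : Continuous F := f.continuous.comp continuous_moebiusCover
  have hF1 : ∀ s t, F (s + 1, t) = F (s, unitInterval.symm t) := fun s t =>
    congrArg f ((moebiusCover_eq_iff _ _).2 ⟨-1, by simp, Or.inr ⟨by decide, rfl⟩⟩)
  -- A height that rises from the edge (`0` at `u = 0`) to the core (`1/2` at `u = 1`).
  let a : ℝ → unitInterval := fun u => ⟨max 0 (min 1 u) / 2, by positivity, by
    linarith [max_le zero_le_one (min_le_left 1 u)]⟩
  have ha : ∀ u, (a u : ℝ) = max 0 (min 1 u) / 2 := fun u => rfl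
  have ha0 : a 0 = 0 := Subtype.ext (by simp [ha])
  have ha1 : unitInterval.symm (a 1) = a 1 := Subtype.ext (by simp [ha]; norm_num)
  have hac : Continuous a := Continuous.subtype_mk (by fun_prop) _
  -- At `u = 0` the difference joins opposite edge points over the same `s`; at `u = 1` it joins
  -- core points half a turn apart. In between the two points stay distinct, because their abscissas
  -- differ by at most `1/2`.
  let Φ : ℝ × ℝ → ℂ := fun x => F (x.1, a x.2) - F (x.1 + a x.2, unitInterval.symm (a x.2))
  have hΦc : Continuous Φ := by fun_prop
  have hΦ0 : ∀ x, Φ x ≠ 0 := by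
    rintro ⟨s, u⟩ h
    obtain ⟨n, h1, h2⟩ := (moebiusCover_eq_iff _ _).1 (hf (sub_eq_zero.1 h))
    simp only at h1 h2
    have h1 : (a u : ℝ) = n := by linarith
    have hb : (a u : ℝ) ≤ 1 / 2 := by
      rw [ha]; linarith [max_le zero_le_one (min_le_left 1 u)]
    have hn : n < 1 := by
      have : (n : ℝ) < 1 := by linarith
      exact_mod_cast this
    have hn' : 0 ≤ n := by
      have : (0 : ℝ) ≤ n := by rw [← h1]; exact (a u).2.1
      exact_mod_cast this
    obtain rfl : n = 0 := by omega
    rcases h2 with ⟨-, h2⟩ | ⟨h2, -⟩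
    · have h2 := congrArg Subtype.val h2
      simp only [coe_symm_eq] at h2
      rw [h1] at h2
      norm_num at h2
    · simp at h2
  let d : C(ℝ × ℝ, Circle) := ⟨fun x => direction ⟨Φ x, hΦ0 x⟩,
    continuous_direction.comp (hΦc.subtype_mk _)⟩
  have hd : ∀ x, d x = direction ⟨Φ x, hΦ0 x⟩ := fun _ => rfl
  have hper : ∀ s u, Φ (s + 2, u) = Φ (s, u) := fun s u => by
    have hF2 : ∀ s t, F (s + 2, t) = F (s, t) := fun s t => by
      rw [show s + 2 = s + 1 + 1 by ring, hF1, hF1, unitInterval.symm_symm]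
    simp only [Φ]
    rw [hF2, add_right_comm, hF2]
  obtain ⟨g, hg, n, hn⟩ := exists_circle_lift_periodic d 2 (fun s u => by simp only [hd, hper])
  -- On the core the difference already has period 1, so the degree over the period 2 is even: `n =
  -- 2m`.
  obtain ⟨m, hm⟩ := circle_lift_sub (X := ℝ) (g₁ := fun s => g (s + 1, 1)) (g₂ := fun s => g (s, 1))
    (by fun_prop) (by fun_prop) fun s => by
      have : Φ (s + 1, 1) = Φ (s, 1) := by
        simp only [Φ, ha1]
        rw [hF1, add_right_comm, hF1, ha1]
      simp only [hg, hd, this]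
  -- On the edge a shift by 1 swaps the two points and reverses the direction. The angle thus grows
  -- by an odd multiple of `π`, and two such steps give `n = 2k + 1`.
  obtain ⟨k, hk⟩ := circle_lift_sub (X := ℝ) (g₁ := fun s => g (s + 1, 0))
    (g₂ := fun s => g (s, 0) + π) (by fun_prop) (by fun_prop) fun s => by
      have : Φ (s + 1, 0) = -Φ (s, 0) := by
        simp only [Φ, ha0]
        rw [hF1, add_right_comm, hF1]
        simp
      rw [Circle.exp_add, hg, hg]
      ext
      simp only [hd, coe_direction, this, norm_neg, Circle.coe_mul]
      rw [Circle.coe_exp, Complex.exp_pi_mul_I]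
      ring
  have e1 := hn 0 1
  have e0 := hn 0 0
  have m0 := hm 0
  have m1 := hm 1
  have k0 := hk 0
  have k1 := hk 1
  norm_num at e0 e1 m0 m1 k0 k1
  have hpi := Real.pi_pos
  have c1 : (n : ℝ) = 2 * m := by
    have : (n : ℝ) * (2 * π) = (2 * m) * (2 * π) := by linarith
    exact mul_right_cancel₀ (by positivity) this
  have c0 : (n : ℝ) = 2 * k + 1 := by
    have : (n : ℝ) * (2 * π) = (2 * k + 1) * (2 * π) := by linarith
    exact mul_right_cancel₀ (by positivity) this
  have : n = 2 * m := by exact_mod_cast c1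
  have : n = 2 * k + 1 := by exact_mod_cast c0
  omega

theorem isOrientable_of_forall {X : Type} [TopologicalSpace X]
    (h : ∀ f : C(MoebiusBand, X), ¬ Function.Injective f) : IsOrientable X := by
  rintro ⟨A, ⟨e⟩⟩
  exact h ⟨fun x => (e.symm x : X), by fun_prop⟩
    (Subtype.val_injective.comp e.symm.injective)

theorem not_isOrientable {X : Type} [TopologicalSpace X] [T2Space X] (f : C(MoebiusBand, X))
    (hf : Function.Injective f) : ¬ IsOrientable X := fun h =>
  h ⟨range f, ⟨(f.continuous.isClosedEmbedding hf).isEmbedding.toHomeomorph.symm⟩⟩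

theorem isOrientable_of_injective {X : Type} [TopologicalSpace X] (g : X → ℂ) (hc : Continuous g)
    (hg : Function.Injective g) : IsOrientable X :=
  isOrientable_of_forall fun f hf =>
    not_injective_moebiusBand_complex ⟨g ∘ f, by fun_prop⟩ (hg.comp hf)

theorem IsOrientable.congr {X Y : Type} [TopologicalSpace X] [TopologicalSpace Y] (h : X ≃ₜ Y) :
    IsOrientable X ↔ IsOrientable Y :=
  not_congr ⟨fun ⟨A, ⟨e⟩⟩ => ⟨h '' A, ⟨(h.image A).symm.trans e⟩⟩,
    fun ⟨A, ⟨e⟩⟩ => ⟨h.symm '' A, ⟨(h.symm.image A).symm.trans e⟩⟩⟩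

theorem isOrientable_disc : IsOrientable Disc :=
  isOrientable_of_injective (fun x => Complex.orthonormalBasisOneI.repr.symm x) (by fun_prop)
    (Complex.orthonormalBasisOneI.repr.symm.injective.comp Subtype.val_injective)

theorem isOrientable_annulus : IsOrientable Annulus := by
  refine isOrientable_of_injective (fun x => ((1 + x.2 : ℝ) : ℂ) * x.1) (by fun_prop) ?_
  rintro ⟨z, s⟩ ⟨w, t⟩ h
  simp only at h
  have hs := s.2.1
  have ht := t.2.1
  have hst : s = t := by
    have := congrArg norm h
    simp only [norm_mul, Complex.norm_real, Circle.norm_coe, mul_one] at this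
    rw [Real.norm_of_nonneg (by linarith), Real.norm_of_nonneg (by linarith)] at this
    exact Subtype.ext (by linarith)
  subst hst
  have hne : ((1 + s : ℝ) : ℂ) ≠ 0 := by
    exact_mod_cast (by linarith : (1 + s : ℝ) ≠ 0)
  rw [Circle.ext (mul_left_cancel₀ hne h)]

/-- A band that misses a point is carried into the plane by stereographic projection from that
point. A band that fills the sphere would be homeomorphic to it, although the band has a boundary
component and the sphere has none. -/
theorem isOrientable_sphere : IsOrientable Sphere := by
  refine isOrientable_of_forall fun f hf => ?_
  by_cases hs : Function.Surjective f
  · have := boundaryComponents_congr (Continuous.homeoOfEquivCompactToT2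
      (f := Equiv.ofBijective f ⟨hf, hs⟩) f.continuous)
    rw [boundaryComponents_eq_one isConnected_boundary_moebiusBand,
      boundaryComponents_eq_zero boundary_sphere] at this
    exact one_ne_zero this
  · obtain ⟨v, hv⟩ : ∃ v, ∀ x, f x ≠ v := by simpa [Function.Surjective] using hs
    have : Fact (Module.finrank ℝ (EuclideanSpace ℝ (Fin 3)) = 2 + 1) := ⟨by simp⟩
    let e := stereographic' 2 v
    have he : ∀ x, f x ∈ e.source := fun x => by simpa [e] using hv x
    refine not_injective_moebiusBand_complex
      ⟨fun x => Complex.orthonormalBasisOneI.repr.symm (e (f x)), ?_⟩ ?_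
    · exact Complex.orthonormalBasisOneI.repr.symm.continuous.comp
        (e.continuousOn.comp_continuous f.continuous he)
    · intro x y h
      exact hf (e.injOn (he x) (he y) (Complex.orthonormalBasisOneI.repr.symm.injective h))

/-- A continuous function on the square with values in the circle has a continuous angle. -/
theorem exists_circle_lift_square {f : Square → Circle} (hf : Continuous f) :
    ∃ g : Square → ℝ, Continuous g ∧ ∀ x, Circle.exp (g x) = f x := by
  let P : ℝ → unitInterval := projIcc 0 1 zero_le_one
  have hP : Continuous P := continuous_projIcc
  obtain ⟨g, hg⟩ := exists_circle_lift ⟨fun x => f (P x.1, P x.2), by fun_prop⟩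
  refine ⟨fun x => g (x.1, x.2), by fun_prop, fun x => ?_⟩
  simp [hg, P]

/-- The projection of the Möbius band to its core. -/
noncomputable def moebiusCore : MoebiusBand → Circle :=
  Quot.lift (fun x => Circle.exp (2 * π * x.1)) (by rintro _ _ ⟨t, rfl, rfl⟩; simp)

/-- Every map from the Möbius band to the circle is homotopic to a power of the projection to the
core. -/
theorem exists_moebiusBand_lift (f : C(MoebiusBand, Circle)) :
    ∃ (a : ℤ) (g : MoebiusBand → ℝ), Continuous g ∧
      ∀ x, f x = moebiusCore x ^ a * Circle.exp (g x) := by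
  obtain ⟨G, hGc, hG⟩ := exists_circle_lift_square (f := fun x => f (Quot.mk _ x))
    (f.continuous.comp continuous_quot_mk)
  -- Across the glued ends the angle jumps by a constant `2πa`. Subtracting a linear function of the
  -- core coordinate removes the jump, and the power of `moebiusCore` compensates for it.
  obtain ⟨a, ha⟩ := circle_lift_sub (X := unitInterval) (g₁ := fun t => G (1, unitInterval.symm t))
    (g₂ := fun t => G (0, t)) (by fun_prop) (by fun_prop) fun t => by
      rw [hG, hG]
      exact congrArg f (Quot.sound ⟨t, rfl, rfl⟩).symm
  refine ⟨a, Quot.lift (fun x => G x - 2 * π * x.1 * a) ?_, continuous_quot_lift _ (by fun_prop), ?_⟩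
  · rintro _ _ ⟨t, rfl, rfl⟩
    simp only [ha, Icc.coe_zero, Icc.coe_one]
    ring
  · rintro ⟨x⟩
    simp only [moebiusCore]
    rw [← Circle.exp_zsmul, ← Circle.exp_add, ← hG, zsmul_eq_mul]
    congr 1
    ring

/-- Needed to complete the primitive vector `(a', b')` to a unimodular matrix. For `a = b = 0` the
vector `(1, 0)` with `d = 0` serves. -/
theorem exists_bezout (a b : ℤ) : ∃ d a' b' u v : ℤ, a = d * a' ∧ b = d * b' ∧ a' * u + b' * v = 1 := by
  by_cases h : (Int.gcd a b : ℤ) = 0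
  · have h : Int.gcd a b = 0 := by exact_mod_cast h
    rw [Int.gcd_eq_zero_iff] at h
    exact ⟨0, 1, 0, 1, 0, by simp [h.1], by simp [h.2], by simp⟩
  · obtain ⟨a', ha⟩ := Int.gcd_dvd_left a b
    obtain ⟨b', hb⟩ := Int.gcd_dvd_right a b
    refine ⟨Int.gcd a b, a', b', Int.gcdA a b, Int.gcdB a b, ha, hb, mul_left_cancel₀ h ?_⟩
    have := Int.gcd_eq_gcd_ab a b
    calc _ = (Int.gcd a b * a') * Int.gcdA a b + (Int.gcd a b * b') * Int.gcdB a b := by ring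
      _ = _ := by rw [← ha, ← hb, ← this, mul_one]

/-- Along the core, a map from the band has degrees `(d a', d b')` with `a'`, `b'` coprime. In the
unimodular coordinates `q = z ^ u * w ^ v` and `z ^ (-b') * w ^ a'` of the torus, the second has
degree zero and hence a real angle `r`. An injective map would therefore give an injective map to
the cylinder, which the plane contains by `(r, q) ↦ e ^ r q`. The identities `e₁` and `e₂` invert
the coordinate change. -/
theorem isOrientable_torus : IsOrientable Torus := by
  refine isOrientable_of_forall fun f hf => ?_
  obtain ⟨a, g₁, hc₁, h₁⟩ := exists_moebiusBand_lift ⟨fun x => (f x).1, by fun_prop⟩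
  obtain ⟨b, g₂, hc₂, h₂⟩ := exists_moebiusBand_lift ⟨fun x => (f x).2, by fun_prop⟩
  obtain ⟨d, a', b', u, v, rfl, rfl, huv⟩ := exists_bezout a b
  simp only [ContinuousMap.coe_mk] at h₁ h₂
  let r : MoebiusBand → ℝ := fun x => -b' * g₁ x + a' * g₂ x
  let q : MoebiusBand → Circle := fun x => (f x).1 ^ u * (f x).2 ^ v
  have hr : ∀ x, (f x).1 ^ (-b') * (f x).2 ^ a' = Circle.exp (r x) := fun x => by
    rw [h₁, h₂, mul_zpow, mul_zpow, ← zpow_mul, ← zpow_mul, ← Circle.exp_zsmul, ← Circle.exp_zsmul,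
      mul_mul_mul_comm, ← zpow_add, ← Circle.exp_add]
    have : d * a' * -b' + d * b' * a' = 0 := by ring
    rw [this, zpow_zero, one_mul]
    simp [r]
  have e₁ : ∀ z w : Circle, (z ^ u * w ^ v) ^ a' * (z ^ (-b') * w ^ a') ^ (-v) = z := fun z w => by
    rw [mul_zpow, mul_zpow, ← zpow_mul, ← zpow_mul, ← zpow_mul, ← zpow_mul, mul_mul_mul_comm,
      ← zpow_add, ← zpow_add, show u * a' + -b' * -v = 1 by linarith,
      show v * a' + a' * -v = 0 by ring]
    simp
  have e₂ : ∀ z w : Circle, (z ^ u * w ^ v) ^ b' * (z ^ (-b') * w ^ a') ^ u = w := fun z w => by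
    rw [mul_zpow, mul_zpow, ← zpow_mul, ← zpow_mul, ← zpow_mul, ← zpow_mul, mul_mul_mul_comm,
      ← zpow_add, ← zpow_add, show u * b' + -b' * u = 0 by ring,
      show v * b' + a' * u = 1 by linarith]
    simp
  refine not_injective_moebiusBand_complex ⟨fun x => Real.exp (r x) * q x, ?_⟩ fun x y h => hf ?_
  · have : Continuous q := by
      simp only [q]
      fun_prop
    have : Continuous r := by fun_prop
    fun_prop
  · simp only [ContinuousMap.coe_mk] at h
    have hrr : r x = r y := by
      have := congrArg norm h
      simpa only [norm_mul, Complex.norm_real, Circle.norm_coe, mul_one, Real.norm_eq_abs,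
        Real.abs_exp, Real.exp_eq_exp] using this
    rw [hrr] at h
    have hq : q x = q y := Circle.ext (mul_left_cancel₀ (by
      exact_mod_cast (Real.exp_pos _).ne') h)
    ext1
    · rw [← e₁ (f x).1 (f x).2, ← e₁ (f y).1 (f y).2, hr, hr, hrr]
      simp only [q] at hq
      rw [hq]
    · rw [← e₂ (f x).1 (f x).2, ← e₂ (f y).1 (f y).2, hr, hr, hrr]
      simp only [q] at hq
      rw [hq]

theorem not_isOrientable_kleinBottle : ¬ IsOrientable KleinBottle := by
  -- The band is swept out by the half circle of angles from `-π/2` to `π/2`: inversion preserves it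
  -- and acts on it as `t ↦ 1 - t`.
  let k : Square → ℝ × Circle := fun x => (x.1, Circle.exp (π * (x.2 - 1 / 2)))
  have hinj : ∀ t t' : unitInterval,
      Circle.exp (π * (t' - 1 / 2)) = Circle.exp (π * (t - 1 / 2)) → t' = t := fun t t' h => by
    have hpi := Real.pi_pos
    have : π * (t' - 1 / 2) = π * ((t : ℝ) - 1 / 2) := by
      refine Circle.exp_injOn_Icc (a := - (π / 2)) (b := π / 2) (by linarith) ?_ ?_ h
      · constructor <;> nlinarith [t'.2.1, t'.2.2]
      · constructor <;> nlinarith [t.2.1, t.2.2]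
    have := mul_left_cancel₀ hpi.ne' this
    exact Subtype.ext (by linarith)
  have hsymm : ∀ t : unitInterval, Circle.exp (π * (unitInterval.symm t - 1 / 2)) =
      (Circle.exp (π * (t - 1 / 2)))⁻¹ := fun t => by
    rw [← Circle.exp_neg, coe_symm_eq]
    congr 1
    ring
  refine not_isOrientable ⟨Quot.lift (fun x => kleinCover (k x)) ?_,
    continuous_quot_lift _ (continuous_kleinCover.comp (by fun_prop))⟩ ?_
  · rintro _ _ ⟨t, rfl, rfl⟩
    refine (kleinCover_eq_iff _ _).2 ⟨1, by simp [k], Or.inr ⟨by decide, ?_⟩⟩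
    exact hsymm t
  · rintro ⟨⟨s, t⟩⟩ ⟨⟨s', t'⟩⟩ h
    obtain ⟨n, h1, h2⟩ := (kleinCover_eq_iff _ _).1 h
    change Quot.mk _ (s, t) = Quot.mk _ (s', t')
    rw [← moebiusCover_mk, ← moebiusCover_mk, moebiusCover_eq_iff]
    refine ⟨n, h1, h2.imp (And.imp_right fun h => hinj _ _ h) (And.imp_right fun h => hinj _ _ ?_)⟩
    rw [hsymm]
    exact h

theorem not_isOrientable_projectivePlane : ¬ IsOrientable ProjectivePlane := by
  have hpi := Real.pi_pos
  have hR : ∀ t : unitInterval, 0 < 1 - ((t : ℝ) - 1 / 2) ^ 2 := fun t => by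
    nlinarith [t.2.1, t.2.2]
  let R : unitInterval → ℝ := fun t => √(1 - ((t : ℝ) - 1 / 2) ^ 2)
  have hR0 : ∀ t, (R t : ℂ) ≠ 0 := fun t => by exact_mod_cast (Real.sqrt_pos.2 (hR t)).ne'
  have hRs : ∀ t, R (unitInterval.symm t) = R t := fun t => by
    simp only [R, coe_symm_eq]
    congr 1
    ring
  -- The zone of heights between `-1/2` and `1/2`, over half of the equator. Its two ends are
  -- antipodal with the heights reversed.
  let k : Square → {p : ℂ × ℝ // ‖p.1‖ ^ 2 + p.2 ^ 2 = 1} := fun x =>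
    ⟨(R x.2 * Circle.exp (π * x.1), x.2 - 1 / 2), by
      simp only [norm_mul, Complex.norm_real, Circle.norm_coe, mul_one, Real.norm_eq_abs, sq_abs, R]
      rw [Real.sq_sqrt (hR _).le]
      ring⟩
  have hk : Continuous k := by
    have : Continuous R := by fun_prop
    exact Continuous.subtype_mk (by fun_prop) _
  have hexp : ∀ s : ℝ, (Circle.exp (s + π) : ℂ) = - Circle.exp s := fun s => by
    rw [Circle.exp_add, Circle.coe_mul, Circle.coe_exp π, Complex.exp_pi_mul_I]
    ring
  refine not_isOrientable ⟨Quot.lift (fun x => projectivePoint (k x)) ?_,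
    continuous_quot_lift _ (continuous_projectivePoint.comp hk)⟩ ?_
  · rintro _ _ ⟨t, rfl, rfl⟩
    refine (projectivePoint_eq_iff _ _ _ _ _ _).2 (Or.inr ⟨?_, ?_⟩)
    · simp only [hRs]
      have := hexp 0
      simp only [zero_add] at this
      simp [-Circle.coe_exp, this]
    · simp only [coe_symm_eq]
      ring
  · rintro ⟨⟨s, t⟩⟩ ⟨⟨s', t'⟩⟩ h
    have bs := s.2
    have bs' := s'.2
    change Quot.mk _ (s, t) = Quot.mk _ (s', t')
    rw [← moebiusCover_mk, ← moebiusCover_mk, moebiusCover_eq_iff]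
    rcases (projectivePoint_eq_iff _ _ _ _ _ _).1 h with ⟨h1, h2⟩ | ⟨h1, h2⟩
    · obtain rfl : t' = t := Subtype.ext (by linarith)
      have h3 := Circle.ext (mul_left_cancel₀ (hR0 _) h1)
      have : π * (s' : ℝ) = π * s := by
        refine Circle.exp_injOn_Icc (a := 0) (b := π) (by linarith) ?_ ?_ h3
        · constructor <;> nlinarith [bs'.1, bs'.2]
        · constructor <;> nlinarith [bs.1, bs.2]
      exact ⟨0, by simpa using mul_left_cancel₀ hpi.ne' this, Or.inl ⟨by simp, rfl⟩⟩
    · obtain rfl : t' = unitInterval.symm t := Subtype.ext (by rw [coe_symm_eq]; linarith)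
      simp only [hRs] at h1
      rw [← mul_neg, ← hexp] at h1
      have h3 := Circle.ext (mul_left_cancel₀ (hR0 _) h1)
      obtain ⟨m, hm⟩ := Circle.exp_eq_exp.1 h3
      refine ⟨2 * m + 1, ?_, Or.inr ⟨by simp, rfl⟩⟩
      have : π * (s' : ℝ) = π * (s + (2 * m + 1)) := by rw [hm]; ring
      push_cast
      exact mul_left_cancel₀ hpi.ne' this

theorem isOrientable_model (s : SurfaceType) : IsOrientable s.model ↔ s.orientable = true := by
  cases s
  · exact iff_of_true isOrientable_sphere rfl
  · exact iff_of_true isOrientable_torus rfl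
  · exact iff_of_true isOrientable_disc rfl
  · exact iff_of_true isOrientable_annulus rfl
  · exact iff_of_false not_isOrientable_projectivePlane (by simp [SurfaceType.orientable])
  · exact iff_of_false not_isOrientable_kleinBottle (by simp [SurfaceType.orientable])
  · refine iff_of_false (not_isOrientable (X := MoebiusBand) (ContinuousMap.id _) fun _ _ h => h) (by simp [SurfaceType.orientable])

end Embeddings

/-! ### Tools for checking the gluings -/

section Preparations

theorem proj_same (w : GluingScheme) (i j : Fin 4) (hij : i ≠ j)
    (h : (w.word i).1 = (w.word j).1) (he : (w.word i).2 = (w.word j).2) (t : unitInterval) :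
    proj w (side i t) = proj w (side j t) :=
  Quot.sound (Glue.same i j t hij h he)

theorem proj_opposite (w : GluingScheme) (i j : Fin 4) (hij : i ≠ j)
    (h : (w.word i).1 = (w.word j).1) (he : (w.word i).2 ≠ (w.word j).2) (t : unitInterval) :
    proj w (side i t) = proj w (side j (unitInterval.symm t)) :=
  Quot.sound (Glue.opposite i j t hij h he)

/-- It suffices to check that a function respects the gluing for pairs of sides in increasing
order. -/
theorem respects_glue {w : GluingScheme} {X : Type*} (f : Square → X)
    (h : ∀ i j : Fin 4, i < j → (w.word i).1 = (w.word j).1 → ∀ t, f (side i t) =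
      f (side j (if (w.word i).2 = (w.word j).2 then t else unitInterval.symm t))) (x y : Square)
    (hxy : Glue w x y) : f x = f y := by
  cases hxy with
  | same i j t hij hl he =>
    rcases lt_or_gt_of_ne hij with hlt | hlt
    · simpa [he] using h i j hlt hl t
    · simpa [he] using (h j i hlt hl.symm t).symm
  | opposite i j t hij hl he =>
    rcases lt_or_gt_of_ne hij with hlt | hlt
    · simpa [he] using h i j hlt hl t
    · simpa [he.symm] using (h j i hlt hl.symm (unitInterval.symm t)).symm

theorem circle_exp_pi_eq_iff {a b : ℝ} :
    Circle.exp (π * a) = Circle.exp (π * b) ↔ ∃ n : ℤ, a = b + 2 * n := by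
  rw [Circle.exp_eq_exp]
  refine exists_congr fun n => ⟨fun h => ?_, fun h => by rw [h]; ring⟩
  have : π * a = π * (b + 2 * n) := by rw [h]; ring
  exact mul_left_cancel₀ Real.pi_ne_zero this

theorem circle_exp_two_pi_eq {t t' : unitInterval}
    (h : Circle.exp (2 * π * t) = Circle.exp (2 * π * t')) :
    t = t' ∨ t = 0 ∧ t' = 1 ∨ t = 1 ∧ t' = 0 := by
  have h : Circle.exp (π * (2 * t)) = Circle.exp (π * (2 * t')) := by
    rw [← mul_assoc, ← mul_assoc, mul_comm π 2, h]
  obtain ⟨n, hn⟩ := circle_exp_pi_eq_iff.1 h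
  have hn : (t : ℝ) = t' + n := by linarith
  have b1 := t.2.1
  have b2 := t.2.2
  have b3 := t'.2.1
  have b4 := t'.2.2
  have h1 : n ≤ 1 := by exact_mod_cast (by linarith : (n : ℝ) ≤ 1)
  have h2 : -1 ≤ n := by exact_mod_cast (by linarith : (-1 : ℝ) ≤ n)
  obtain rfl | rfl | rfl : n = -1 ∨ n = 0 ∨ n = 1 := by omega
  · push_cast at hn
    exact Or.inr (Or.inl ⟨Subtype.ext (by push_cast; linarith), Subtype.ext (by push_cast; linarith)⟩)
  · exact Or.inl (Subtype.ext (by simpa using hn))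
  · push_cast at hn
    exact Or.inr (Or.inr ⟨Subtype.ext (by push_cast; linarith), Subtype.ext (by push_cast; linarith)⟩)

theorem exists_unitInterval_exp (z : Circle) : ∃ t : unitInterval, Circle.exp (2 * π * t) = z := by
  obtain ⟨a, rfl⟩ := Circle.exp_surjective z
  refine ⟨⟨Int.fract (a / (2 * π)), Int.fract_nonneg _, (Int.fract_lt_one _).le⟩, ?_⟩
  rw [Circle.exp_eq_exp]
  refine ⟨-⌊a / (2 * π)⌋, ?_⟩
  have := Real.pi_pos
  have h := Int.self_sub_floor (a / (2 * π))
  simp only [← h]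
  push_cast
  field_simp
  ring

/-- Polar coordinates are continuous as long as the angle is wherever the radius is nonzero. -/
theorem continuous_polar {X : Type*} [TopologicalSpace X] {R : X → ℝ} {u : X → ℂ}
    (hR : Continuous R) (hu : ∀ x, ‖u x‖ ≤ 1) (h : ∀ x, R x ≠ 0 → ContinuousAt u x) :
    Continuous fun x => (R x : ℂ) * u x := by
  refine continuous_iff_continuousAt.2 fun x => ?_
  by_cases hx : R x = 0
  · have h0 : (R x : ℂ) * u x = 0 := by simp [hx]
    rw [ContinuousAt, h0]
    refine squeeze_zero_norm (a := fun x => |R x|) (fun y => ?_) ?_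
    · rw [norm_mul, Complex.norm_real, Real.norm_eq_abs]
      exact mul_le_of_le_one_right (abs_nonneg _) (hu y)
    · have := hR.abs.tendsto x
      rwa [hx, abs_zero] at this
  · exact (Complex.continuous_ofReal.comp hR).continuousAt.mul (h x hx)

theorem polar_arg (w : ℂ) : w = ‖w‖ * Circle.exp (π * (w.arg / π)) := by
  rw [mul_div_cancel₀ _ Real.pi_ne_zero, Circle.coe_exp, Complex.norm_mul_exp_arg_mul_I]

theorem abs_arg_div_pi_le (w : ℂ) : |w.arg / π| ≤ 1 := by
  rw [abs_div, abs_of_pos Real.pi_pos, div_le_one Real.pi_pos]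
  exact Complex.abs_arg_le_pi w

end Preparations

/-! ### Annulus, torus, Klein bottles and Möbius bands from the square -/

section StripSurfaces

/-- The glued horizontal sides close the second coordinate up to a circle. As for the other listed
schemes, three goals remain for `quotHomeo`: the map is onto, it respects the gluing, and it
identifies nothing more. -/
theorem surface_annulus : Nonempty (Surface (listed 5) ≃ₜ Annulus) := by
  have g : ∀ t, proj (listed 5) (t, 0) = proj (listed 5) (t, 1) := fun t => by
    simpa [side] using proj_opposite (listed 5) 0 2 (by decide) rfl (by decide) t
  refine ⟨quotHomeo (fun x => (Circle.exp (2 * π * x.2), x.1)) (by fun_prop) ?_ ?_ ?_⟩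
  · rintro ⟨z, s⟩
    obtain ⟨t, rfl⟩ := exists_unitInterval_exp z
    exact ⟨(s, t), rfl⟩
  · refine respects_glue _ fun i j hij h t => ?_
    fin_cases i <;> fin_cases j <;> simp [listed] at hij h
    all_goals simp [listed, side]
  · rintro ⟨s, t⟩ ⟨s', t'⟩ h
    simp only [Prod.mk.injEq] at h
    obtain ⟨h, rfl⟩ := h
    rcases circle_exp_two_pi_eq h with rfl | ⟨rfl, rfl⟩ | ⟨rfl, rfl⟩
    · rfl
    · exact g s
    · exact (g s).symm

theorem surface_torus : Nonempty (Surface (listed 6) ≃ₜ Torus) := by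
  have g₁ : ∀ t, proj (listed 6) (t, 0) = proj (listed 6) (t, 1) := fun t => by
    simpa [side] using proj_opposite (listed 6) 0 2 (by decide) rfl (by decide) t
  have g₂ : ∀ t, proj (listed 6) (1, t) = proj (listed 6) (0, t) := fun t => by
    simpa [side] using proj_opposite (listed 6) 1 3 (by decide) rfl (by decide) t
  refine ⟨quotHomeo (fun x => (Circle.exp (2 * π * x.1), Circle.exp (2 * π * x.2)))
    (by fun_prop) ?_ ?_ ?_⟩
  · rintro ⟨z, w⟩
    obtain ⟨s, rfl⟩ := exists_unitInterval_exp z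
    obtain ⟨t, rfl⟩ := exists_unitInterval_exp w
    exact ⟨(s, t), rfl⟩
  · refine respects_glue _ fun i j hij h t => ?_
    fin_cases i <;> fin_cases j <;> simp [listed] at hij h
    all_goals simp [listed, side]
  · rintro ⟨s, t⟩ ⟨s', t'⟩ h
    simp only [Prod.mk.injEq] at h
    trans proj (listed 6) (s, t')
    · rcases circle_exp_two_pi_eq h.2 with rfl | ⟨rfl, rfl⟩ | ⟨rfl, rfl⟩
      · rfl
      · exact g₁ s
      · exact (g₁ s).symm
    · rcases circle_exp_two_pi_eq h.1 with rfl | ⟨rfl, rfl⟩ | ⟨rfl, rfl⟩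
      · rfl
      · exact (g₂ t').symm
      · exact g₂ t'

/-- The horizontal sides close the second coordinate up to a circle, and the reflection `t ↦ 1 - t`
that glues the vertical sides becomes inversion of the circle. -/
theorem surface_kleinBottle_abab : Nonempty (Surface (listed 7) ≃ₜ KleinBottle) := by
  have g₁ : ∀ t, proj (listed 7) (t, 0) = proj (listed 7) (t, 1) := fun t => by
    simpa [side] using proj_opposite (listed 7) 0 2 (by decide) rfl (by decide) t
  have g₂ : ∀ t, proj (listed 7) (1, t) = proj (listed 7) (0, unitInterval.symm t) := fun t => by
    simpa [side] using proj_same (listed 7) 1 3 (by decide) rfl (by decide) t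
  have g₃ : ∀ s t t' : unitInterval, Circle.exp (2 * π * t) = Circle.exp (2 * π * t') →
      proj (listed 7) (s, t) = proj (listed 7) (s, t') := fun s t t' h => by
    rcases circle_exp_two_pi_eq h with rfl | ⟨rfl, rfl⟩ | ⟨rfl, rfl⟩
    · rfl
    · exact g₁ s
    · exact (g₁ s).symm
  have hsymm : ∀ t : unitInterval, Circle.exp (2 * π * unitInterval.symm t) =
      (Circle.exp (2 * π * t))⁻¹ := fun t => by
    rw [coe_symm_eq, mul_sub, mul_one, sub_eq_add_neg, Circle.exp_add, Circle.exp_two_pi, one_mul,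
      Circle.exp_neg]
  refine ⟨quotHomeo (fun x => kleinCover (x.1, Circle.exp (2 * π * x.2)))
    (continuous_kleinCover.comp (by fun_prop)) ?_ ?_ ?_⟩
  · rintro ⟨s, z⟩
    obtain ⟨t, rfl⟩ := exists_unitInterval_exp z
    exact ⟨(s, t), kleinCover_mk _ _⟩
  · refine respects_glue _ fun i j hij h t => ?_
    fin_cases i <;> fin_cases j <;> simp [listed] at hij h
    all_goals simp [listed, side]
    refine ((kleinCover_eq_iff _ _).2 ⟨1, by simp, Or.inr ⟨by decide, ?_⟩⟩).symm
    have h := hsymm t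
    rw [coe_symm_eq] at h
    simp only [h, inv_inv]
  · rintro ⟨s, t⟩ ⟨s', t'⟩ h
    obtain ⟨n, hn, hc⟩ := (kleinCover_eq_iff _ _).1 h
    simp only at hn hc
    have b1 := s.2.1
    have b2 := s.2.2
    have b3 := s'.2.1
    have b4 := s'.2.2
    have h1 : n ≤ 1 := by exact_mod_cast (by linarith : (n : ℝ) ≤ 1)
    have h2 : -1 ≤ n := by exact_mod_cast (by linarith : (-1 : ℝ) ≤ n)
    obtain rfl | rfl | rfl : n = -1 ∨ n = 0 ∨ n = 1 := by omega
    · push_cast at hn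
      obtain rfl : s = 1 := Subtype.ext (by push_cast; linarith)
      obtain rfl : s' = 0 := Subtype.ext (by push_cast; linarith)
      have h := (hc.resolve_left fun h => by simp at h).2
      rw [← hsymm] at h
      exact (g₂ t).trans (g₃ 0 _ _ h.symm)
    · obtain rfl : s' = s := Subtype.ext (by simpa using hn)
      exact g₃ _ _ _ (hc.resolve_right fun h => h.1 (by simp)).2.symm
    · push_cast at hn
      obtain rfl : s = 0 := Subtype.ext (by push_cast; linarith)
      obtain rfl : s' = 1 := Subtype.ext (by push_cast; linarith)
      have h := (hc.resolve_left fun h => by simp at h).2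
      rw [← hsymm] at h
      have := g₂ (unitInterval.symm t)
      rw [unitInterval.symm_symm] at this
      exact this.symm.trans (g₃ 1 _ _ h.symm)

theorem surface_moebiusBand_abac : Nonempty (Surface (listed 8) ≃ₜ MoebiusBand) := by
  have g : ∀ t, proj (listed 8) (t, 0) = proj (listed 8) (unitInterval.symm t, 1) := fun t => by
    simpa [side] using proj_same (listed 8) 0 2 (by decide) rfl (by decide) t
  refine ⟨quotHomeo (fun x => Quot.mk _ (x.2, x.1)) (continuous_quot_mk.comp (by fun_prop))
    ?_ ?_ ?_⟩
  · rintro ⟨s, t⟩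
    exact ⟨(t, s), rfl⟩
  · refine respects_glue _ fun i j hij h t => ?_
    fin_cases i <;> fin_cases j <;> simp [listed] at hij h
    all_goals simp [listed, side]
    exact Quot.sound ⟨t, rfl, rfl⟩
  · intro x y h
    have := congrArg (Quot.lift (fun x => proj (listed 8) (x.2, x.1)) (by
      rintro _ _ ⟨t, rfl, rfl⟩; exact g t)) h
    exact this

/-- The square is mapped to the strip by `(s + t, min s (1 - t))`. Over an abscissa `c ≤ 1` it fills
the heights `[0, c]`, over `c ≥ 1` the heights `[0, 2 - c]`. Shifted back by 1 and flipped, the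
second half fills the heights `[c - 1, 1]` over `c - 1`. So the two halves together fill the band
and meet along the diagonal, which is the image of the two glued sides. -/
theorem surface_moebiusBand_aabc : Nonempty (Surface (listed 3) ≃ₜ MoebiusBand) := by
  have g : ∀ t, proj (listed 3) (t, 0) = proj (listed 3) (1, t) := fun t => by
    simpa [side] using proj_same (listed 3) 0 1 (by decide) rfl (by decide) t
  let m : Square → unitInterval := fun x => min x.1 (unitInterval.symm x.2)
  have hm : ∀ s t : unitInterval, (s : ℝ) ≤ 1 - t ∧ (m (s, t) : ℝ) = s ∨
      1 - (t : ℝ) ≤ s ∧ (m (s, t) : ℝ) = 1 - t := fun s t => by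
    rcases le_total s (unitInterval.symm t) with h | h
    · exact Or.inl ⟨by simpa using Subtype.coe_le_coe.2 h, by simp [m, h]⟩
    · exact Or.inr ⟨by simpa using Subtype.coe_le_coe.2 h, by simp [m, h]⟩
  -- By symmetry only deck transformations with `n ≥ 0` need checking. Since `s + t` lies in `[0,
  -- 2]`, also `n ≤ 2`, and `n = 2` only joins opposite corners.
  have key : ∀ (s t s' t' : unitInterval) (n : ℤ), 0 ≤ n → (s' + t' : ℝ) = s + t + n →
      (Even n ∧ m (s', t') = m (s, t) ∨ ¬ Even n ∧ m (s', t') = unitInterval.symm (m (s, t))) →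
      proj (listed 3) (s, t) = proj (listed 3) (s', t') := by
    intro s t s' t' n h0 hn h
    have b1 := s.2
    have b2 := t.2
    have b3 := s'.2
    have b4 := t'.2
    simp only [mem_Icc] at b1 b2 b3 b4
    have h2 : n ≤ 2 := by exact_mod_cast (by linarith : (n : ℝ) ≤ 2)
    obtain rfl | rfl | rfl : n = 0 ∨ n = 1 ∨ n = 2 := by omega
    · have h := congrArg Subtype.val (h.resolve_right fun h => h.1 (by simp)).2
      push_cast at hn
      have hs : s = s' := Subtype.ext <| by
        rcases hm s t with ⟨_, _⟩ | ⟨_, _⟩ <;> rcases hm s' t' with ⟨_, _⟩ | ⟨_, _⟩ <;> linarith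
      subst hs
      rw [Subtype.ext (by linarith : (t : ℝ) = t')]
    · have h := congrArg Subtype.val (h.resolve_left fun h => by simp at h).2
      simp only [coe_symm_eq] at h
      push_cast at hn
      have ht : t = 0 := Subtype.ext <| by
        push_cast
        rcases hm s t with ⟨_, _⟩ | ⟨_, _⟩ <;> rcases hm s' t' with ⟨_, _⟩ | ⟨_, _⟩ <;> linarith
      subst ht
      have hs : s' = 1 := Subtype.ext <| by
        push_cast at *
        rcases hm s 0 with ⟨_, _⟩ | ⟨_, _⟩ <;> rcases hm s' t' with ⟨_, _⟩ | ⟨_, _⟩ <;>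
          push_cast at * <;> linarith
      subst hs
      rw [Subtype.ext (by push_cast at hn; linarith : (t' : ℝ) = s)]
      exact g s
    · push_cast at hn
      obtain rfl : s = 0 := Subtype.ext (by push_cast; linarith)
      obtain rfl : t = 0 := Subtype.ext (by push_cast; linarith)
      obtain rfl : s' = 1 := Subtype.ext (by push_cast; linarith)
      obtain rfl : t' = 1 := Subtype.ext (by push_cast; linarith)
      exact (g 0).trans (g 1)
  refine ⟨quotHomeo (fun x => moebiusCover ((x.1 : ℝ) + x.2, m x))
    (continuous_moebiusCover.comp (by fun_prop)) ?_ ?_ ?_⟩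
  · rintro ⟨a, b⟩
    rw [← moebiusCover_mk]
    have ha := a.2
    have hb := b.2
    simp only [mem_Icc] at ha hb
    rcases le_total (b : ℝ) a with h | h
    · refine ⟨(b, ⟨a - b, by constructor <;> linarith⟩), congrArg moebiusCover ?_⟩
      refine Prod.ext (by simp) (Subtype.ext ?_)
      rcases hm b ⟨a - b, by constructor <;> linarith⟩ with ⟨h1, h2⟩ | ⟨h1, h2⟩ <;>
        simp only at h1 h2 ⊢ <;> linarith
    · refine ⟨(⟨a + 1 - b, by constructor <;> linarith⟩, b),
        ((moebiusCover_eq_iff _ _).2 ⟨1, by simp, Or.inr ⟨by decide, Subtype.ext ?_⟩⟩).symm⟩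
      rcases hm ⟨a + 1 - b, by constructor <;> linarith⟩ b with ⟨h1, h2⟩ | ⟨h1, h2⟩ <;>
        simp only [coe_symm_eq] at h1 h2 ⊢ <;> linarith
  · refine respects_glue _ fun i j hij h t => ?_
    fin_cases i <;> fin_cases j <;> simp [listed] at hij h
    simp only [listed, side]
    refine (moebiusCover_eq_iff _ _).2 ⟨1, by simp [add_comm], Or.inr ⟨by decide, ?_⟩⟩
    have h1 : min 1 (unitInterval.symm t) = unitInterval.symm t := min_eq_right unitInterval.le_one'
    have h2 : min t 1 = t := min_eq_left unitInterval.le_one'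
    simp [m, h1, h2]
  · rintro ⟨s, t⟩ ⟨s', t'⟩ h
    obtain ⟨n, hn, hc⟩ := (moebiusCover_eq_iff _ _).1 h
    rcases le_total 0 n with h0 | h0
    · exact key s t s' t' n h0 hn hc
    · obtain ⟨k, hk, hc'⟩ := (moebiusCover_eq_iff _ _).1 h.symm
      simp only at hn hk
      refine (key s' t' s t k ?_ hk hc').symm
      have : (k : ℝ) = ((-n : ℤ) : ℝ) := by push_cast; linarith
      have : k = -n := by exact_mod_cast this
      omega

/-- Seen in the coordinates `s + t` and `s - t`, the square is a diamond. Going from a side to its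
partner changes `s + t` by 1 and replaces `s - t` by `1 - (s - t)` modulo 2. The offset `1/2` in the
angle turns this reflection into inversion of the circle. -/
theorem surface_kleinBottle_aabb : Nonempty (Surface (listed 4) ≃ₜ KleinBottle) := by
  have g₁ : ∀ t, proj (listed 4) (t, 0) = proj (listed 4) (1, t) := fun t => by
    simpa [side] using proj_same (listed 4) 0 1 (by decide) rfl (by decide) t
  have g₂ : ∀ t, proj (listed 4) (t, 1) = proj (listed 4) (0, t) := fun t => by
    simpa [side] using proj_same (listed 4) 2 3 (by decide) rfl (by decide) (unitInterval.symm t)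
  -- Here `n` counts deck transformations of the cylinder and `m` turns of the circle.
  have key : ∀ (s t s' t' : unitInterval) (n m : ℤ), 0 ≤ n → (s' + t' : ℝ) = s + t + n →
      (Even n ∧ (s' - t' : ℝ) = s - t + 2 * m ∨ ¬ Even n ∧ (s' - t' : ℝ) = 1 - (s - t) + 2 * m) →
      proj (listed 4) (s, t) = proj (listed 4) (s', t') := by
    intro s t s' t' n m h0 hn h
    have b1 := s.2
    have b2 := t.2
    have b3 := s'.2
    have b4 := t'.2
    simp only [mem_Icc] at b1 b2 b3 b4
    have h2 : n ≤ 2 := by exact_mod_cast (by linarith : (n : ℝ) ≤ 2)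
    obtain rfl | rfl | rfl : n = 0 ∨ n = 1 ∨ n = 2 := by omega
    · have h := (h.resolve_right fun h => h.1 (by simp)).2
      push_cast at hn
      have m1 : m ≤ 1 := by exact_mod_cast (by linarith : (m : ℝ) ≤ 1)
      have m2 : -1 ≤ m := by exact_mod_cast (by linarith : (-1 : ℝ) ≤ m)
      have hc : proj (listed 4) (0, 1) = proj (listed 4) (1, 0) :=
        (g₂ 1).symm.trans (g₁ 1).symm
      obtain rfl | rfl | rfl : m = -1 ∨ m = 0 ∨ m = 1 := by omega
      · push_cast at h
        obtain rfl : s = 1 := Subtype.ext (by push_cast; linarith)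
        obtain rfl : t = 0 := Subtype.ext (by push_cast; linarith)
        obtain rfl : s' = 0 := Subtype.ext (by push_cast; linarith)
        obtain rfl : t' = 1 := Subtype.ext (by push_cast; linarith)
        exact hc.symm
      · push_cast at h
        rw [Subtype.ext (by linarith : (s : ℝ) = s'), Subtype.ext (by linarith : (t : ℝ) = t')]
      · push_cast at h
        obtain rfl : s = 0 := Subtype.ext (by push_cast; linarith)
        obtain rfl : t = 1 := Subtype.ext (by push_cast; linarith)
        obtain rfl : s' = 1 := Subtype.ext (by push_cast; linarith)
        obtain rfl : t' = 0 := Subtype.ext (by push_cast; linarith)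
        exact hc
    · have h := (h.resolve_left fun h => by simp at h).2
      push_cast at hn
      have m1 : m ≤ 0 := by exact_mod_cast (by linarith : (m : ℝ) ≤ 0)
      have m2 : -1 ≤ m := by exact_mod_cast (by linarith : (-1 : ℝ) ≤ m)
      obtain rfl | rfl : m = -1 ∨ m = 0 := by omega
      · push_cast at h
        obtain rfl : s = 0 := Subtype.ext (by push_cast; linarith)
        obtain rfl : t' = 1 := Subtype.ext (by push_cast; linarith)
        push_cast at h hn
        rw [Subtype.ext (by linarith : (s' : ℝ) = t)]
        exact (g₂ t).symm
      · push_cast at h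
        obtain rfl : t = 0 := Subtype.ext (by push_cast; linarith)
        obtain rfl : s' = 1 := Subtype.ext (by push_cast; linarith)
        push_cast at h hn
        rw [Subtype.ext (by linarith : (t' : ℝ) = s)]
        exact g₁ s
    · push_cast at hn
      obtain rfl : s = 0 := Subtype.ext (by push_cast; linarith)
      obtain rfl : t = 0 := Subtype.ext (by push_cast; linarith)
      obtain rfl : s' = 1 := Subtype.ext (by push_cast; linarith)
      obtain rfl : t' = 1 := Subtype.ext (by push_cast; linarith)
      exact (g₁ 0).trans (g₁ 1)
  let f : Square → KleinBottle := fun x =>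
    kleinCover ((x.1 : ℝ) + x.2, Circle.exp (π * (x.1 - x.2 - 1 / 2)))
  have hf : ∀ s t s' t' : unitInterval, f (s, t) = f (s', t') ↔ ∃ n m : ℤ,
      (s' + t' : ℝ) = s + t + n ∧
        (Even n ∧ (s' - t' : ℝ) = s - t + 2 * m ∨ ¬ Even n ∧ (s' - t' : ℝ) = 1 - (s - t) + 2 * m) := by
    intro s t s' t'
    rw [kleinCover_eq_iff]
    simp only [← Circle.exp_neg, ← mul_neg, circle_exp_pi_eq_iff]
    refine exists_congr fun n => ?_
    constructor
    · rintro ⟨hn, ⟨he, m, hm⟩ | ⟨he, m, hm⟩⟩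
      · exact ⟨m, hn, Or.inl ⟨he, by linarith⟩⟩
      · exact ⟨m, hn, Or.inr ⟨he, by linarith⟩⟩
    · rintro ⟨m, hn, ⟨he, hm⟩ | ⟨he, hm⟩⟩
      · exact ⟨hn, Or.inl ⟨he, m, by linarith⟩⟩
      · exact ⟨hn, Or.inr ⟨he, m, by linarith⟩⟩
  refine ⟨quotHomeo f (continuous_kleinCover.comp (by fun_prop)) ?_ ?_ ?_⟩
  · rintro ⟨a, z⟩
    rw [← kleinCover_mk]
    obtain ⟨c, hc1, hc2, hz⟩ : ∃ c : ℝ, -1 ≤ c ∧ c ≤ 1 ∧ z = Circle.exp (π * (c - 1 / 2)) := by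
      let w := z * Circle.exp (π * (1 / 2))
      have hw := abs_le.1 (abs_arg_div_pi_le w)
      refine ⟨(w : ℂ).arg / π, hw.1, hw.2, ?_⟩
      have : Circle.exp (π * ((w : ℂ).arg / π)) = w := by
        rw [mul_div_cancel₀ _ Real.pi_ne_zero, Circle.exp_arg]
      rw [mul_sub, sub_eq_add_neg, Circle.exp_add, this, Circle.exp_neg, mul_inv_cancel_right]
    subst hz
    have ha := a.2
    simp only [mem_Icc] at ha
    -- Points with `|c| ≤ a` lie in the lower half of the diamond. The others are found in the upper
    -- half, where `s + t = a + 1` and `s - t` is `1 - c` or `-1 - c`.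
    rcases lt_or_ge (a : ℝ) c with h | h
    · refine ⟨(⟨(a + 1 + (1 - c)) / 2, by constructor <;> linarith⟩,
        ⟨(a + 1 - (1 - c)) / 2, by constructor <;> linarith⟩),
        ((kleinCover_eq_iff _ _).2 ⟨1, by push_cast; ring, Or.inr ⟨by decide, ?_⟩⟩).symm⟩
      simp only [← Circle.exp_neg, ← mul_neg, circle_exp_pi_eq_iff]
      exact ⟨0, by push_cast; ring⟩
    · rcases lt_or_ge c (-a) with h' | h'
      · refine ⟨(⟨(a + 1 + (-1 - c)) / 2, by constructor <;> linarith⟩,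
          ⟨(a + 1 - (-1 - c)) / 2, by constructor <;> linarith⟩),
          ((kleinCover_eq_iff _ _).2 ⟨1, by push_cast; ring, Or.inr ⟨by decide, ?_⟩⟩).symm⟩
        simp only [← Circle.exp_neg, ← mul_neg, circle_exp_pi_eq_iff]
        exact ⟨-1, by push_cast; ring⟩
      · refine ⟨(⟨(a + c) / 2, by constructor <;> linarith⟩,
          ⟨(a - c) / 2, by constructor <;> linarith⟩), congrArg kleinCover ?_⟩
        refine Prod.ext ?_ (congrArg Circle.exp ?_)
        · simp only
          ring
        · simp only
          ring
  · refine respects_glue _ fun i j hij h t => ?_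
    fin_cases i <;> fin_cases j <;> simp [listed] at hij h
    · simp only [listed, side]
      exact (hf _ _ _ _).2 ⟨1, 0, by simp [add_comm], Or.inr ⟨by decide, by simp⟩⟩
    · simp only [listed, side]
      refine (hf _ _ _ _).2 ⟨-1, -1, ?_, Or.inr ⟨by decide, ?_⟩⟩
      · simp
      · simp
        ring
  · rintro ⟨s, t⟩ ⟨s', t'⟩ h
    obtain ⟨n, m, hn, hm⟩ := (hf _ _ _ _).1 h
    rcases le_total 0 n with h0 | h0
    · exact key s t s' t' n m h0 hn hm
    · obtain ⟨k, l, hk, hl⟩ := (hf _ _ _ _).1 h.symm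
      refine (key s' t' s t k l ?_ hk hl).symm
      have : (k : ℝ) = ((-n : ℤ) : ℝ) := by push_cast; linarith
      have : k = -n := by exact_mod_cast this
      omega

end StripSurfaces

/-! ### Polar coordinates and the disc -/

section PolarSurfaces

theorem continuous_polar_exp {X : Type*} [TopologicalSpace X] {R a b : X → ℝ} (hR : Continuous R)
    (ha : Continuous a) (hb : Continuous b) (h : ∀ x, R x ≠ 0 → b x ≠ 0) :
    Continuous fun x => (R x : ℂ) * Circle.exp (π * (a x / b x)) := by
  refine continuous_polar hR (fun x => (Circle.norm_coe _).le) fun x hx => ?_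
  have : ContinuousAt (fun x => a x / b x) x := ha.continuousAt.div hb.continuousAt (h x hx)
  exact continuous_subtype_val.continuousAt.comp
    (Circle.exp.continuous.continuousAt.comp (continuousAt_const.mul this))

theorem polar_eq_polar_iff {R R' a a' : ℝ} (hR : 0 ≤ R) (hR' : 0 ≤ R') :
    (R : ℂ) * Circle.exp (π * a) = R' * Circle.exp (π * a') ↔
      R = R' ∧ (R = 0 ∨ ∃ n : ℤ, a = a' + 2 * n) := by
  constructor
  · intro h
    have h1 := congrArg norm h
    simp only [norm_mul, Complex.norm_real, Circle.norm_coe, mul_one, Real.norm_of_nonneg hR,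
      Real.norm_of_nonneg hR'] at h1
    subst h1
    refine ⟨rfl, or_iff_not_imp_left.2 fun h0 => circle_exp_pi_eq_iff.1 (Circle.ext ?_)⟩
    exact mul_left_cancel₀ (by exact_mod_cast h0) h
  · rintro ⟨rfl, rfl | h⟩
    · simp
    · rw [circle_exp_pi_eq_iff.2 h]

theorem neg_polar (R a : ℝ) :
    -((R : ℂ) * Circle.exp (π * a)) = R * Circle.exp (π * (a + 1)) := by
  rw [mul_add, Circle.exp_add, mul_one, Circle.coe_mul, Circle.coe_exp π, Complex.exp_pi_mul_I]
  ring

theorem norm_polar_sq_add {a h : ℝ} (hh : |h| ≤ 1) :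
    ‖(√(1 - h ^ 2) : ℂ) * Circle.exp a‖ ^ 2 + h ^ 2 = 1 := by
  have : h ^ 2 ≤ 1 := by rw [← sq_abs]; exact pow_le_one₀ (abs_nonneg _) hh
  rw [norm_mul, Complex.norm_real, Circle.norm_coe, mul_one, Real.norm_eq_abs, sq_abs,
    Real.sq_sqrt (by linarith)]
  ring

theorem norm_eq_sqrt {w : ℂ} {h : ℝ} (H : ‖w‖ ^ 2 + h ^ 2 = 1) : ‖w‖ = √(1 - h ^ 2) := by
  rw [← H, add_sub_cancel_right, Real.sqrt_sq (norm_nonneg _)]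

theorem abs_le_one_of_sq {w : ℂ} {h : ℝ} (H : ‖w‖ ^ 2 + h ^ 2 = 1) : |h| ≤ 1 := by
  rw [← sq_le_one_iff_abs_le_one]
  nlinarith [sq_nonneg ‖w‖]

/-- The disc in complex coordinates. -/
noncomputable def discPoint (w : {w : ℂ // ‖w‖ ≤ 1}) : Disc :=
  ⟨Complex.orthonormalBasisOneI.repr w, by simpa using w.2⟩

theorem continuous_discPoint : Continuous discPoint :=
  Continuous.subtype_mk
    (Complex.orthonormalBasisOneI.repr.continuous.comp continuous_subtype_val) _

theorem discPoint_injective : Function.Injective discPoint := fun _ _ h =>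
  Subtype.ext (Complex.orthonormalBasisOneI.repr.injective (congrArg Subtype.val h))

theorem discPoint_surjective : Function.Surjective discPoint := fun x =>
  ⟨⟨Complex.orthonormalBasisOneI.repr.symm x, by
    rw [LinearIsometryEquiv.norm_map]; exact mem_closedBall_zero_iff.1 x.2⟩,
    Subtype.ext (Complex.orthonormalBasisOneI.repr.apply_symm_apply _)⟩

/-- The vanishing cross product `hc` puts both pairs on one line through the origin, and the common
positive maximum fixes the position on it. -/
theorem eq_of_max_eq_max {X Y X' Y' : ℝ} (hX : 0 ≤ X) (hX' : 0 ≤ X')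
    (h : max X Y = max X' Y') (h0 : max X Y ≠ 0) (hc : Y * X' = Y' * X) : X = X' ∧ Y = Y' := by
  have hpos : 0 < max X Y := lt_of_le_of_ne (le_max_of_le_left hX) h0.symm
  rcases max_cases X Y with ⟨e, h1⟩ | ⟨e, h1⟩ <;> rcases max_cases X' Y' with ⟨e', h2⟩ | ⟨e', h2⟩ <;>
    rw [e, e'] at h <;> rw [e] at hpos
  · subst h
    exact ⟨rfl, mul_right_cancel₀ hpos.ne' hc⟩
  · exfalso
    subst h
    nlinarith
  · exfalso
    subst h
    nlinarith
  · subst h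
    exact ⟨(mul_left_cancel₀ hpos.ne' hc).symm, rfl⟩

/-- The two glued sides meet at the corner `(1, 0)`. With `r` the distance from it in the maximum
norm and `ρ` running from `-1` on one side to `1` on the other, the right angle there is opened to a
full turn. The sides then come together along the ray of angle `π`, and the free sides become the
rim. -/
theorem surface_disc : Nonempty (Surface (listed 0) ≃ₜ Disc) := by
  have g : ∀ t, proj (listed 0) (unitInterval.symm t, 0) = proj (listed 0) (1, t) := fun t => by
    simpa [side] using proj_opposite (listed 0) 0 1 (by decide) rfl (by decide) (unitInterval.symm t)
  let r : Square → ℝ := fun x => max (1 - x.1) x.2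
  let ρ : Square → ℝ := fun x => (x.2 - (1 - x.1)) / (x.2 + (1 - x.1))
  have hr : ∀ x, r x = max (1 - x.1 : ℝ) x.2 := fun x => rfl
  have hρ : ∀ x, ρ x = (x.2 - (1 - x.1)) / (x.2 + (1 - x.1)) := fun x => rfl
  have hr0 : ∀ x : Square, 0 ≤ r x := fun x => le_max_of_le_right x.2.2.1
  have hr1 : ∀ x : Square, r x ≤ 1 := fun x => max_le (by linarith [x.1.2.1]) x.2.2.2
  let f : Square → Disc := fun x => discPoint ⟨r x * Circle.exp (π * ρ x), by
      rw [norm_mul, Complex.norm_real, Circle.norm_coe, mul_one, Real.norm_of_nonneg (hr0 x)]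
      exact hr1 x⟩
  have hf : Continuous f := by
    refine continuous_discPoint.comp (Continuous.subtype_mk (continuous_polar_exp (by fun_prop)
      (by fun_prop) (by fun_prop) fun x hx h => hx ?_) _)
    have h1 := x.1.2.2
    have h2 := x.2.2.1
    rw [hr, show (x.2 : ℝ) = 0 by linarith, show 1 - (x.1 : ℝ) = 0 by linarith, max_self]
  refine ⟨quotHomeo f hf ?_ ?_ ?_⟩
  · intro z
    obtain ⟨⟨w, hw⟩, rfl⟩ := discPoint_surjective z
    obtain ⟨a, ha, hwa⟩ : ∃ a : ℝ, |a| ≤ 1 ∧ w = ‖w‖ * Circle.exp (π * a) :=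
      ⟨_, abs_arg_div_pi_le w, polar_arg w⟩
    have ha' := abs_le.1 ha
    -- The preimage has `1 - s = S (1 - a)` and `t = S (1 + a)`, which gives the angle `a`; the
    -- radius `S (1 + |a|)` has to be `‖w‖`.
    have hS : 0 < 1 + |a| := by positivity
    have e1 : (1 - a) ≤ 1 + |a| := by linarith [neg_abs_le a]
    have e2 : (1 + a) ≤ 1 + |a| := by linarith [le_abs_self a]
    have f1 : 0 ≤ ‖w‖ / (1 + |a|) := by positivity
    have f2 : ‖w‖ / (1 + |a|) * (1 + |a|) = ‖w‖ := by field_simp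
    generalize ‖w‖ / (1 + |a|) = S at f1 f2
    have hX : S * (1 - a) ≤ 1 := by nlinarith
    have hX0 : 0 ≤ S * (1 - a) := mul_nonneg f1 (by linarith)
    have hY : S * (1 + a) ≤ 1 := by nlinarith
    have hY0 : 0 ≤ S * (1 + a) := mul_nonneg f1 (by linarith)
    obtain ⟨x, hx1, hx2⟩ : ∃ x : Square, 1 - (x.1 : ℝ) = S * (1 - a) ∧ (x.2 : ℝ) = S * (1 + a) :=
      ⟨(⟨1 - S * (1 - a), by constructor <;> linarith⟩, ⟨S * (1 + a), hY0, hY⟩), by simp, rfl⟩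
    refine ⟨x, congrArg discPoint (Subtype.ext ?_)⟩
    refine Eq.trans ((polar_eq_polar_iff (hr0 _) (norm_nonneg _)).2 ⟨?_, ?_⟩) hwa.symm
    · rw [hr, hx1, hx2, ← f2, ← mul_max_of_nonneg _ _ f1]
      congr 1
      rcases le_total 0 a with h | h
      · rw [abs_of_nonneg h, max_eq_right (by linarith)]
      · rw [abs_of_nonpos h, max_eq_left (by linarith)]
        ring
    · by_cases hS0 : S = 0
      · exact Or.inl (by rw [hr, hx1, hx2, hS0]; simp)
      · refine Or.inr ⟨0, ?_⟩
        rw [hρ, hx1, hx2, show S * (1 + a) - S * (1 - a) = a * (2 * S) by ring,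
          show S * (1 + a) + S * (1 - a) = 2 * S by ring, mul_div_assoc, div_self (by positivity)]
        simp
  · refine respects_glue _ fun i j hij h t => ?_
    fin_cases i <;> fin_cases j <;> simp [listed] at hij h
    have ht : 0 ≤ 1 - (t : ℝ) := sub_nonneg.2 t.2.2
    refine congrArg discPoint (Subtype.ext ((polar_eq_polar_iff (hr0 _) (hr0 _)).2 ?_))
    simp only [listed, side, hr, hρ]
    simp [ht]
    by_cases h : 1 - (t : ℝ) = 0
    · exact Or.inl h
    · refine Or.inr ⟨-1, ?_⟩
      rw [← neg_sub, neg_div, div_self h]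
      norm_num
  · rintro ⟨s, t⟩ ⟨s', t'⟩ h
    have h := congrArg Subtype.val (discPoint_injective h)
    obtain ⟨h1, h2⟩ := (polar_eq_polar_iff (hr0 (s, t)) (hr0 (s', t'))).1 h
    have b1 := s.2
    have b2 := t.2
    have b3 := s'.2
    have b4 := t'.2
    simp only [mem_Icc] at b1 b2 b3 b4
    by_cases h0 : r (s, t) = 0
    · have h0' : r (s', t') = 0 := h1.symm.trans h0
      rw [hr] at h0 h0'
      have e1 := le_max_left (1 - s : ℝ) t
      have e2 := le_max_right (1 - s : ℝ) t
      have e3 := le_max_left (1 - s' : ℝ) t'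
      have e4 := le_max_right (1 - s' : ℝ) t'
      simp only at h0 h0'
      rw [Subtype.ext (by linarith : (s : ℝ) = s'), Subtype.ext (by linarith : (t : ℝ) = t')]
    · obtain ⟨n, hn⟩ := h2.resolve_left h0
      have hS : 0 < (t : ℝ) + (1 - s) := by
        refine lt_of_le_of_ne (by linarith) fun h => h0 ?_
        rw [hr]
        simp only
        rw [show (t : ℝ) = 0 by linarith, show (1 - s : ℝ) = 0 by linarith, max_self]
      have hS' : 0 < (t' : ℝ) + (1 - s') := by
        refine lt_of_le_of_ne (by linarith) fun h => h0 ?_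
        rw [h1, hr]
        simp only
        rw [show (t' : ℝ) = 0 by linarith, show (1 - s' : ℝ) = 0 by linarith, max_self]
      rw [hr, hr] at h1
      rw [hr] at h0
      simp only [hρ] at hn h0 h1
      have k1 : |((t : ℝ) - (1 - s)) / (t + (1 - s))| ≤ 1 := by
        rw [abs_div, abs_of_pos hS, div_le_one hS, abs_le]
        constructor <;> linarith
      have k2 : |((t' : ℝ) - (1 - s')) / (t' + (1 - s'))| ≤ 1 := by
        rw [abs_div, abs_of_pos hS', div_le_one hS', abs_le]
        constructor <;> linarith
      rw [abs_le] at k1 k2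
      have n1 : n ≤ 1 := by exact_mod_cast (by linarith : (n : ℝ) ≤ 1)
      have n2 : -1 ≤ n := by exact_mod_cast (by linarith : (-1 : ℝ) ≤ n)
      -- Angles `ρ` in `[-1, 1]` that differ by `±2` are the two extremes, so the points lie on the
      -- glued sides.
      obtain rfl | rfl | rfl : n = -1 ∨ n = 0 ∨ n = 1 := by omega
      · push_cast at hn
        have a1 : ((t : ℝ) - (1 - s)) / (t + (1 - s)) = -1 := by linarith
        have a2 : ((t' : ℝ) - (1 - s')) / (t' + (1 - s')) = 1 := by linarith
        rw [div_eq_iff hS.ne'] at a1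
        rw [div_eq_iff hS'.ne'] at a2
        obtain rfl : t = 0 := Subtype.ext (by push_cast; linarith)
        obtain rfl : s' = 1 := Subtype.ext (by push_cast; linarith)
        have : s = unitInterval.symm t' := Subtype.ext (by
          simp [b4] at h1
          rw [max_eq_left (by linarith)] at h1
          rw [coe_symm_eq]
          linarith)
        rw [this]
        exact g t'
      · rw [Int.cast_zero, mul_zero, add_zero, div_eq_div_iff hS.ne' hS'.ne'] at hn
        obtain ⟨c1, c2⟩ := eq_of_max_eq_max (by linarith) (by linarith) h1 h0 (by linarith)
        rw [Subtype.ext (by linarith : (s : ℝ) = s'), Subtype.ext c2]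
      · push_cast at hn
        have a1 : ((t : ℝ) - (1 - s)) / (t + (1 - s)) = 1 := by linarith
        have a2 : ((t' : ℝ) - (1 - s')) / (t' + (1 - s')) = -1 := by linarith
        rw [div_eq_iff hS.ne'] at a1
        rw [div_eq_iff hS'.ne'] at a2
        obtain rfl : s = 1 := Subtype.ext (by push_cast; linarith)
        obtain rfl : t' = 0 := Subtype.ext (by push_cast; linarith)
        have : s' = unitInterval.symm t := Subtype.ext (by
          rw [Icc.coe_one, Icc.coe_zero, sub_self, max_eq_right b2.1, max_eq_left (by linarith)] at h1
          rw [coe_symm_eq]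
          linarith)
        rw [this]
        exact (g t).symm

end PolarSurfaces

/-! ### The sphere, and the projective plane from a hemisphere -/

section SphericalSurfaces

theorem sqrt_one_sub_sq_eq_zero_iff {h : ℝ} (hh : |h| ≤ 1) : √(1 - h ^ 2) = 0 ↔ |h| = 1 := by
  rw [Real.sqrt_eq_zero', sub_nonpos, one_le_sq_iff_one_le_abs]
  exact ⟨fun h => le_antisymm hh h, fun h => h.ge⟩

/-- The segments `t - s = h` join a boundary point to its glued partner. Each is wrapped once around
the parallel of height `h`, with `d / (1 - |h|)` running through `[-1, 1]`. At the corners `(1, 0)`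
and `(0, 1)` they shrink to the poles. -/
theorem surface_sphere : Nonempty (Surface (listed 1) ≃ₜ Sphere) := by
  have g₁ : ∀ t, proj (listed 1) (t, 0) = proj (listed 1) (1, unitInterval.symm t) := fun t => by
    simpa [side] using proj_opposite (listed 1) 0 1 (by decide) rfl (by decide) t
  have g₂ : ∀ t, proj (listed 1) (0, t) = proj (listed 1) (unitInterval.symm t, 1) := fun t => by
    simpa [side] using (proj_opposite (listed 1) 2 3 (by decide) rfl (by decide) t).symm
  let h : Square → ℝ := fun x => x.2 - x.1
  let d : Square → ℝ := fun x => 1 - x.1 - x.2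
  have hh : ∀ x, h x = x.2 - x.1 := fun x => rfl
  have hd : ∀ x, d x = 1 - x.1 - x.2 := fun x => rfl
  have hh1 : ∀ x, |h x| ≤ 1 := fun x =>
    abs_le.2 ⟨by linarith [x.1.2.2, x.2.2.1, hh x], by linarith [x.1.2.1, x.2.2.2, hh x]⟩
  have hdh : ∀ x : Square, |d x| ≤ 1 - |h x| := fun x => by
    have b1 := x.1.2
    have b2 := x.2.2
    simp only [mem_Icc] at b1 b2
    rw [hh, hd]
    rcases abs_cases (1 - x.1 - x.2 : ℝ) with ⟨e, -⟩ | ⟨e, -⟩ <;>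
      rcases abs_cases (x.2 - x.1 : ℝ) with ⟨e', -⟩ | ⟨e', -⟩ <;> rw [e, e'] <;> linarith
  let f : Square → Sphere := fun x =>
    spherePoint ⟨(√(1 - h x ^ 2) * Circle.exp (π * (d x / (1 - |h x|))), h x),
      norm_polar_sq_add (hh1 x)⟩
  have hf : Continuous f := by
    refine continuous_spherePoint.comp (Continuous.subtype_mk (.prodMk (continuous_polar_exp
      (by fun_prop) (by fun_prop) (by fun_prop) fun x hx h => hx ?_) (by fun_prop)) _)
    rw [sqrt_one_sub_sq_eq_zero_iff (hh1 x)]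
    linarith
  -- With the denominator cleared, the criterion holds at the poles too, where `d` vanishes.
  have hfe : ∀ x y, f x = f y ↔ h x = h y ∧ ∃ n : ℤ, d x = d y + 2 * n * (1 - |h x|) := fun x y => by
    rw [spherePoint_eq_iff, polar_eq_polar_iff (Real.sqrt_nonneg _) (Real.sqrt_nonneg _),
      sqrt_one_sub_sq_eq_zero_iff (hh1 x)]
    by_cases hxy : h x = h y
    · have a := hdh x
      have b := hdh y
      rw [← hxy] at b ⊢
      simp only [true_and, and_true]
      by_cases h1 : 1 - |h x| = 0
      · rw [h1] at a b
        have a := abs_eq_zero.1 (le_antisymm a (abs_nonneg _))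
        have b := abs_eq_zero.1 (le_antisymm b (abs_nonneg _))
        exact iff_of_true (Or.inl (by linarith)) ⟨0, by rw [a, b]; simp⟩
      · rw [or_iff_right (fun h => h1 (by linarith))]
        refine exists_congr fun n => ?_
        rw [div_add' _ _ _ h1, div_left_inj' h1]
    · simp [hxy]
  refine ⟨quotHomeo f hf ?_ ?_ ?_⟩
  · intro z
    obtain ⟨⟨⟨w, h'⟩, H⟩, rfl⟩ := spherePoint_surjective z
    obtain ⟨a, ha, hwa⟩ : ∃ a : ℝ, |a| ≤ 1 ∧ w = ‖w‖ * Circle.exp (π * a) :=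
      ⟨_, abs_arg_div_pi_le w, polar_arg w⟩
    have hh' := abs_le_one_of_sq H
    have k1 : |(1 - |h'|) * a| ≤ 1 - |h'| := by
      rw [abs_mul, abs_of_nonneg (sub_nonneg.2 hh')]
      exact mul_le_of_le_one_right (sub_nonneg.2 hh') ha
    have k2 := abs_le.1 k1
    have k3 := le_abs_self h'
    have k4 := neg_abs_le h'
    obtain ⟨x, e1, e2⟩ : ∃ x, h x = h' ∧ d x = (1 - |h'|) * a := by
      refine ⟨(⟨(1 - h' - (1 - |h'|) * a) / 2, by constructor <;> linarith⟩,
        ⟨(1 + h' - (1 - |h'|) * a) / 2, by constructor <;> linarith⟩), ?_, ?_⟩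
      · simp only [hh]
        ring
      · simp only [hd]
        ring
    refine ⟨x, ?_⟩
    refine (spherePoint_eq_iff _ _ _ _ _ _).2 ⟨?_, e1⟩
    refine Eq.trans ?_ hwa.symm
    rw [polar_eq_polar_iff (Real.sqrt_nonneg _) (norm_nonneg _), norm_eq_sqrt H, e1, e2,
      sqrt_one_sub_sq_eq_zero_iff hh']
    refine ⟨rfl, or_iff_not_imp_left.2 fun hne => ⟨0, ?_⟩⟩
    rw [mul_div_cancel_left₀ _ (fun h => hne (by linarith))]
    simp
  · refine respects_glue _ fun i j hij h t => ?_
    have ht := t.2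
    simp only [mem_Icc] at ht
    fin_cases i <;> fin_cases j <;> simp [listed] at hij h
    · suffices f (t, 0) = f (1, unitInterval.symm t) by simpa [listed, side] using this
      refine (hfe _ _).2 ⟨by simp [hh], 1, ?_⟩
      simp [hh, hd, abs_of_nonneg ht.1]
      ring
    · suffices f (unitInterval.symm t, 1) = f (0, t) by simpa [listed, side] using this
      refine (hfe _ _).2 ⟨by simp [hh], -1, ?_⟩
      simp [hh, hd, abs_of_nonneg ht.1]
      ring
  · have key : ∀ (x y : Square) (n : ℤ), 0 ≤ n → h x = h y → d x = d y + 2 * n * (1 - |h x|) →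
        proj (listed 1) x = proj (listed 1) y := by
      rintro ⟨s, t⟩ ⟨s', t'⟩ n h0 e1 e2
      have a := hdh (s, t)
      have b := hdh (s', t')
      rw [← e1] at b
      rw [abs_le] at a b
      have b1 := s.2
      have b2 := t.2
      have b3 := s'.2
      have b4 := t'.2
      simp only [mem_Icc] at b1 b2 b3 b4
      by_cases hd0 : d (s, t) = d (s', t')
      · simp only [hd, hh] at hd0 e1
        have hs : s = s' := Subtype.ext (by linarith)
        have ht : t = t' := Subtype.ext (by linarith)
        rw [hs, ht]
      · have hm : 0 < 1 - |h (s, t)| := lt_of_le_of_ne (sub_nonneg.2 (hh1 _)) fun h => hd0 (by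
          rw [e2, ← h, mul_zero, add_zero])
        have n1 : n ≤ 1 := by
          by_contra! hn
          have : (2 : ℝ) ≤ n := by exact_mod_cast hn
          nlinarith
        obtain rfl : n = 1 := by
          rcases h0.eq_or_lt with rfl | h0
          · exact absurd (by simpa using e2) hd0
          · omega
        rw [Int.cast_one, mul_one] at e2
        have e3 : d (s, t) = 1 - |h (s, t)| := by linarith
        have e4 : d (s', t') = -(1 - |h (s, t)|) := by linarith
        simp only [hd, hh] at e1 e3 e4
        rcases le_total (s : ℝ) t with hst | hst
        · rw [abs_of_nonneg (sub_nonneg.2 hst)] at e3 e4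
          obtain rfl : s = 0 := Subtype.ext (by push_cast; linarith)
          obtain rfl : t' = 1 := Subtype.ext (by push_cast; linarith)
          obtain rfl : s' = unitInterval.symm t := Subtype.ext (by
            rw [coe_symm_eq]; push_cast at *; linarith)
          exact g₂ t
        · rw [abs_of_nonpos (sub_nonpos.2 hst)] at e3 e4
          obtain rfl : t = 0 := Subtype.ext (by push_cast; linarith)
          obtain rfl : s' = 1 := Subtype.ext (by push_cast; linarith)
          obtain rfl : t' = unitInterval.symm s := Subtype.ext (by
            rw [coe_symm_eq]; push_cast at *; linarith)
          exact g₁ s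
    intro x y hxy
    obtain ⟨e1, n, hn⟩ := (hfe _ _).1 hxy
    rcases le_total 0 n with h0 | h0
    · exact key x y n h0 e1 hn
    · refine (key y x (-n) (by omega) e1.symm ?_).symm
      rw [← e1, hn]
      push_cast
      ring

/-- Every point of the projective plane lies on the image of the lower hemisphere. -/
theorem exists_projectivePoint (x : ProjectivePlane) :
    ∃ (w : ℂ) (z : ℝ) (H : ‖w‖ ^ 2 + z ^ 2 = 1), z ≤ 0 ∧ projectivePoint ⟨(w, z), H⟩ = x := by
  obtain ⟨x⟩ := x
  obtain ⟨⟨⟨w, z⟩, H⟩, rfl⟩ := spherePoint_surjective x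
  rcases le_total z 0 with hz | hz
  · exact ⟨w, z, H, hz, rfl⟩
  · refine ⟨-w, -z, by simpa using H, by linarith, ?_⟩
    exact (projectivePoint_eq_iff _ _ _ _ _ _).2 (Or.inr ⟨by simp, by simp⟩)

/-- The square, with its centre as origin and the maximum norm `N`, is spread radially over the
upper hemisphere at height `1 - N`. Its boundary becomes the equator, on which the gluing is the
antipodal map. -/
theorem surface_projectivePlane_abab : Nonempty (Surface (listed 9) ≃ₜ ProjectivePlane) := by
  have g₁ : ∀ t, proj (listed 9) (t, 0) = proj (listed 9) (unitInterval.symm t, 1) := fun t => by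
    simpa [side] using proj_same (listed 9) 0 2 (by decide) rfl (by decide) t
  have g₂ : ∀ t, proj (listed 9) (1, t) = proj (listed 9) (0, unitInterval.symm t) := fun t => by
    simpa [side] using proj_same (listed 9) 1 3 (by decide) rfl (by decide) t
  let v : Square → ℂ := fun x => ⟨2 * x.1 - 1, 2 * x.2 - 1⟩
  let N : ℂ → ℝ := fun z => max |z.re| |z.im|
  have hN : ∀ z, N z = max |z.re| |z.im| := fun z => rfl
  have hN0 : ∀ z, 0 ≤ N z := fun z => le_max_of_le_left (abs_nonneg _)
  have hNz : ∀ z, N z = 0 ↔ z = 0 := fun z => by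
    constructor
    · intro h
      have h1 := le_max_left |z.re| |z.im|
      have h2 := le_max_right |z.re| |z.im|
      rw [← hN, h] at h1 h2
      exact Complex.ext (abs_eq_zero.1 (le_antisymm h1 (abs_nonneg _)))
        (abs_eq_zero.1 (le_antisymm h2 (abs_nonneg _)))
    · rintro rfl
      simp [hN]
  have hNs : ∀ (l : ℝ) z, 0 ≤ l → N (l * z) = l * N z := fun l z hl => by
    simp [hN, abs_mul, abs_of_nonneg hl, mul_max_of_nonneg _ _ hl]
  have hNn : ∀ z, N (-z) = N z := fun z => by simp [hN]
  have hvc : Continuous v := by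
    have : v = fun x => ((2 * x.1 - 1 : ℝ) : ℂ) + ((2 * x.2 - 1 : ℝ) : ℂ) * Complex.I := by
      ext x
      apply Complex.ext <;> simp [v]
    rw [this]
    fun_prop
  have hNc : Continuous N := by fun_prop
  have hN1 : ∀ x, N (v x) ≤ 1 := fun x =>
    max_le (abs_le.2 ⟨by linarith [x.1.2.1], by linarith [x.1.2.2]⟩)
      (abs_le.2 ⟨by linarith [x.2.2.1], by linarith [x.2.2.2]⟩)
  have hh1 : ∀ x, |1 - N (v x)| ≤ 1 := fun x =>
    abs_le.2 ⟨by linarith [hN1 x], by linarith [hN0 (v x)]⟩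
  let R : Square → ℝ := fun x => √(1 - (1 - N (v x)) ^ 2)
  have hR : ∀ x, R x = √(1 - (1 - N (v x)) ^ 2) := fun x => rfl
  have hR0 : ∀ x, R x = 0 ↔ v x = 0 := fun x => by
    rw [hR, sqrt_one_sub_sq_eq_zero_iff (hh1 x), abs_of_nonneg (sub_nonneg.2 (hN1 x)), ← hNz]
    constructor <;> intro h <;> linarith
  have hRc : Continuous R := by fun_prop
  have hsum : ∀ x, ‖(R x : ℂ) * (v x / ‖v x‖)‖ ^ 2 + (1 - N (v x)) ^ 2 = 1 := fun x => by
    by_cases hv : v x = 0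
    · rw [hv, (hNz 0).2 rfl]
      simp
    · have : ‖(v x / ‖v x‖ : ℂ)‖ = 1 := by
        rw [norm_div, Complex.norm_real, norm_norm, div_self (norm_ne_zero_iff.2 hv)]
      rw [norm_mul, this, mul_one, Complex.norm_real, Real.norm_eq_abs, sq_abs, hR, Real.sq_sqrt]
      · ring
      · rw [sub_nonneg, sq_le_one_iff_abs_le_one]
        exact hh1 x
  let f : Square → ProjectivePlane := fun x =>
    projectivePoint ⟨(R x * (v x / ‖v x‖), 1 - N (v x)), hsum x⟩
  have hf : Continuous f := by
    refine continuous_projectivePoint.comp (Continuous.subtype_mk (.prodMk (continuous_polar hRc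
      (fun x => ?_) fun x hx => ?_) (by fun_prop)) _)
    · rw [norm_div, Complex.norm_real, norm_norm]
      exact div_self_le_one _
    · have : v x ≠ 0 := fun h => hx ((hR0 x).2 h)
      exact hvc.continuousAt.div (by fun_prop) (by simpa using this)
  have hray : ∀ (u u' : ℂ), u ≠ 0 → u' ≠ 0 → N u = N u' → u / ‖u‖ = u' / ‖u'‖ → u = u' := by
    intro u u' h h' hNu he
    have n := norm_pos_iff.2 h
    have n' := norm_pos_iff.2 h'
    have hu : u = ((‖u‖ / ‖u'‖ : ℝ) : ℂ) * u' := by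
      have : (‖u‖ : ℂ) ≠ 0 := by exact_mod_cast n.ne'
      have : (‖u'‖ : ℂ) ≠ 0 := by exact_mod_cast n'.ne'
      push_cast
      field_simp at he ⊢
      linear_combination he
    have hN' : N u' ≠ 0 := (hNz u').not.2 h'
    rw [hu, hNs _ _ (by positivity)] at hNu
    have : ‖u‖ / ‖u'‖ = 1 := mul_right_cancel₀ hN' (by rw [hNu, one_mul])
    rw [hu, this]
    simp
  have hvinj : ∀ x y, v x = v y → x = y := fun x y h => by
    have h1 := congrArg Complex.re h
    have h2 := congrArg Complex.im h
    simp only [v] at h1 h2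
    exact Prod.ext (Subtype.ext (by linarith)) (Subtype.ext (by linarith))
  have hvneg : ∀ x : Square, v (unitInterval.symm x.1, unitInterval.symm x.2) = - v x := fun x => by
    apply Complex.ext <;> simp [v] <;> ring
  have hopp : ∀ x, N (v x) = 1 → f x = f (unitInterval.symm x.1, unitInterval.symm x.2) := by
    intro x hx
    refine (projectivePoint_eq_iff _ _ _ _ _ _).2 (Or.inr ⟨?_, ?_⟩)
    · simp only [hR, hvneg, hNn, norm_neg]
      ring
    · rw [hvneg, hNn, hx]
      simp
  refine ⟨quotHomeo f hf ?_ ?_ ?_⟩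
  · intro x
    obtain ⟨w, z, H, hz, rfl⟩ := exists_projectivePoint x
    have hz1 := abs_le.1 (abs_le_one_of_sq H)
    -- The factor that gives `w` the norm `1 + z`. The point with `v x = -(l * w)` then has height
    -- `-z` and represents the antipode. For `w = 0` the division yields `l = 0`, which is right
    -- because `z = -1`.
    let l : ℝ := (1 + z) / N w
    have hl : 0 ≤ l := div_nonneg (by linarith) (hN0 w)
    have hw : w = 0 → z = -1 := by
      rintro rfl
      have : z ^ 2 = 1 := by simpa using H
      nlinarith
    have hlN : N (l * w) = 1 + z := by
      rw [hNs _ _ hl]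
      by_cases hw0 : w = 0
      · rw [hw hw0, hw0, (hNz 0).2 rfl]
        simp
      · exact div_mul_cancel₀ _ ((hNz w).not.2 hw0)
    have k1 := le_max_left |(l * w).re| |(l * w).im|
    have k2 := le_max_right |(l * w).re| |(l * w).im|
    rw [← hN, hlN] at k1 k2
    rw [abs_le] at k1 k2
    obtain ⟨x, hx⟩ : ∃ x, v x = -(l * w) := by
      refine ⟨(⟨(1 - (l * w).re) / 2, by constructor <;> linarith⟩,
        ⟨(1 - (l * w).im) / 2, by constructor <;> linarith⟩), ?_⟩
      apply Complex.ext
      · simp only [v, Complex.neg_re]; ring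
      · simp only [v, Complex.neg_im]; ring
    refine ⟨x, (projectivePoint_eq_iff _ _ _ _ _ _).2 (Or.inr ⟨?_, ?_⟩)⟩
    · have hRx : R x = ‖w‖ := by
        rw [hR, hx, hNn, hlN, norm_eq_sqrt H]
        congr 1
        ring
      rw [hRx, hx]
      by_cases hw0 : w = 0
      · simp [hw0]
      · have hl' : l ≠ 0 := by
          intro h
          rw [h, Complex.ofReal_zero, zero_mul, (hNz 0).2 rfl] at hlN
          have hz' : z = -1 := by linarith
          rw [hz'] at H
          exact hw0 (norm_eq_zero.1 (by nlinarith [norm_nonneg w]))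
        have a1 : (‖w‖ : ℂ) ≠ 0 := by exact_mod_cast (norm_ne_zero_iff.2 hw0)
        have a2 : (l : ℂ) ≠ 0 := by exact_mod_cast hl'
        rw [norm_neg, norm_mul, Complex.norm_real, Real.norm_of_nonneg hl]
        push_cast
        field_simp
    · rw [hx, hNn, hlN]
      ring
  · refine respects_glue _ fun i j hij h t => ?_
    fin_cases i <;> fin_cases j <;> simp [listed] at hij h
    · suffices f (t, 0) = f (unitInterval.symm t, 1) by simpa [listed, side] using this
      have := hopp (t, 0) (le_antisymm (hN1 _) (by simp [hN, v]))
      simpa using this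
    · suffices f (1, t) = f (0, unitInterval.symm t) by simpa [listed, side] using this
      have := hopp (1, t) (le_antisymm (hN1 _) (by simp [hN, v]; norm_num))
      simpa using this
  · intro x y h
    rcases (projectivePoint_eq_iff _ _ _ _ _ _).1 h with ⟨h1, h2⟩ | ⟨h1, h2⟩
    · have hNN : N (v x) = N (v y) := by linarith
      have hRR : R y = R x := by rw [hR, hR, hNN]
      by_cases hv : v x = 0
      · rw [hvinj x y]
        rw [hv, (hNz 0).2 rfl] at hNN
        rw [hv, (hNz _).1 hNN.symm]
      · have hv' : v y ≠ 0 := fun h => hv ((hNz _).1 (by rw [hNN, h, (hNz 0).2 rfl]))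
        have hRx : (R x : ℂ) ≠ 0 := by exact_mod_cast (hR0 x).not.2 hv
        rw [hRR] at h1
        rw [hvinj x y (hray _ _ hv hv' hNN (mul_left_cancel₀ hRx h1).symm)]
    -- Opposite heights that are both nonnegative vanish, so both points lie on the boundary of the
    -- square.
    · have e1 : N (v x) = 1 := by linarith [hN1 x, hN1 y]
      have e2 : N (v y) = 1 := by linarith [hN1 x, hN1 y]
      have hv : v x ≠ 0 := fun h => by rw [h, (hNz 0).2 rfl] at e1; norm_num at e1
      have hv' : v y ≠ 0 := fun h => by rw [h, (hNz 0).2 rfl] at e2; norm_num at e2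
      have hRR : R y = R x := by rw [hR, hR, e1, e2]
      have hRx : (R x : ℂ) ≠ 0 := by exact_mod_cast (hR0 x).not.2 hv
      rw [hRR, ← mul_neg] at h1
      have h3 := mul_left_cancel₀ hRx h1
      have : v y = v (unitInterval.symm x.1, unitInterval.symm x.2) := by
        rw [hvneg]
        refine hray _ _ hv' (neg_ne_zero.2 hv) (by rw [hNn, e1, e2]) ?_
        rw [h3, norm_neg, neg_div]
      rw [hvinj _ _ this]
      obtain ⟨s, t⟩ := x
      have e1' : |2 * (s : ℝ) - 1| = 1 ∨ |2 * (t : ℝ) - 1| = 1 := by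
        rw [hN] at e1
        rcases max_choice |(v (s, t)).re| |(v (s, t)).im| with h | h <;> rw [h] at e1
        · exact Or.inl e1
        · exact Or.inr e1
      change proj (listed 9) (s, t) = proj (listed 9) (unitInterval.symm s, unitInterval.symm t)
      rcases e1' with e | e <;> rcases (abs_eq zero_le_one).1 e with e | e
      · obtain rfl : s = 1 := Subtype.ext (by push_cast; linarith)
        simpa using g₂ t
      · obtain rfl : s = 0 := Subtype.ext (by push_cast; linarith)
        simpa using (g₂ (unitInterval.symm t)).symm
      · obtain rfl : t = 1 := Subtype.ext (by push_cast; linarith)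
        simpa using (g₁ (unitInterval.symm s)).symm
      · obtain rfl : t = 0 := Subtype.ext (by push_cast; linarith)
        simpa using g₁ s

end SphericalSurfaces

/-! ### The projective plane from a cap and a Möbius band -/

section ConeAndCrosscap

/-- The diagonal `s = t` cuts the square into two triangles. The one with sides `a a⁻¹` is folded to
the cap of heights `-1 ≤ z ≤ -1/2`: each segment parallel to the diagonal becomes a full parallel.
The triangle with sides `b b` goes to the zone `|z| ≤ 1/2`, where `p = 0` and the angle is `s + t`.
Across its glued sides `z` changes sign and the angle shifts by a half turn, as under the antipodal
map. -/
theorem surface_projectivePlane_aabb :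
    Nonempty (Surface (listed 2) ≃ₜ ProjectivePlane) := by
  have g₁ : ∀ t, proj (listed 2) (t, 0) = proj (listed 2) (1, unitInterval.symm t) := fun t => by
    simpa [side] using proj_opposite (listed 2) 0 1 (by decide) rfl (by decide) t
  have g₂ : ∀ t, proj (listed 2) (t, 1) = proj (listed 2) (0, t) := fun t => by
    simpa [side] using proj_same (listed 2) 2 3 (by decide) rfl (by decide) (unitInterval.symm t)
  let p : Square → ℝ := fun x => max (x.1 - x.2) 0
  let z : Square → ℝ := fun x => -1 / 2 - (x.1 - x.2) + p x / 2
  let d : Square → ℝ := fun x => x.1 + x.2 - p x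
  have hp : ∀ x, p x = max (x.1 - x.2 : ℝ) 0 := fun x => rfl
  have hz : ∀ x, z x = -1 / 2 - (x.1 - x.2) + p x / 2 := fun x => rfl
  have hd : ∀ x, d x = x.1 + x.2 - p x := fun x => rfl
  have hcases : ∀ x : Square, (x.1 : ℝ) ≤ x.2 ∧ p x = 0 ∨ (x.2 : ℝ) ≤ x.1 ∧ p x = x.1 - x.2 := by
    intro x
    rcases le_total (x.1 : ℝ) x.2 with h | h
    · exact Or.inl ⟨h, max_eq_right (by linarith)⟩
    · exact Or.inr ⟨h, max_eq_left (by linarith)⟩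
  have hz1 : ∀ x, -1 ≤ z x ∧ z x ≤ 1 / 2 := fun x => by
    have b1 := x.1.2
    have b2 := x.2.2
    simp only [mem_Icc] at b1 b2
    rw [hz]
    rcases hcases x with ⟨h, e⟩ | ⟨h, e⟩ <;> rw [e] <;> constructor <;> linarith
  have hzabs : ∀ x, |z x| ≤ 1 := fun x => abs_le.2 ⟨(hz1 x).1, by linarith [(hz1 x).2]⟩
  have hp1 : ∀ x, p x = 1 ↔ |z x| = 1 := fun x => by
    have b1 := x.1.2
    have b2 := x.2.2
    simp only [mem_Icc] at b1 b2
    rw [abs_eq zero_le_one, or_iff_right (fun h => by linarith [(hz1 x).2]), hz]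
    rcases hcases x with ⟨h, e⟩ | ⟨h, e⟩ <;> rw [e] <;> constructor <;> intro h <;> linarith
  have hd2 : ∀ x, 0 ≤ d x ∧ d x ≤ 2 * (1 - p x) := fun x => by
    have b1 := x.1.2
    have b2 := x.2.2
    simp only [mem_Icc] at b1 b2
    rw [hd]
    rcases hcases x with ⟨h, e⟩ | ⟨h, e⟩ <;> rw [e] <;> constructor <;> linarith
  let f : Square → ProjectivePlane := fun x =>
    projectivePoint ⟨(√(1 - z x ^ 2) * Circle.exp (π * (d x / (1 - p x))), z x),
      norm_polar_sq_add (hzabs x)⟩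
  have hf : Continuous f := by
    refine continuous_projectivePoint.comp (Continuous.subtype_mk (.prodMk (continuous_polar_exp
      (by fun_prop) (by fun_prop) (by fun_prop) fun x hx h => hx ?_) (by fun_prop)) _)
    rw [sqrt_one_sub_sq_eq_zero_iff (hzabs x), ← hp1]
    linarith
  have hzz : ∀ x y, z x = z y → (x.1 - x.2 : ℝ) = y.1 - y.2 ∧ p x = p y := fun x y h => by
    rw [hz, hz] at h
    have : (x.1 - x.2 : ℝ) = y.1 - y.2 := by
      rcases hcases x with ⟨h1, e1⟩ | ⟨h1, e1⟩ <;> rcases hcases y with ⟨h2, e2⟩ | ⟨h2, e2⟩ <;>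
        rw [e1, e2] at h <;> linarith
    exact ⟨this, by rw [hp, hp, this]⟩
  have hfe : ∀ x y, f x = f y ↔
      (z x = z y ∧ ∃ n : ℤ, d x = d y + 2 * n * (1 - p x)) ∨
      (z x = - z y ∧ ∃ n : ℤ, d x = d y + 2 * n + 1) := fun x y => by
    rw [eq_comm, projectivePoint_eq_iff, neg_polar,
      polar_eq_polar_iff (Real.sqrt_nonneg _) (Real.sqrt_nonneg _),
      polar_eq_polar_iff (Real.sqrt_nonneg _) (Real.sqrt_nonneg _),
      sqrt_one_sub_sq_eq_zero_iff (hzabs x), ← hp1]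
    refine or_congr ?_ ?_
    · by_cases hxy : z x = z y
      · have a := hd2 x
        have b := hd2 y
        rw [← (hzz x y hxy).2] at b ⊢
        rw [hxy]
        simp only [true_and, and_true]
        by_cases h1 : 1 - p x = 0
        · rw [h1] at a b
          exact iff_of_true (Or.inl (by linarith)) ⟨0, by simp; linarith⟩
        · rw [or_iff_right (fun h => h1 (by linarith))]
          refine exists_congr fun n => ?_
          rw [div_add' _ _ _ h1, div_left_inj' h1]
      · simp [hxy]
    · by_cases hxy : z x = - z y
      · have a := hz1 x
        have b := hz1 y
        have hpx : p x = 0 := by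
          rcases hcases x with ⟨-, e⟩ | ⟨h, e⟩
          · exact e
          · have := hz x
            rw [e] at this ⊢
            linarith
        have hpy : p y = 0 := by
          rcases hcases y with ⟨-, e⟩ | ⟨h, e⟩
          · exact e
          · have := hz y
            rw [e] at this ⊢
            linarith
        rw [hxy, hpx, hpy]
        simp only [neg_sq, true_and, and_true, zero_ne_one, false_or, sub_zero, div_one]
        exact exists_congr fun n => ⟨fun h => by linarith, fun h => by linarith⟩
      · simp [hxy]
  refine ⟨quotHomeo f hf ?_ ?_ ?_⟩
  · intro y
    obtain ⟨w, h, H, hh, rfl⟩ := exists_projectivePoint y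
    have hh1 := abs_le.1 (abs_le_one_of_sq H)
    obtain ⟨θ, h0, h2, hw⟩ : ∃ θ : ℝ, 0 ≤ θ ∧ θ ≤ 2 ∧ w = ‖w‖ * Circle.exp (π * θ) := by
      have := abs_le.1 (abs_arg_div_pi_le w)
      rcases le_total 0 (w.arg / π) with h | h
      · exact ⟨_, h, by linarith, polar_arg w⟩
      · refine ⟨w.arg / π + 2, by linarith, by linarith, (polar_arg w).trans ?_⟩
        rw [show Circle.exp (π * (w.arg / π)) = Circle.exp (π * (w.arg / π + 2)) from
          circle_exp_pi_eq_iff.2 ⟨-1, by push_cast; ring⟩]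
    have main : ∀ x, (z x = h ∧ (p x = 1 ∨ ∃ n : ℤ, d x / (1 - p x) = θ + 2 * n)) ∨
        (z x = -h ∧ ∃ n : ℤ, d x / (1 - p x) = θ + 1 + 2 * n) →
        f x = projectivePoint ⟨(w, h), H⟩ := by
      intro x hx
      refine ((projectivePoint_eq_iff _ _ _ _ _ _).2 ?_).symm
      rcases hx with ⟨e, hx⟩ | ⟨e, hx⟩
      · refine Or.inl ⟨Eq.trans ((polar_eq_polar_iff (Real.sqrt_nonneg _) (norm_nonneg _)).2
          ⟨by rw [e, norm_eq_sqrt H], ?_⟩) hw.symm, e⟩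
        rwa [sqrt_one_sub_sq_eq_zero_iff (hzabs x), ← hp1]
      · refine Or.inr ⟨Eq.trans ((polar_eq_polar_iff (Real.sqrt_nonneg _) (norm_nonneg _)).2
          ⟨by rw [e, neg_sq, norm_eq_sqrt H], Or.inr hx⟩)
          ((neg_polar _ _).symm.trans (congrArg Neg.neg hw.symm)), e⟩
    have point : ∀ s t : ℝ, s ∈ Icc (0 : ℝ) 1 → t ∈ Icc (0 : ℝ) 1 →
        ∃ x : Square, (x.1 : ℝ) = s ∧ (x.2 : ℝ) = t :=
      fun s t hs ht => ⟨(⟨s, hs⟩, ⟨t, ht⟩), rfl, rfl⟩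
    -- The cap and the zone are treated separately; in the cap the preimage solves `p = -1 - 2h` and
    -- `d = θ (1 - p)`.
    rcases le_total h (-1 / 2) with hl | hl
    · obtain ⟨x, hx1, hx2⟩ := point (-1 - 2 * h + (1 + h) * θ) ((1 + h) * θ)
        ⟨by nlinarith, by nlinarith⟩ ⟨by nlinarith, by nlinarith⟩
      have hpx : p x = -1 - 2 * h := by
        rw [hp, hx1, hx2, max_eq_left (by linarith)]
        ring
      refine ⟨x, main x (Or.inl ⟨by rw [hz, hpx, hx1, hx2]; ring, ?_⟩)⟩
      rcases eq_or_lt_of_le hh1.1 with h1 | h1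
      · exact Or.inl (by rw [hpx]; linarith)
      · refine Or.inr ⟨0, ?_⟩
        rw [hd, hpx, hx1, hx2, div_eq_iff (by linarith)]
        push_cast
        ring
    · have flat : ∀ u v : ℝ, u ≤ 0 → -u ≤ v → v ≤ 2 + u →
          ∃ x : Square, z x = -1 / 2 - u ∧ d x / (1 - p x) = v := by
        intro u v hu h1 h2
        obtain ⟨x, hx1, hx2⟩ := point ((v + u) / 2) ((v - u) / 2)
          ⟨by linarith, by linarith⟩ ⟨by linarith, by linarith⟩
        have hpx : p x = 0 := by
          rw [hp, hx1, hx2, max_eq_right (by linarith)]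
        refine ⟨x, ?_, ?_⟩
        · rw [hz, hpx, hx1, hx2]
          ring
        · rw [hd, hpx, hx1, hx2]
          ring
      -- At height `h` the triangle only reaches the angles in `[h + 1/2, 2 - (h + 1/2)]`. Every
      -- other angle is reached by the antipodal point, at height `-h` and angle `θ ± 1`.
      rcases lt_or_ge θ (h + 1 / 2) with c1 | c1
      · obtain ⟨x, e1, e2⟩ := flat (-1 / 2 + h) (θ + 1) (by linarith) (by linarith) (by linarith)
        exact ⟨x, main x (Or.inr ⟨by rw [e1]; ring, 0, by rw [e2]; push_cast; ring⟩)⟩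
      rcases lt_or_ge (2 - (h + 1 / 2)) θ with c2 | c2
      · obtain ⟨x, e1, e2⟩ := flat (-1 / 2 + h) (θ - 1) (by linarith) (by linarith) (by linarith)
        exact ⟨x, main x (Or.inr ⟨by rw [e1]; ring, -1, by rw [e2]; push_cast; ring⟩)⟩
      · obtain ⟨x, e1, e2⟩ := flat (-1 / 2 - h) θ (by linarith) (by linarith) (by linarith)
        exact ⟨x, main x (Or.inl ⟨by rw [e1]; ring, Or.inr ⟨0, by rw [e2]; push_cast; ring⟩⟩)⟩
  · refine respects_glue _ fun i j hij h t => ?_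
    have ht := t.2
    simp only [mem_Icc] at ht
    fin_cases i <;> fin_cases j <;> simp [listed] at hij h
    · suffices f (t, 0) = f (1, unitInterval.symm t) by simpa [listed, side] using this
      have e1 : p (t, 0) = t := by simp [hp, ht.1]
      have e2 : p (1, unitInterval.symm t) = t := by simp [hp, ht.1]
      refine (hfe _ _).2 (Or.inl ⟨by rw [hz, hz, e1, e2]; simp, -1, ?_⟩)
      rw [hd, hd, e1, e2]
      simp
      ring
    · suffices f (unitInterval.symm t, 1) = f (0, unitInterval.symm t) by
        simpa [listed, side] using this
      have e1 : p (unitInterval.symm t, 1) = 0 := by simp [hp, ht.1]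
      have e2 : p (0, unitInterval.symm t) = 0 := by simp [hp, ht.2]
      refine (hfe _ _).2 (Or.inr ⟨by rw [hz, hz, e1, e2]; simp; ring, 0, ?_⟩)
      rw [hd, hd, e1, e2]
      simp
  · have key : ∀ (x y : Square) (n : ℤ), n ≤ 0 → z x = z y → d x = d y + 2 * n * (1 - p x) →
        proj (listed 2) x = proj (listed 2) y := by
      rintro ⟨s, t⟩ ⟨s', t'⟩ n h0 e1 e2
      obtain ⟨hc, hpp⟩ := hzz _ _ e1
      have a := hd2 (s, t)
      have b := hd2 (s', t')
      have b1 := s.2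
      have b2 := t.2
      have b3 := s'.2
      have b4 := t'.2
      simp only [mem_Icc] at b1 b2 b3 b4
      rw [← hpp] at b
      by_cases hd0 : d (s, t) = d (s', t')
      · rw [hd, hd, hpp] at hd0
        simp only at hd0 hc
        have hs : s = s' := Subtype.ext (by linarith)
        have ht : t = t' := Subtype.ext (by linarith)
        rw [hs, ht]
      · have hm : 0 < 1 - p (s, t) := lt_of_le_of_ne (by linarith) fun h => hd0 (by
          rw [e2, ← h, mul_zero, add_zero])
        have n1 : -1 ≤ n := by
          by_contra! hn
          have : (n : ℝ) ≤ -2 := by exact_mod_cast (by omega : n ≤ -2)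
          nlinarith
        obtain rfl : n = -1 := by
          rcases h0.eq_or_lt with rfl | h0
          · exact absurd (by simpa using e2) hd0
          · omega
        push_cast at e2
        have e3 : d (s, t) = 0 := by linarith
        have e4 : d (s', t') = 2 * (1 - p (s', t')) := by rw [← hpp]; linarith
        rw [hd] at e3 e4
        have f1 := hcases (s, t)
        have f2 := hcases (s', t')
        simp only at e3 e4 hc f1 f2
        obtain rfl : t = 0 := Subtype.ext (by
          push_cast
          rcases f1 with ⟨_, _⟩ | ⟨_, _⟩ <;> rcases f2 with ⟨_, _⟩ | ⟨_, _⟩ <;> linarith)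
        obtain rfl : s' = 1 := Subtype.ext (by
          push_cast at *
          rcases f1 with ⟨_, _⟩ | ⟨_, _⟩ <;> rcases f2 with ⟨_, _⟩ | ⟨_, _⟩ <;> linarith)
        obtain rfl : t' = unitInterval.symm s := Subtype.ext (by
          rw [coe_symm_eq]; push_cast at *; linarith)
        exact g₁ s
    rintro ⟨s, t⟩ ⟨s', t'⟩ hxy
    rcases (hfe _ _).1 hxy with ⟨e1, n, hn⟩ | ⟨e1, n, hn⟩
    · rcases le_total n 0 with h0 | h0
      · exact key _ _ n h0 e1 hn
      · refine (key _ _ (-n) (by omega) e1.symm ?_).symm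
        rw [← (hzz _ _ e1).2, hn]
        push_cast
        ring
    · have b1 := s.2
      have b2 := t.2
      have b3 := s'.2
      have b4 := t'.2
      simp only [mem_Icc] at b1 b2 b3 b4
      have f1 := hcases (s, t)
      have f2 := hcases (s', t')
      rw [hz, hz] at e1
      rw [hd, hd] at hn
      simp only at f1 f2 e1 hn
      have p1 : p (s, t) = 0 := by
        rcases f1 with ⟨_, _⟩ | ⟨_, _⟩ <;> rcases f2 with ⟨_, _⟩ | ⟨_, _⟩ <;> linarith
      have p2 : p (s', t') = 0 := by
        rcases f1 with ⟨_, _⟩ | ⟨_, _⟩ <;> rcases f2 with ⟨_, _⟩ | ⟨_, _⟩ <;> linarith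
      rw [p1, p2] at e1 hn
      have n1 : n ≤ 0 := by
        have : (n : ℝ) < 1 := by linarith
        exact_mod_cast Int.lt_add_one_iff.1 (by exact_mod_cast this : n < 0 + 1)
      have n2 : -1 ≤ n := by
        have : (-2 : ℝ) < n := by linarith
        have : (-2 : ℤ) < n := by exact_mod_cast this
        omega
      obtain rfl | rfl : n = -1 ∨ n = 0 := by omega
      · push_cast at hn
        obtain rfl : s = 0 := Subtype.ext (by push_cast; linarith)
        obtain rfl : t' = 1 := Subtype.ext (by push_cast at *; linarith)
        obtain rfl : s' = t := Subtype.ext (by push_cast at *; linarith)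
        exact (g₂ s').symm
      · push_cast at hn
        obtain rfl : t = 1 := Subtype.ext (by push_cast; linarith)
        obtain rfl : s' = 0 := Subtype.ext (by push_cast at *; linarith)
        obtain rfl : t' = s := Subtype.ext (by push_cast at *; linarith)
        exact g₂ t'

end ConeAndCrosscap

/-! ### Separating the remaining models -/

section AngleLifts

/-- Every circle-valued map on `X` has a continuous choice of angle. -/
def AngleLifts (X : Type) [TopologicalSpace X] : Prop :=
  ∀ f : X → Circle, Continuous f → ∃ g : X → ℝ, Continuous g ∧ ∀ x, Circle.exp (g x) = f x

theorem AngleLifts.congr {X Y : Type} [TopologicalSpace X] [TopologicalSpace Y]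
    (hX : AngleLifts X) (e : X ≃ₜ Y) : AngleLifts Y := fun f hf => by
  obtain ⟨g, hg, h⟩ := hX (f ∘ e) (hf.comp e.continuous)
  exact ⟨g ∘ e.symm, hg.comp e.symm.continuous, fun y => by simp [h]⟩

/-- Along a loop of degree one the angle is `2πs` up to a constant, so it does not return to its
initial value. -/
theorem not_angleLifts_of_loop {X : Type} [TopologicalSpace X] {f : X → Circle}
    (hf : Continuous f) {γ : unitInterval → X} (hγ : Continuous γ) (h01 : γ 0 = γ 1)
    (h : ∀ s, f (γ s) = Circle.exp (2 * π * s)) : ¬ AngleLifts X := fun hX => by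
  obtain ⟨g, hg, hgf⟩ := hX f hf
  obtain ⟨n, hn⟩ := circle_lift_sub (g₁ := fun s => g (γ s))
    (g₂ := fun s : unitInterval => 2 * π * s) (hg.comp hγ) (by fun_prop)
    fun s => (hgf _).trans (h s)
  have h0 := hn 0
  have h1 := hn 1
  simp only [h01] at h0
  rw [h0] at h1
  simp at h1

theorem not_angleLifts_torus : ¬ AngleLifts Torus :=
  not_angleLifts_of_loop (f := Prod.fst) continuous_fst
    (γ := fun s => (Circle.exp (2 * π * s), 1)) (by fun_prop) (by simp) fun _ => rfl

theorem not_angleLifts_kleinBottle : ¬ AngleLifts KleinBottle := by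
  refine not_angleLifts_of_loop
    (f := Quot.lift (fun x : unitInterval × Circle => Circle.exp (2 * π * x.1)) ?_)
    (continuous_quot_lift _ (by fun_prop)) (γ := fun s => Quot.mk _ (s, 1))
    (continuous_quot_mk.comp (by fun_prop)) (Quot.sound ⟨1, rfl, by simp⟩) fun _ => rfl
  rintro _ _ ⟨z, rfl, rfl⟩
  simp

/-- On the square an angle always exists, so only its jumps across the glued sides can be an
obstruction. -/
theorem angleLifts_surface {w : GluingScheme}
    (h : ∀ g : Square → ℝ, Continuous g →
      (∀ x y, Glue w x y → Circle.exp (g x) = Circle.exp (g y)) →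
      ∀ x y, Glue w x y → g x = g y) : AngleLifts (Surface w) := fun f hf => by
  obtain ⟨g, hg, hgf⟩ := exists_circle_lift_square (hf.comp continuous_quot_mk)
  have hg' := h g hg fun x y hxy => by rw [hgf, hgf]; exact congrArg f (Quot.sound hxy)
  exact ⟨Quot.lift g hg', continuous_quot_lift _ hg, fun x => Quot.inductionOn x hgf⟩

theorem angleLifts_sphere : AngleLifts Sphere := by
  refine AngleLifts.congr (angleLifts_surface fun g hg hgl => ?_) surface_sphere.some
  obtain ⟨m, hm⟩ := circle_lift_sub (g₁ := fun t : unitInterval => g (t, 0))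
    (g₂ := fun t => g (1, unitInterval.symm t)) (by fun_prop) (by fun_prop) fun t => by
      simpa [side] using hgl _ _ (Glue.opposite 0 1 t (by decide) rfl (by decide))
  obtain ⟨n, hn⟩ := circle_lift_sub (g₁ := fun t : unitInterval => g (unitInterval.symm t, 1))
    (g₂ := fun t => g (0, t)) (by fun_prop) (by fun_prop) fun t => by
      simpa [side] using hgl _ _ (Glue.opposite 2 3 t (by decide) rfl (by decide))
  -- Glued sides share a corner that the gluing fixes, so the jump is zero there and hence
  -- everywhere.
  have m1 := hm 1
  have n1 := hn 1
  simp only [unitInterval.symm_one, left_eq_add] at m1 n1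
  refine respects_glue _ fun i j hij h t => ?_
  fin_cases i <;> fin_cases j <;> simp [listed] at hij h
  · simpa [listed, side, m1] using hm t
  · simpa [listed, side, n1] using hn t

theorem angleLifts_projectivePlane : AngleLifts ProjectivePlane := by
  refine AngleLifts.congr (angleLifts_surface fun g hg hgl => ?_)
    surface_projectivePlane_abab.some
  obtain ⟨m, hm⟩ := circle_lift_sub (g₁ := fun t : unitInterval => g (t, 0))
    (g₂ := fun t => g (unitInterval.symm t, 1)) (by fun_prop) (by fun_prop) fun t => by
      simpa [side] using hgl _ _ (Glue.same 0 2 t (by decide) rfl (by decide))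
  obtain ⟨n, hn⟩ := circle_lift_sub (g₁ := fun t : unitInterval => g (1, t))
    (g₂ := fun t => g (0, unitInterval.symm t)) (by fun_prop) (by fun_prop) fun t => by
      simpa [side] using hgl _ _ (Glue.same 1 3 t (by decide) rfl (by decide))
  -- At the corners, `g (1, 0) - g (0, 1)` equals both jumps, while `g (0, 0) - g (1, 1)` equals the
  -- first and minus the second. Hence both jumps vanish.
  have m0 := hm 0
  have m1 := hm 1
  have n0 := hn 0
  have n1 := hn 1
  simp only [unitInterval.symm_one, unitInterval.symm_zero] at m0 m1 n0 n1
  have m2 : (m : ℝ) * (2 * π) = 0 := by linarith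
  have n2 : (n : ℝ) * (2 * π) = 0 := by linarith
  refine respects_glue _ fun i j hij h t => ?_
  fin_cases i <;> fin_cases j <;> simp [listed] at hij h
  · simpa [listed, side, m2] using hm t
  · simpa [listed, side, n2] using hn t

/-- Orientability and the number of boundary components leave two ambiguous pairs, sphere and torus,
projective plane and Klein bottle; `AngleLifts` holds for the first member of each pair and fails
for the second. -/
theorem model_injective (s t : SurfaceType) (h : Nonempty (s.model ≃ₜ t.model)) : s = t := by
  obtain ⟨e⟩ := h
  have ho : s.orientable = t.orientable := by
    have := IsOrientable.congr e
    rw [isOrientable_model, isOrientable_model] at this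
    exact Bool.eq_iff_iff.2 this
  have hb : s.boundaryCount = t.boundaryCount := by
    have := boundaryComponents_congr e
    rw [boundaryComponents_model, boundaryComponents_model] at this
    exact_mod_cast this
  have hl : AngleLifts s.model ↔ AngleLifts t.model := ⟨fun h => h.congr e, fun h => h.congr e.symm⟩
  cases s <;> cases t <;>
    simp only [SurfaceType.orientable, SurfaceType.boundaryCount, reduceCtorEq,
      OfNat.ofNat_ne_zero, OfNat.zero_ne_ofNat, OfNat.one_ne_ofNat, OfNat.ofNat_ne_one,
      zero_ne_one, one_ne_zero] at ho hb <;>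
    first
    | rfl
    | exact absurd (hl.1 angleLifts_sphere) not_angleLifts_torus
    | exact absurd (hl.2 angleLifts_sphere) not_angleLifts_torus
    | exact absurd (hl.1 angleLifts_projectivePlane) not_angleLifts_kleinBottle
    | exact absurd (hl.2 angleLifts_projectivePlane) not_angleLifts_kleinBottle

end AngleLifts

/-! ### Gluing schemes up to equivalence -/

section SchemeClasses

set_option linter.unusedSimpArgs false

/-- The number of sides `i` that are glued to the side `i + d`, with equal exponents if `b` is
false and with different exponents if `b` is true. -/
def gluedPairs (w : GluingScheme) (d : Fin 4) (b : Bool) : ℕ :=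
  (Finset.univ.filter fun i : Fin 4 =>
    (w.word i).1 = (w.word (i + d)).1 ∧ xor (w.word i).2 (w.word (i + d)).2 = b).card

theorem Move.gluedPairs_eq {w w' : GluingScheme} (h : Move w w') (d : Fin 4) (b : Bool) :
    gluedPairs w d b = gluedPairs w' d b := by
  cases h with
  | relabel ρ s h =>
    refine congrArg Finset.card (Finset.filter_congr fun i _ => ?_)
    rw [h, h, ρ.injective.eq_iff]
    refine and_congr_right fun e => ?_
    rw [e]
    cases (w.word i).2 <;> cases (w.word (i + d)).2 <;> cases s _ <;> simp
  | permute h =>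
    refine Finset.card_equiv (Equiv.subRight 1) fun i => ?_
    simp only [Finset.mem_filter_univ, Equiv.subRight_apply, h]
    rw [show i - 1 + d + 1 = i + d by abel, sub_add_cancel]
  | flip h =>
    -- A reflection exchanges the ends of a pair, so the reflected pair starts at the image of `i +
    -- d`.
    refine Finset.card_equiv ((Equiv.addRight d).trans Fin.revPerm) fun i => ?_
    simp only [Finset.mem_filter_univ, Equiv.trans_apply, Equiv.coe_addRight, Fin.revPerm_apply, h]
    rw [show (Fin.rev (i + d) + d).rev = i by decide +revert, Fin.rev_rev]
    refine and_congr eq_comm ?_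
    cases (w.word i).2 <;> cases (w.word (i + d)).2 <;> simp

theorem gluedPairs_eq_of_equiv {w w' : GluingScheme} (h : schemeSetoid w w') (d : Fin 4)
    (b : Bool) : gluedPairs w d b = gluedPairs w' d b := by
  induction h with
  | rel _ _ h => exact h.gluedPairs_eq d b
  | refl => rfl
  | symm _ _ _ ih => exact ih.symm
  | trans _ _ _ _ _ ih₁ ih₂ => exact ih₁.trans ih₂

theorem listed_injective_of_gluedPairs : ∀ k l : Fin 10,
    gluedPairs (listed k) 1 false = gluedPairs (listed l) 1 false →
    gluedPairs (listed k) 1 true = gluedPairs (listed l) 1 true →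
    gluedPairs (listed k) 2 false = gluedPairs (listed l) 2 false →
    gluedPairs (listed k) 2 true = gluedPairs (listed l) 2 true → k = l := by
  decide

theorem listed_class_injective : Function.Injective fun k : Fin 10 =>
    (Quotient.mk schemeSetoid (listed k) : SchemeClass) := fun k l h => by
  have h' := gluedPairs_eq_of_equiv (Quotient.exact h)
  exact listed_injective_of_gluedPairs k l (h' 1 false) (h' 1 true) (h' 2 false) (h' 2 true)

/-- The matching of finitely many letters extends to all of `ℕ`, because the unused letters on both
sides form countably infinite sets. -/
theorem exists_perm_extending {ι : Type*} [Finite ι] {f g : ι → ℕ}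
    (h : ∀ i j, f i = f j ↔ g i = g j) : ∃ ρ : Equiv.Perm ℕ, ∀ i, ρ (f i) = g i := by
  classical
  let F : Quotient (Setoid.ker f) → ℕ := Quotient.lift f fun _ _ h => h
  let G : Quotient (Setoid.ker f) → ℕ := Quotient.lift g fun i j e => (h i j).1 e
  have hF : Function.Injective F := by
    rintro ⟨i⟩ ⟨j⟩ e
    exact Quotient.sound e
  have hG : Function.Injective G := by
    rintro ⟨i⟩ ⟨j⟩ e
    exact Quotient.sound ((h i j).2 e)
  let e₁ : {n // n ∈ range F} ≃ {n // n ∈ range G} :=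
    (Equiv.ofInjective F hF).symm.trans (Equiv.ofInjective G hG)
  have : Infinite {n // ¬ n ∈ range F} := (finite_range F).infinite_compl.to_subtype
  have : Infinite {n // ¬ n ∈ range G} := (finite_range G).infinite_compl.to_subtype
  obtain ⟨e₂⟩ := nonempty_equiv_of_countable (α := {n // ¬ n ∈ range F}) (β := {n // ¬ n ∈ range G})
  refine ⟨Equiv.subtypeCongr e₁ e₂, fun i => ?_⟩
  have hi : f i ∈ range F := ⟨Quotient.mk _ i, rfl⟩
  have : (⟨f i, hi⟩ : range F) = Equiv.ofInjective F hF (Quotient.mk _ i) := rfl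
  simp only [Equiv.subtypeCongr, Equiv.trans_apply, Equiv.sumCompl_symm_apply_of_pos hi,
    Equiv.sumCongr_apply, Sum.map_inl, Equiv.sumCompl_apply_inl, e₁, this, Equiv.symm_apply_apply]
  rfl

/-- Coincidences of letters and relative exponents are a complete invariant for relabeling. A letter
has to be inverted if one side that carries it changes its exponent, and then every such side does.
-/
theorem move_of_pattern {w w' : GluingScheme}
    (h : ∀ i j, i < j → ((w.word i).1 = (w.word j).1 ↔ (w'.word i).1 = (w'.word j).1))
    (he : ∀ i j, i < j → (w.word i).1 = (w.word j).1 →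
      xor (w.word i).2 (w.word j).2 = xor (w'.word i).2 (w'.word j).2) : Move w w' := by
  classical
  obtain ⟨ρ, hρ⟩ := exists_perm_extending (f := fun i => (w.word i).1)
    (g := fun i => (w'.word i).1) fun i j => by
      rcases lt_trichotomy i j with hij | rfl | hij
      · exact h i j hij
      · simp
      · rw [eq_comm, h j i hij, eq_comm]
  have he' : ∀ i j, (w.word i).1 = (w.word j).1 →
      xor (w.word i).2 (w'.word i).2 = xor (w.word j).2 (w'.word j).2 := by
    have aux : ∀ i j, i < j → (w.word i).1 = (w.word j).1 →
        xor (w.word i).2 (w'.word i).2 = xor (w.word j).2 (w'.word j).2 := fun i j hij hl => by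
      have := he i j hij hl
      revert this
      cases (w.word i).2 <;> cases (w.word j).2 <;> cases (w'.word i).2 <;>
        cases (w'.word j).2 <;> simp
    intro i j hl
    rcases lt_trichotomy i j with hij | rfl | hij
    · exact aux i j hij hl
    · rfl
    · exact (aux j i hij hl.symm).symm
  refine .relabel w w' ρ
    (fun a => decide (∃ i, (w.word i).1 = a ∧ xor (w.word i).2 (w'.word i).2 = true)) fun i => ?_
  refine Prod.ext (hρ i).symm ?_
  have : decide (∃ j, (w.word j).1 = (w.word i).1 ∧ xor (w.word j).2 (w'.word j).2 = true) =
      xor (w.word i).2 (w'.word i).2 := by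
    rw [Bool.eq_iff_iff, decide_eq_true_iff]
    exact ⟨fun ⟨j, hj, hx⟩ => (he' j i hj) ▸ hx, fun hx => ⟨i, rfl, hx⟩⟩
  simp only [this]
  cases (w.word i).2 <;> simp

/-- The scheme read from side `i` on. -/
def GluingScheme.rotate (w : GluingScheme) (i : Fin 4) : GluingScheme where
  word k := w.word (k + i)
  at_most_twice a b c hab hbc hac := w.at_most_twice _ _ _
    (by simpa using hab) (by simpa using hbc) (by simpa using hac)
  glued := by
    obtain ⟨a, b, hab, h⟩ := w.glued
    exact ⟨a - i, b - i, by simpa using hab, by simpa using h⟩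

theorem equiv_rotate (w : GluingScheme) (i : Fin 4) : schemeSetoid w (w.rotate i) := by
  have step : ∀ j, schemeSetoid (w.rotate j) (w.rotate (j + 1)) := fun j =>
    .rel _ _ (.permute _ _ fun k => congrArg w.word (by abel))
  have h0 : schemeSetoid w (w.rotate 0) := .rel _ _
    (move_of_pattern (by simp [GluingScheme.rotate]) (by simp [GluingScheme.rotate]))
  have h1 := schemeSetoid.trans h0 (step 0)
  have h2 := schemeSetoid.trans h1 (step 1)
  have h3 := schemeSetoid.trans h2 (step 2)
  fin_cases i
  exacts [h0, h1, h2, h3]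

theorem exists_glued_rotate (w : GluingScheme) : ∃ i : Fin 4,
    ((w.rotate i).word 0).1 = ((w.rotate i).word 1).1 ∨
      ((w.rotate i).word 0).1 = ((w.rotate i).word 2).1 := by
  obtain ⟨i, j, hij, h⟩ := w.glued
  simp only [GluingScheme.rotate, zero_add]
  obtain h' | h' | h' : j = 1 + i ∨ j = 2 + i ∨ i = 1 + j := by
    clear h
    decide +revert
  · exact ⟨i, Or.inl (h' ▸ h)⟩
  · exact ⟨i, Or.inr (h' ▸ h)⟩
  · exact ⟨j, Or.inl (h' ▸ h.symm)⟩

theorem exists_listed_of_adjacent (w : GluingScheme) (h : (w.word 0).1 = (w.word 1).1) :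
    ∃ k, schemeSetoid w (listed k) := by
  have a : (w.word 1).1 ≠ (w.word 2).1 := fun e =>
    w.at_most_twice 0 1 2 (by decide) (by decide) (by decide) ⟨h, e⟩
  have b : (w.word 1).1 ≠ (w.word 3).1 := fun e =>
    w.at_most_twice 0 1 3 (by decide) (by decide) (by decide) ⟨h, e⟩
  have of_move : ∀ {w' : GluingScheme} k, Move w' (listed k) → schemeSetoid w w' →
      ∃ k, schemeSetoid w (listed k) := fun k hm hw => ⟨k, schemeSetoid.trans hw (.rel _ _ hm)⟩
  have a' := a.symm
  have b' := b.symm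
  by_cases c : (w.word 2).1 = (w.word 3).1 <;> by_cases e : (w.word 0).2 = (w.word 1).2 <;>
    by_cases e' : (w.word 2).2 = (w.word 3).2
  · refine of_move 4 (move_of_pattern ?_ ?_) (schemeSetoid.refl w) <;> intro i j hij <;>
      fin_cases i <;> fin_cases j <;> simp [listed, h, a, b, a', b', c, e, e'] at hij ⊢
  -- The pattern `a a b b⁻¹` becomes `b b⁻¹ a a` after a half turn.
  · refine of_move 2 (move_of_pattern ?_ ?_) (equiv_rotate w 2) <;> intro i j hij <;>
      fin_cases i <;> fin_cases j <;> simp [GluingScheme.rotate, listed, h, a, b, a', b', c, e, e'] at hij ⊢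
  · refine of_move 2 (move_of_pattern ?_ ?_) (schemeSetoid.refl w) <;> intro i j hij <;>
      fin_cases i <;> fin_cases j <;> simp [listed, h, a, b, a', b', c, e, e'] at hij ⊢
  · refine of_move 1 (move_of_pattern ?_ ?_) (schemeSetoid.refl w) <;> intro i j hij <;>
      fin_cases i <;> fin_cases j <;> simp [listed, h, a, b, a', b', c, e, e'] at hij ⊢
  · refine of_move 3 (move_of_pattern ?_ ?_) (schemeSetoid.refl w) <;> intro i j hij <;>
      fin_cases i <;> fin_cases j <;> simp [listed, h, a, b, a', b', c, e, e'] at hij ⊢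
  · refine of_move 3 (move_of_pattern ?_ ?_) (schemeSetoid.refl w) <;> intro i j hij <;>
      fin_cases i <;> fin_cases j <;> simp [listed, h, a, b, a', b', c, e, e'] at hij ⊢
  · refine of_move 0 (move_of_pattern ?_ ?_) (schemeSetoid.refl w) <;> intro i j hij <;>
      fin_cases i <;> fin_cases j <;> simp [listed, h, a, b, a', b', c, e, e'] at hij ⊢
  · refine of_move 0 (move_of_pattern ?_ ?_) (schemeSetoid.refl w) <;> intro i j hij <;>
      fin_cases i <;> fin_cases j <;> simp [listed, h, a, b, a', b', c, e, e'] at hij ⊢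

theorem exists_listed_of_opposite (w : GluingScheme) (h : (w.word 0).1 = (w.word 2).1) :
    ∃ k, schemeSetoid w (listed k) := by
  have a : (w.word 2).1 ≠ (w.word 1).1 := fun e =>
    w.at_most_twice 0 2 1 (by decide) (by decide) (by decide) ⟨h, e⟩
  have b : (w.word 2).1 ≠ (w.word 3).1 := fun e =>
    w.at_most_twice 0 2 3 (by decide) (by decide) (by decide) ⟨h, e⟩
  have of_move : ∀ {w' : GluingScheme} k, Move w' (listed k) → schemeSetoid w w' →
      ∃ k, schemeSetoid w (listed k) := fun k hm hw => ⟨k, schemeSetoid.trans hw (.rel _ _ hm)⟩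
  have a' := a.symm
  have b' := b.symm
  by_cases c : (w.word 1).1 = (w.word 3).1 <;> by_cases e : (w.word 0).2 = (w.word 2).2 <;>
    by_cases e' : (w.word 1).2 = (w.word 3).2
  · refine of_move 9 (move_of_pattern ?_ ?_) (schemeSetoid.refl w) <;> intro i j hij <;>
      fin_cases i <;> fin_cases j <;> simp [listed, h, a, b, a', b', c, e, e'] at hij ⊢
  -- The pattern `a b a b⁻¹` becomes `b a b⁻¹ a` after a quarter turn.
  · refine of_move 7 (move_of_pattern ?_ ?_) (equiv_rotate w 1) <;> intro i j hij <;>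
      fin_cases i <;> fin_cases j <;> simp [GluingScheme.rotate, listed, h, a, b, a', b', c, e, e'] at hij ⊢
  · refine of_move 7 (move_of_pattern ?_ ?_) (schemeSetoid.refl w) <;> intro i j hij <;>
      fin_cases i <;> fin_cases j <;> simp [listed, h, a, b, a', b', c, e, e'] at hij ⊢
  · refine of_move 6 (move_of_pattern ?_ ?_) (schemeSetoid.refl w) <;> intro i j hij <;>
      fin_cases i <;> fin_cases j <;> simp [listed, h, a, b, a', b', c, e, e'] at hij ⊢
  · refine of_move 8 (move_of_pattern ?_ ?_) (schemeSetoid.refl w) <;> intro i j hij <;>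
      fin_cases i <;> fin_cases j <;> simp [listed, h, a, b, a', b', c, e, e'] at hij ⊢
  · refine of_move 8 (move_of_pattern ?_ ?_) (schemeSetoid.refl w) <;> intro i j hij <;>
      fin_cases i <;> fin_cases j <;> simp [listed, h, a, b, a', b', c, e, e'] at hij ⊢
  · refine of_move 5 (move_of_pattern ?_ ?_) (schemeSetoid.refl w) <;> intro i j hij <;>
      fin_cases i <;> fin_cases j <;> simp [listed, h, a, b, a', b', c, e, e'] at hij ⊢
  · refine of_move 5 (move_of_pattern ?_ ?_) (schemeSetoid.refl w) <;> intro i j hij <;>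
      fin_cases i <;> fin_cases j <;> simp [listed, h, a, b, a', b', c, e, e'] at hij ⊢

theorem exists_equiv_listed (w : GluingScheme) : ∃ k, schemeSetoid w (listed k) := by
  obtain ⟨i, h | h⟩ := exists_glued_rotate w
  · obtain ⟨k, hk⟩ := exists_listed_of_adjacent _ h
    exact ⟨k, schemeSetoid.trans (equiv_rotate w i) hk⟩
  · obtain ⟨k, hk⟩ := exists_listed_of_opposite _ h
    exact ⟨k, schemeSetoid.trans (equiv_rotate w i) hk⟩

theorem listed_class_bijective : Function.Bijective fun k : Fin 10 =>
    (Quotient.mk schemeSetoid (listed k) : SchemeClass) :=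
  ⟨listed_class_injective, Quotient.ind fun w => (exists_equiv_listed w).imp fun _ hk =>
    Quotient.sound (schemeSetoid.symm hk)⟩

end SchemeClasses

/-! ### Moves induce homeomorphisms -/

section MoveHomeomorph

theorem Glue.map {w w' : GluingScheme} {φ : Square → Square} {p : Fin 4 → Fin 4}
    {r : unitInterval → unitInterval} (hp : Function.Injective p)
    (hr : ∀ t, r (unitInterval.symm t) = unitInterval.symm (r t))
    (hφ : ∀ i t, φ (side i t) = side (p i) (r t))
    (hl : ∀ i j, (w'.word i).1 = (w'.word j).1 → (w.word (p i)).1 = (w.word (p j)).1 ∧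
      ((w'.word i).2 = (w'.word j).2 ↔ (w.word (p i)).2 = (w.word (p j)).2))
    {x y : Square} (h : Glue w' x y) : Glue w (φ x) (φ y) := by
  cases h with
  | same i j t hij h he =>
    rw [hφ, hφ]
    exact .same _ _ _ (hp.ne hij) (hl i j h).1 ((hl i j h).2.1 he)
  | opposite i j t hij h he =>
    rw [hφ, hφ, hr]
    exact .opposite _ _ _ (hp.ne hij) (hl i j h).1 fun e => he ((hl i j h).2.2 e)

/-- A homeomorphism of the square that permutes the sides compatibly with two schemes induces a
homeomorphism of the glued surfaces. -/
theorem exists_surface_homeomorph {w w' : GluingScheme} (φ : Square ≃ₜ Square)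
    (p : Equiv.Perm (Fin 4)) (r : unitInterval ≃ unitInterval)
    (hr : ∀ t, r (unitInterval.symm t) = unitInterval.symm (r t))
    (hφ : ∀ i t, φ (side i t) = side (p i) (r t))
    (hl : ∀ i j, ((w'.word i).1 = (w'.word j).1 ↔ (w.word (p i)).1 = (w.word (p j)).1))
    (he : ∀ i j, (w'.word i).1 = (w'.word j).1 →
      ((w'.word i).2 = (w'.word j).2 ↔ (w.word (p i)).2 = (w.word (p j)).2)) :
    ∃ e : Surface w' ≃ₜ Surface w, ∀ x, e (proj w' x) = proj w (φ x) := by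
  have h₁ : ∀ x y, Glue w' x y → Glue w (φ x) (φ y) := fun x y =>
    Glue.map p.injective hr hφ fun i j h => ⟨(hl i j).1 h, he i j h⟩
  have h₂ : ∀ x y, Glue w x y → Glue w' (φ.symm x) (φ.symm y) := fun x y =>
    Glue.map (r := r.symm) p.symm.injective
      (fun t => r.injective (by rw [hr, Equiv.apply_symm_apply, Equiv.apply_symm_apply]))
      (fun i t => by
        rw [Homeomorph.symm_apply_eq, hφ, Equiv.apply_symm_apply, Equiv.apply_symm_apply])
      fun i j h => by
        have h' := (hl (p.symm i) (p.symm j)).2 (by simpa using h)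
        exact ⟨h', by simpa using (he _ _ h').symm⟩
  exact ⟨{
    toFun := Quot.map φ h₁
    invFun := Quot.map φ.symm h₂
    left_inv := Quot.ind fun x => by simp [Quot.map]
    right_inv := Quot.ind fun x => by simp [Quot.map]
    continuous_toFun := continuous_quot_lift _ (continuous_quot_mk.comp φ.continuous)
    continuous_invFun := continuous_quot_lift _ (continuous_quot_mk.comp φ.symm.continuous) },
    fun x => rfl⟩

theorem side_one (i : Fin 4) : side i 1 = side (i + 1) 0 := by
  fin_cases i <;> simp [side]

/-- The rotation of the square by a quarter turn. -/
def squareRotation : Square ≃ₜ Square where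
  toFun x := (unitInterval.symm x.2, x.1)
  invFun x := (x.2, unitInterval.symm x.1)
  left_inv x := by simp
  right_inv x := by simp
  continuous_toFun := by fun_prop
  continuous_invFun := by fun_prop

theorem squareRotation_side (i : Fin 4) (t : unitInterval) :
    squareRotation (side i t) = side (i + 1) t := by
  fin_cases i <;> simp [side, squareRotation]

theorem prodComm_side (i : Fin 4) (t : unitInterval) :
    Homeomorph.prodComm _ _ (side i t) = side i.rev (unitInterval.symm t) := by
  fin_cases i <;> simp [side, Fin.rev]

/-- Each move is realised by the identity, a rotation or a reflection of the square. The permutation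
of the corners is recorded for the count of vertices. Under the reflection, side `i` starts where
side `i.rev` ends, whence the extra shift by 1. -/
theorem Move.exists_homeomorph {w w' : GluingScheme} (h : Move w w') :
    ∃ (e : Surface w' ≃ₜ Surface w) (k : Equiv.Perm (Fin 4)),
      ∀ i, e (proj w' (side i 0)) = proj w (side (k i) 0) := by
  cases h with
  | relabel ρ s h =>
    obtain ⟨e, he⟩ := exists_surface_homeomorph (w := w) (w' := w') (Homeomorph.refl _)
      (Equiv.refl _) (Equiv.refl _) (fun _ => rfl) (fun _ _ => rfl) (fun i j => by simp [h])
      (fun i j hij => by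
        rw [h, h, ρ.injective.eq_iff] at hij
        simp [h, hij])
    exact ⟨e, Equiv.refl _, fun i => he _⟩
  | permute h =>
    obtain ⟨e, he⟩ := exists_surface_homeomorph (w := w) (w' := w') squareRotation
      (Equiv.addRight 1) (Equiv.refl _) (fun _ => rfl) squareRotation_side
      (fun i j => by simp [h]) (fun i j hij => by simp [h])
    exact ⟨e, Equiv.addRight 1, fun i => by rw [he, squareRotation_side]; rfl⟩
  | flip h =>
    obtain ⟨e, he⟩ := exists_surface_homeomorph (w := w) (w' := w') (Homeomorph.prodComm _ _)
      Fin.revPerm unitInterval.symmHomeomorph.toEquiv (fun _ => rfl) prodComm_side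
      (fun i j => by simp [h]) (fun i j hij => by simp [h])
    refine ⟨e, Fin.revPerm.trans (Equiv.addRight 1), fun i => ?_⟩
    rw [he, prodComm_side, unitInterval.symm_zero, side_one]
    rfl

theorem surface_homeomorph_of_equiv {w w' : GluingScheme} (h : schemeSetoid w w') :
    Nonempty (Surface w ≃ₜ Surface w') := by
  induction h with
  | rel _ _ h => exact ⟨h.exists_homeomorph.choose.symm⟩
  | refl => exact ⟨Homeomorph.refl _⟩
  | symm _ _ _ ih => exact ⟨ih.some.symm⟩
  | trans _ _ _ _ _ ih₁ ih₂ => exact ⟨ih₁.some.trans ih₂.some⟩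

end MoveHomeomorph

/-! ### Counting vertices, edges and faces -/

section EulerCharacteristic

theorem proj_glue_iff {w : GluingScheme} {P : Square → Prop}
    (hP : ∀ x y, Glue w x y → (P x ↔ P y)) {x y : Square} (h : proj w x = proj w y) :
    P x ↔ P y :=
  iff_of_eq (congrArg (Quot.lift P fun x y hxy => propext (hP x y hxy)) h)

/-- A property of the points of the sides that is symmetric under the gluings is well-defined on the
surface. -/
theorem proj_eq_imp {w : GluingScheme} {P : Square → Prop} (Q : Fin 4 → unitInterval → Prop)
    (hPQ : ∀ i t, P (side i t) ↔ Q i t)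
    (h : ∀ i j t, i ≠ j → (w.word i).1 = (w.word j).1 →
      ((w.word i).2 = (w.word j).2 → (Q i t ↔ Q j t)) ∧
      ((w.word i).2 ≠ (w.word j).2 → (Q i t ↔ Q j (unitInterval.symm t)))) {x y : Square}
    (hxy : proj w x = proj w y) : P x ↔ P y := by
  refine proj_glue_iff (fun x y hg => ?_) hxy
  cases hg with
  | same i j t hij hl he => rw [hPQ, hPQ]; exact (h i j t hij hl).1 he
  | opposite i j t hij hl he => rw [hPQ, hPQ]; exact (h i j t hij hl).2 he

theorem mem_range_side_iff (x : Square) :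
    x ∈ ⋃ i, range (side i) ↔ x.1 = 0 ∨ x.1 = 1 ∨ x.2 = 0 ∨ x.2 = 1 := by
  obtain ⟨s, t⟩ := x
  simp only [mem_iUnion, mem_range]
  constructor
  · rintro ⟨i, u, h⟩
    fin_cases i <;> simp only [side, Prod.mk.injEq] at h <;> obtain ⟨rfl, rfl⟩ := h <;> simp
  · rintro (h | h | h | h) <;> subst h
    · exact ⟨3, unitInterval.symm t, by simp [side]⟩
    · exact ⟨1, t, rfl⟩
    · exact ⟨0, s, rfl⟩
    · exact ⟨2, unitInterval.symm s, by simp [side]⟩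

/-- Only points of sides are glued, so lying on the boundary of the square is well-defined on the
surface. The complement is the image of the connected open square, which leaves a single face. -/
theorem compl_graph (w : GluingScheme) :
    (graph w)ᶜ = proj w '' (Ioo 0 1 ×ˢ Ioo 0 1) := by
  have mem : ∀ x, proj w x ∈ graph w ↔ x ∈ ⋃ i, range (side i) := by
    intro x
    refine ⟨fun h => ?_, fun h => ?_⟩
    · obtain ⟨i, _, ⟨t, rfl⟩, h⟩ := mem_iUnion.1 h
      exact (proj_eq_imp (P := fun x => x ∈ ⋃ i, range (side i)) (fun _ _ => True)
        (fun i t => iff_true_intro (mem_iUnion.2 ⟨i, t, rfl⟩)) (by simp) h).1 (mem_iUnion.2 ⟨i, t, rfl⟩)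
    · obtain ⟨i, hi⟩ := mem_iUnion.1 h
      exact mem_iUnion.2 ⟨i, x, hi, rfl⟩
  ext y
  obtain ⟨x, rfl⟩ : ∃ x, proj w x = y := Quot.exists_rep y
  have hx : ∀ x, x ∉ ⋃ i, range (side i) ↔
      x ∈ Ioo (0 : unitInterval) 1 ×ˢ Ioo (0 : unitInterval) 1 := fun x => by
    rw [mem_range_side_iff]
    simp only [mem_prod, mem_Ioo, unitInterval.pos_iff_ne_zero, unitInterval.lt_one_iff_ne_one]
    tauto
  rw [mem_compl_iff, mem]
  refine ⟨fun h => ⟨x, (hx x).1 h, rfl⟩, ?_⟩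
  rintro ⟨x', hx', h⟩
  rw [← mem, ← h, mem]
  exact (hx x').2 hx'

theorem card_faces (w : GluingScheme) : Nat.card (ConnectedComponents ↥(graph w)ᶜ) = 1 := by
  have : IsConnected (graph w)ᶜ := by
    rw [compl_graph]
    refine IsConnected.image (IsConnected.prod ?_ ?_) _ continuous_quot_mk.continuousOn <;>
      exact isConnected_Ioo zero_lt_one
  have : ConnectedSpace ↥(graph w)ᶜ := isConnected_iff_connectedSpace.1 this
  exact Nat.card_eq_one_iff_unique.2 ⟨inferInstance, inferInstance⟩

/-- The midpoint of the unit interval. -/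
noncomputable def half : unitInterval := ⟨1 / 2, by norm_num, by norm_num⟩

theorem symm_eq_half {t : unitInterval} : unitInterval.symm t = half ↔ t = half := by
  simp only [Subtype.ext_iff, coe_symm_eq, half]
  constructor <;> intro h <;> linarith

theorem side_eq_midpoint (i j : Fin 4) (t : unitInterval) :
    side i t = side j half ↔ i = j ∧ t = half := by
  have h : unitInterval.symm half = half := symm_eq_half.2 rfl
  have h0 : half ≠ 0 := fun h => by simpa [half] using congrArg Subtype.val h
  have h1 : half ≠ 1 := fun h => by
    have := congrArg Subtype.val h
    norm_num [half] at this
  fin_cases i <;> fin_cases j <;> simp [side, h, h0.symm, h1.symm, symm_eq_half]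

theorem side_eq_corner (i j : Fin 4) (t : unitInterval) :
    side i t = side j 0 ↔ (i = j ∧ t = 0) ∨ (i + 1 = j ∧ t = 1) := by
  fin_cases i <;> fin_cases j <;> simp [side]

/-- The midpoint parameter is fixed by `unitInterval.symm`, so the midpoint of a side is identified
only with midpoints of sides with the same letter. The image of a side therefore remembers its
letter. -/
theorem image_side_eq_iff (w : GluingScheme) (i j : Fin 4) :
    proj w '' range (side i) = proj w '' range (side j) ↔ (w.word i).1 = (w.word j).1 := by
  constructor
  · intro h
    obtain ⟨_, ⟨t, rfl⟩, h⟩ : proj w (side i half) ∈ proj w '' range (side j) :=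
      h ▸ ⟨_, ⟨half, rfl⟩, rfl⟩
    have := (proj_eq_imp (P := fun x => ∃ k, x = side k half ∧ (w.word k).1 = (w.word i).1)
      (fun k t => t = half ∧ (w.word k).1 = (w.word i).1)
      (fun k t => by simp [side_eq_midpoint, and_assoc])
      (fun a b t _ hl => by simp [hl, symm_eq_half]) h).2 ⟨i, rfl, rfl⟩
    obtain ⟨k, hk, hl⟩ := this
    rw [side_eq_midpoint] at hk
    rw [← hl, hk.1]
  · have sub : ∀ i j, (w.word i).1 = (w.word j).1 →
        proj w '' range (side i) ⊆ proj w '' range (side j) := by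
      rintro i j h _ ⟨_, ⟨t, rfl⟩, rfl⟩
      by_cases hij : i = j
      · exact hij ▸ ⟨_, ⟨t, rfl⟩, rfl⟩
      by_cases he : (w.word i).2 = (w.word j).2
      · exact ⟨_, ⟨t, rfl⟩, (proj_same w i j hij h he t).symm⟩
      · exact ⟨_, ⟨_, rfl⟩, (proj_opposite w i j hij h he t).symm⟩
    exact fun h => (sub i j h).antisymm (sub j i h.symm)

theorem ncard_range_eq {ι α β : Type*} [Nonempty β] {f : ι → α} {g : ι → β}
    (h : ∀ i j, f i = f j ↔ g i = g j) : (range f).ncard = (range g).ncard := by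
  have hg : g.FactorsThrough f := fun i j e => (h i j).1 e
  let b : α → β := fun _ => Classical.arbitrary β
  have hb : ∀ i, Function.extend f g b (f i) = g i := hg.extend_apply b
  have : range g = Function.extend f g b '' range f := by
    rw [← range_comp]
    exact congrArg range (funext fun i => (hb i).symm)
  rw [this, InjOn.ncard_image]
  rintro _ ⟨i, rfl⟩ _ ⟨j, rfl⟩ e
  rw [hb, hb] at e
  exact (h i j).2 e

theorem ncard_range_eq_card {α : Type*} {β : Type*} [Nonempty β] [DecidableEq β] {f : Fin 4 → α}
    {g : Fin 4 → β} (h : ∀ i j, f i = f j ↔ g i = g j) :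
    (range f).ncard = (Finset.univ.image g).card := by
  rw [ncard_range_eq h, ← ncard_coe_finset, Finset.coe_image, Finset.coe_univ, image_univ]

theorem card_edges (w : GluingScheme) : (range fun i => proj w '' range (side i)).ncard =
    (Finset.univ.image fun i => (w.word i).1).card :=
  ncard_range_eq_card (image_side_eq_iff w)

theorem Move.eulerCharacteristic_eq {w w' : GluingScheme} (h : Move w w') :
    eulerCharacteristic w = eulerCharacteristic w' := by
  have hV : (range fun i => proj w (side i 0)).ncard =
      (range fun i => proj w' (side i 0)).ncard := by
    obtain ⟨e, k, hk⟩ := h.exists_homeomorph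
    rw [← ncard_image_of_injective _ e.injective, ← range_comp, ← k.surjective.range_comp]
    exact congrArg _ (congrArg _ (funext fun i => (hk i).symm))
  have hE : (Finset.univ.image fun i => (w.word i).1).card =
      (Finset.univ.image fun i => (w'.word i).1).card := by
    have perm : ∀ k : Equiv.Perm (Fin 4), (Finset.univ.image fun i => (w.word (k i)).1) =
        Finset.univ.image fun i => (w.word i).1 := fun k => by
      rw [← Finset.coe_inj]
      simp only [Finset.coe_image, Finset.coe_univ, image_univ]
      exact k.surjective.range_comp fun i => (w.word i).1
    cases h with
    | relabel ρ s h =>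
      simp only [h]
      rw [← Finset.card_image_of_injective _ ρ.injective, Finset.image_image]
      rfl
    | permute h =>
      simp only [h]
      exact congrArg _ (perm (Equiv.addRight 1)).symm
    | flip h =>
      simp only [h]
      exact congrArg _ (perm Fin.revPerm).symm
  rw [eulerCharacteristic, eulerCharacteristic, card_edges, card_edges, card_faces, card_faces, hV,
    hE]

theorem eulerCharacteristic_eq_of_equiv {w w' : GluingScheme} (h : schemeSetoid w w') :
    eulerCharacteristic w = eulerCharacteristic w' := by
  induction h with
  | rel _ _ h => exact h.eulerCharacteristic_eq
  | refl => rfl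
  | symm _ _ _ ih => exact ih.symm
  | trans _ _ _ _ _ ih₁ ih₂ => exact ih₁.trans ih₂

/-- Two corners are identified directly by the gluing of two sides. -/
def CornerGlue (w : GluingScheme) (i j : Fin 4) : Prop :=
  i = j ∨ ∃ a b : Fin 4, a ≠ b ∧ (w.word a).1 = (w.word b).1 ∧
    ((w.word a).2 = (w.word b).2 ∧ (i = a ∧ j = b ∨ i = a + 1 ∧ j = b + 1) ∨
      (w.word a).2 ≠ (w.word b).2 ∧ (i = a ∧ j = b + 1 ∨ i = a + 1 ∧ j = b))

instance (w : GluingScheme) (i j : Fin 4) : Decidable (CornerGlue w i j) :=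
  inferInstanceAs (Decidable (_ ∨ _))

theorem CornerGlue.proj_eq {w : GluingScheme} {i j : Fin 4} (h : CornerGlue w i j) :
    proj w (side i 0) = proj w (side j 0) := by
  obtain rfl | ⟨a, b, hab, hl, ⟨he, h⟩ | ⟨he, h⟩⟩ := h
  · rfl
  · obtain ⟨rfl, rfl⟩ | ⟨rfl, rfl⟩ := h
    · exact proj_same w _ _ hab hl he 0
    · rw [← side_one, ← side_one]
      exact proj_same w _ _ hab hl he 1
  · obtain ⟨rfl, rfl⟩ | ⟨rfl, rfl⟩ := h
    · rw [← side_one]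
      simpa using proj_opposite w _ _ hab hl he 0
    · rw [← side_one]
      simpa using proj_opposite w _ _ hab hl he 1

/-- The vertices can be counted with a function that picks a representative corner for each. -/
theorem card_vertices (w : GluingScheme) (c : Fin 4 → Fin 4)
    (h₁ : ∀ i j, CornerGlue w i j → c i = c j)
    (h₂ : ∀ i, ∃ j, CornerGlue w i j ∧ CornerGlue w j (c i)) :
    (range fun i => proj w (side i 0)).ncard = (Finset.univ.image c).card := by
  have h₃ : ∀ i, proj w (side i 0) = proj w (side (c i) 0) := fun i => by
    obtain ⟨j, hj, hj'⟩ := h₂ i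
    exact hj.proj_eq.trans hj'.proj_eq
  refine ncard_range_eq_card fun i j => ⟨fun h => ?_, fun h => by simp only [h₃ i, h₃ j, h]⟩
  -- By `h₁` the representative of a corner is unchanged under gluing, so it can be read off from
  -- the point of the surface.
  have := (proj_eq_imp (P := fun x => ∃ k, x = side k 0 ∧ c k = c i)
    (fun k t => t = 0 ∧ c k = c i ∨ t = 1 ∧ c (k + 1) = c i)
    (fun k t => by
      simp only [side_eq_corner, or_and_right, exists_or, and_assoc, exists_eq_left'])
    (fun a b t hab hl => ⟨fun he => by
      rw [h₁ a b (Or.inr ⟨a, b, hab, hl, by simp [he]⟩),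
        h₁ (a + 1) (b + 1) (Or.inr ⟨a, b, hab, hl, by simp [he]⟩)], fun he => by
      rw [h₁ a (b + 1) (Or.inr ⟨a, b, hab, hl, by simp [he]⟩),
        h₁ (a + 1) b (Or.inr ⟨a, b, hab, hl, by simp [he]⟩)]
      simp [or_comm]⟩) h).1 ⟨i, rfl, rfl⟩
  obtain ⟨k, hk, hc⟩ := this
  rw [← hc]
  simp only [side_eq_corner, zero_ne_one, and_false, or_false, and_true] at hk
  rw [hk]

/-- The surface of each of the ten listed schemes. -/
def listedType : Fin 10 → SurfaceType :=
  ![.disc, .sphere, .projectivePlane, .moebiusBand, .kleinBottle, .annulus, .torus, .kleinBottle,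
    .moebiusBand, .projectivePlane]

/-- A representative for each class of identified corners of the listed schemes. -/
def listedCorner : Fin 10 → Fin 4 → Fin 4 :=
  ![![0, 1, 0, 3], ![0, 1, 0, 3], ![0, 1, 0, 0], ![0, 0, 0, 3], ![0, 0, 0, 0],
    ![0, 1, 1, 0], ![0, 0, 0, 0], ![0, 0, 0, 0], ![0, 1, 0, 1], ![0, 1, 0, 1]]

theorem eulerCharacteristic_listed (k : Fin 10) :
    eulerCharacteristic (listed k) = (listedType k).chi := by
  rw [eulerCharacteristic, card_edges, card_faces, card_vertices _ (listedCorner k)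
    (by decide +revert) (by decide +revert)]
  fin_cases k <;> rfl

end EulerCharacteristic

/-! ### Assembling the classification -/

section Classification

theorem surface_listed (k : Fin 10) : Nonempty (Surface (listed k) ≃ₜ (listedType k).model) := by
  fin_cases k
  exacts [surface_disc, surface_sphere, surface_projectivePlane_aabb, surface_moebiusBand_aabc,
    surface_kleinBottle_aabb, surface_annulus, surface_torus, surface_kleinBottle_abab,
    surface_moebiusBand_abac, surface_projectivePlane_abab]

theorem surface_listed_iff (k : Fin 10) (s : SurfaceType) :
    Nonempty (Surface (listed k) ≃ₜ s.model) ↔ listedType k = s := by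
  obtain ⟨e⟩ := surface_listed k
  exact ⟨fun ⟨f⟩ => model_injective _ _ ⟨e.symm.trans f⟩, fun h => h ▸ ⟨e⟩⟩

theorem listedType_surjective : Function.Surjective listedType := fun s => by
  cases s
  exacts [⟨1, rfl⟩, ⟨6, rfl⟩, ⟨0, rfl⟩, ⟨5, rfl⟩, ⟨2, rfl⟩, ⟨4, rfl⟩, ⟨3, rfl⟩]

theorem exists_surface_model (w : GluingScheme) : ∃ s : SurfaceType,
    Nonempty (Surface w ≃ₜ s.model) := by
  obtain ⟨k, hk⟩ := exists_equiv_listed w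
  obtain ⟨e⟩ := surface_homeomorph_of_equiv hk
  obtain ⟨f⟩ := surface_listed k
  exact ⟨_, ⟨e.trans f⟩⟩

instance : DecidableEq SurfaceType := fun s t => by
  cases s <;> cases t <;> first | exact isTrue rfl | exact isFalse nofun

theorem card_surfaceType : Nat.card SurfaceType = 7 := by
  let e : Fin 7 → SurfaceType :=
    ![.sphere, .torus, .disc, .annulus, .projectivePlane, .kleinBottle, .moebiusBand]
  have he : Function.Bijective e := by
    refine ⟨by decide, fun s => ?_⟩
    cases s
    exacts [⟨0, rfl⟩, ⟨1, rfl⟩, ⟨2, rfl⟩, ⟨3, rfl⟩, ⟨4, rfl⟩, ⟨5, rfl⟩, ⟨6, rfl⟩]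
  rw [← Nat.card_eq_of_bijective e he, Nat.card_fin]

theorem card_homeomorphism_types : Nat.card (Quotient homeoSetoid) = 7 := by
  rw [← card_surfaceType]
  choose t ht using exists_surface_model
  refine Nat.card_eq_of_bijective (Quotient.lift t fun w w' ⟨e⟩ => model_injective _ _
    ⟨((ht w).some.symm.trans e).trans (ht w').some⟩) ⟨?_, fun s => ?_⟩
  · refine Quotient.ind₂ fun w w' h => Quotient.sound ?_
    have h : t w = t w' := h
    obtain ⟨e⟩ := ht w
    obtain ⟨e'⟩ := ht w'
    exact ⟨e.trans ((h ▸ Homeomorph.refl _ : (t w).model ≃ₜ (t w').model).trans e'.symm)⟩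
  · obtain ⟨k, rfl⟩ := listedType_surjective s
    exact ⟨Quotient.mk _ (listed k), ((surface_listed_iff k _).1 (ht (listed k))).symm⟩

theorem card_schemes (s : SurfaceType) :
    Nat.card {c : SchemeClass // ∃ w : GluingScheme, Quotient.mk schemeSetoid w = c ∧
      Nonempty (Surface w ≃ₜ s.model)} = s.schemeCount := by
  have h : ∀ k : Fin 10, listedType k = s ↔ ∃ w : GluingScheme,
      Quotient.mk schemeSetoid w = Quotient.mk schemeSetoid (listed k) ∧
        Nonempty (Surface w ≃ₜ s.model) := fun k => by
    rw [← surface_listed_iff]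
    refine ⟨fun h => ⟨_, rfl, h⟩, fun ⟨w, hw, ⟨e⟩⟩ => ?_⟩
    obtain ⟨f⟩ := surface_homeomorph_of_equiv (Quotient.exact hw)
    exact ⟨f.symm.trans e⟩
  rw [← Nat.card_congr ((Equiv.ofBijective _ listed_class_bijective).subtypeEquiv h),
    Nat.card_eq_fintype_card]
  cases s <;> rfl

/-- Orientability and boundary components pass along the homeomorphism. The Euler characteristic
belongs to the scheme: it is that of an equivalent listed scheme, whose type must be `s` by
`surface_listed_iff`. -/
theorem invariants_of_surface (w : GluingScheme) (s : SurfaceType)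
    (h : Nonempty (Surface w ≃ₜ s.model)) :
    eulerCharacteristic w = s.chi ∧ (IsOrientable (Surface w) ↔ s.orientable = true) ∧
      boundaryComponents (Surface w) = (s.boundaryCount : ℕ∞) := by
  obtain ⟨e⟩ := h
  refine ⟨?_, (IsOrientable.congr e).trans (isOrientable_model s),
    (boundaryComponents_congr e).trans (boundaryComponents_model s)⟩
  obtain ⟨k, hk⟩ := exists_equiv_listed w
  obtain ⟨f⟩ := surface_homeomorph_of_equiv hk
  rw [eulerCharacteristic_eq_of_equiv hk, eulerCharacteristic_listed,
    (surface_listed_iff k s).1 ⟨f.symm.trans e⟩]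

end Classification

end QuadGluing

theorem mainTheorem3 :
    -- every gluing scheme is equivalent to exactly one of the ten listed ones
    (Function.Bijective fun k : Fin 10 =>
      (Quotient.mk QuadGluing.schemeSetoid (QuadGluing.listed k) : QuadGluing.SchemeClass)) ∧
    -- equivalent gluing schemes give homeomorphic surfaces
    (∀ w w' : QuadGluing.GluingScheme, QuadGluing.schemeSetoid w w' →
      Nonempty (QuadGluing.Surface w ≃ₜ QuadGluing.Surface w')) ∧
    -- there are seven surfaces up to homeomorphism
    Nat.card (Quotient QuadGluing.homeoSetoid) = 7 ∧
    -- the seven standard surfaces are pairwise not homeomorphic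
    (∀ s t : QuadGluing.SurfaceType, Nonempty (s.model ≃ₜ t.model) → s = t) ∧
    -- every glued surface is one of them
    (∀ w : QuadGluing.GluingScheme, ∃ s : QuadGluing.SurfaceType,
      Nonempty (QuadGluing.Surface w ≃ₜ s.model)) ∧
    -- the invariants of the glued surfaces are those of the table
    (∀ (w : QuadGluing.GluingScheme) (s : QuadGluing.SurfaceType),
      Nonempty (QuadGluing.Surface w ≃ₜ s.model) →
        QuadGluing.eulerCharacteristic w = s.chi ∧
        (QuadGluing.IsOrientable (QuadGluing.Surface w) ↔ s.orientable = true) ∧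
        QuadGluing.boundaryComponents (QuadGluing.Surface w) = (s.boundaryCount : ℕ∞)) ∧
    -- the number of gluing schemes, up to equivalence, for each of the seven surfaces
    (∀ s : QuadGluing.SurfaceType,
      Nat.card {c : QuadGluing.SchemeClass // ∃ w : QuadGluing.GluingScheme,
        Quotient.mk QuadGluing.schemeSetoid w = c ∧
          Nonempty (QuadGluing.Surface w ≃ₜ s.model)} = s.schemeCount) :=
  ⟨QuadGluing.listed_class_bijective, fun _ _ => QuadGluing.surface_homeomorph_of_equiv,
    QuadGluing.card_homeomorphism_types, QuadGluing.model_injective,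
    QuadGluing.exists_surface_model, QuadGluing.invariants_of_surface, QuadGluing.card_schemes⟩
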